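/- \textbf{Setting.} A \emph{theory} $T=(\mathcal L,\mathcal T)$ is a countable relational language $\mathcal L$ with a countable set $\mathcal T$ of $\mathcal L_{\omega_1\omega}$-sentences. Its \emph{syntactic Boolean $\omega_1$-pretopos} $\overline{\langle T\rangle}$ is the following category. An object (an \emph{imaginary sort}) $A=(\bigsqcup_i\alpha_i)/(\bigsqcup_{i,j}\varepsilon_{ij})$ consists of countably many $\mathcal L_{\omega_1\omega}$-formulas $\alpha_i(\vec x_i)$ and formulas $\varepsilon_{ij}(\vec x_i,\vec x_j)$ which $\mathcal T$ proves to define an equivalence relation on $\bigsqcup_i\alpha_i$. A morphism $A\to B$ (a \emph{definable function}) is a $\mathcal T$-provable-equivalence class of families of formulas $\varphi_{ik}(\vec x_i,\vec y_k)$ which $\mathcal T$ proves to define the graph of a function from $A$ to $B$. Every formula $\alpha$ is regarded as an imaginary sort; $\mathbb X$ denotes the sort given by the true formula in one variable. A functor between $\omega_1$-pretoposes is \emph{$\omega_1$-coherent} if it preserves finite limits, countable disjoint unions and quotients of equivalence relations. An \emph{interpretation} $F:T\to T'$ is an $\omega_1$-coherent functor $\overline{\langle T\rangle}\to\overline{\langle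 T'\rangle}$. Theories, interpretations and natural isomorphisms form a 2-category $\mathfrak{Thy}$. Let $\mathsf{Count}$ be the category with objects $0,1,2,\dots,\mathbb N$ (initial segments of $\mathbb N$) and all functions; its set $\bigsqcup_{M,N}N^M$ of morphisms carries the evident standard Borel structure. Let $\mathrm{Coh}(T)$ be the groupoid of $\omega_1$-coherent functors $\overline{\langle T\rangle}\to\mathsf{Count}$ and natural isomorphisms; with interpretations acting by precomposition, $F\mapsto F^*$, it is a 2-functor $\mathrm{Coh}:\mathfrak{Thy}^{\mathrm{op}}\to\mathfrak{Gpd}$ to the 2-category of small groupoids. Let $\mathrm{MOD}(T)$ be the groupoid of models of $T$ whose underlying set is an object of $\mathsf{Count}$, and isomorphisms, with Borel structures generated by the sets $\{M : |M|\ge n\}$ and $\{M : \vec a\in M^n,\ R^M(\vec a)\}$ on objects, and by the source and target maps and the sets $\{g : g(k)=l\}$ on morphisms; it is a standard Borel groupoid. Let $\mathfrak{BorGpd}$ be the 2-category of standard Borel groupoids, Borel functors and Borel natural isomorphisms. \textbf{Proposition.} The assignment $T\mapsto\mathrm{MOD}(T)$ extends to a pseudofunctor $\mathrm{MOD}:\mathfrak{Thy}^{\mathrm{op}}\to\mathfrak{BorGpd}$,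 for which there are pseudonatural transformations $K$, from the composite $\mathfrak{Thy}^{\mathrm{op}}\xrightarrow{\mathrm{MOD}}\mathfrak{BorGpd}\to\mathfrak{Gpd}$ to $\mathrm{Coh}$, and $L$, in the opposite direction, which form an adjoint equivalence, with an invertible modification $\zeta: K\circ L\to 1$ as counit, such that for every theory $T$ the components $K_T,L_T,\zeta_T$ satisfy the following. \begin{enumerate} \item[(0)] $L_T$ is the functor $F\mapsto F_*(\mathcal X)$, where $F_*(\mathcal X)$ is the model with underlying set $F(\mathbb X)$ in which an $n$-ary $R\in\mathcal L$ is interpreted as the image of $F(R)\hookrightarrow F(\mathbb X^n)\cong F(\mathbb X)^n$; a natural isomorphism is sent to its component at $\mathbb X$. \item[(i)] $L_T\circ K_T=1$ on the nose, and $\zeta_{T,K_T(M)}=1_{K_T(M)}$ for every $M\in\mathrm{MOD}(T)$. \item[(ii)] For each imaginary sort $A$, the functor $K_T(-)(A):\mathrm{MOD}(T)\to\mathsf{Count}$ is Borel on objects and on morphisms. \item[(iii)] For each definable function $f:A\to B$, the natural transformation $K_T(-)(f)$ is Borel, i.e. $M\mapsto K_T(M)(f)$ is a Borel map. \item[(iv)]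 For each imaginary sort $A$ there is a countable subcategory $S_A\subseteq\overline{\langle T\rangle}$ such that the morphism $\zeta_{T,F,A}:K_T(L_T(F))(A)\to F(A)$ of $\mathsf{Count}$, as $F\in\mathrm{Coh}(T)$ varies, depends only on $F|S_A$, and in a Borel way. \end{enumerate} -/

import Mathlib

open CategoryTheory

namespace Lw1w

/-! ### The logic `L_{ω₁ω}` over a countable relational language -/

/-- A countable relational first-order language. -/
structure RelLang : Type 1 where
  /-- relation symbols -/
  Sym : Type
  arity : Sym → ℕ
  countable : Countable Sym

/-- `L_{ω₁ω}`-formulas in a context of `n` free variables `x_0, …, x_{n-1}`, up to renaming of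
bound variables. Conjunctions and disjunctions range over arbitrary countable (in particular
finite or empty) families, indexed by subsets of `ℕ`. Quantifiers bind the last variable. -/
inductive Formula (L : RelLang) : ℕ → Type
  | rel {n : ℕ} (R : L.Sym) (x : Fin (L.arity R) → Fin n) : Formula L n
  | eq {n : ℕ} (i j : Fin n) : Formula L n
  | neg {n : ℕ} (φ : Formula L n) : Formula L n
  | conj {n : ℕ} (I : Set ℕ) (φ : I → Formula L n) : Formula L n
  | disj {n : ℕ} (I : Set ℕ) (φ : I → Formula L n) : Formula L n
  | all {n : ℕ} (φ : Formula L (n + 1)) : Formula L n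
  | ex {n : ℕ} (φ : Formula L (n + 1)) : Formula L n

/-- A map of variables extended by fixing the last (bound) variable. -/
def liftVar {n m : ℕ} (σ : Fin n → Fin m) : Fin (n + 1) → Fin (m + 1) :=
  Fin.snoc (α := fun _ => Fin (m + 1)) (fun i => (σ i).castSucc) (Fin.last m)

/-- The map of variables replacing the last variable by `x_i`. -/
def instVar {n : ℕ} (i : Fin n) : Fin (n + 1) → Fin n :=
  Fin.snoc (α := fun _ => Fin n) id i

/-- Concatenation of two tuples of variables. -/
def cat {n k m : ℕ} (x : Fin n → Fin m) (y : Fin k → Fin m) : Fin (n + k) → Fin m :=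
  Fin.append x y

namespace Formula

variable {L : RelLang}

/-- Capture-avoiding substitution of variables for variables: `φ(x_{σ 0}, …, x_{σ (n-1)})`. -/
def subst : {n : ℕ} → Formula L n → {m : ℕ} → (Fin n → Fin m) → Formula L m
  | _, rel R x, _, σ => rel R (σ ∘ x)
  | _, eq i j, _, σ => eq (σ i) (σ j)
  | _, neg φ, _, σ => neg (φ.subst σ)
  | _, conj I φ, _, σ => conj I fun i => (φ i).subst σ
  | _, disj I φ, _, σ => disj I fun i => (φ i).subst σ
  | _, all φ, _, σ => all (φ.subst (liftVar σ))
  | _, ex φ, _, σ => ex (φ.subst (liftVar σ))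

/-- The true formula `⊤`, the empty conjunction. -/
def top {n : ℕ} : Formula L n := conj ∅ fun i => i.2.elim

/-- The false formula `⊥`, the empty disjunction. -/
def bot {n : ℕ} : Formula L n := disj ∅ fun i => i.2.elim

/-- Binary conjunction. -/
def and {n : ℕ} (φ ψ : Formula L n) : Formula L n :=
  conj {i | i < 2} fun i => if i.1 = 0 then φ else ψ

/-- Equality of two tuples of variables. -/
def eqs {n k : ℕ} (x y : Fin k → Fin n) : Formula L n :=
  conj {i | i < k} fun i => eq (x ⟨i.1, i.2⟩) (y ⟨i.1, i.2⟩)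

/-- `∃ y_0 ⋯ y_{k-1}, φ(x, y)`. -/
def exs {n : ℕ} : (k : ℕ) → Formula L (n + k) → Formula L n
  | 0, φ => φ
  | k + 1, φ => exs k (ex φ)

/-- `⋁_{k ∈ J} ∃ y, φ_k(x, y)`, where `y` is a tuple of `m k` variables. -/
def bigEx {n : ℕ} (J : Set ℕ) (m : J → ℕ) (φ : (k : J) → Formula L (n + m k)) : Formula L n :=
  disj J fun k => exs (m k) (φ k)

/-- `φ(x, y)` for a formula `φ` whose variables are split in two blocks. -/
def sub2 {n k m : ℕ} (φ : Formula L (n + k)) (x : Fin n → Fin m) (y : Fin k → Fin m) :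
    Formula L m :=
  φ.subst (cat x y)

theorem liftVar_comp {n m k : ℕ} (σ : Fin n → Fin m) (τ : Fin m → Fin k) :
    liftVar τ ∘ liftVar σ = liftVar (τ ∘ σ) := by
  funext i
  refine Fin.lastCases ?_ (fun i => ?_) i <;> simp [liftVar]

theorem liftVar_id {n : ℕ} : liftVar (id : Fin n → Fin n) = id := by
  funext i
  refine Fin.lastCases ?_ (fun i => ?_) i <;> simp [liftVar]

theorem subst_subst {n : ℕ} (φ : Formula L n) : ∀ {m k : ℕ} (σ : Fin n → Fin m)
    (τ : Fin m → Fin k), (φ.subst σ).subst τ = φ.subst (τ ∘ σ) := by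
  induction φ with
  | rel R x => intros; rfl
  | eq i j => intros; rfl
  | neg φ ih => intros; simp [subst, ih]
  | conj I φ ih => intros; simp [subst, ih]
  | disj I φ ih => intros; simp [subst, ih]
  | all φ ih => intros; simp [subst, ih, liftVar_comp]
  | ex φ ih => intros; simp [subst, ih, liftVar_comp]

theorem subst_id {n : ℕ} (φ : Formula L n) : φ.subst id = φ := by
  induction φ with
  | rel R x => rfl
  | eq i j => rfl
  | neg φ ih => simp [subst, ih]
  | conj I φ ih => simp [subst, ih]
  | disj I φ ih => simp [subst, ih]
  | all φ ih => simp [subst, ih, liftVar_id]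
  | ex φ ih => simp [subst, ih, liftVar_id]

theorem subst_wk {n m : ℕ} (φ : Formula L n) (σ : Fin n → Fin m) :
    (φ.subst σ).subst Fin.castSucc = (φ.subst Fin.castSucc).subst (liftVar σ) := by
  rw [subst_subst, subst_subst]
  congr 1
  funext i
  simp [liftVar]

theorem subst_inst {n m : ℕ} (φ : Formula L (n + 1)) (i : Fin n) (σ : Fin n → Fin m) :
    (φ.subst (instVar i)).subst σ = (φ.subst (liftVar σ)).subst (instVar (σ i)) := by
  rw [subst_subst, subst_subst]
  congr 1
  funext j
  refine Fin.lastCases ?_ (fun j => ?_) j <;> simp [liftVar, instVar]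

@[simp] theorem subst_and {n m : ℕ} (φ ψ : Formula L n) (σ : Fin n → Fin m) :
    (φ.and ψ).subst σ = (φ.subst σ).and (ψ.subst σ) := by
  simp only [and, subst]
  congr 1
  funext i
  split_ifs <;> rfl

@[simp] theorem subst_top {n m : ℕ} (σ : Fin n → Fin m) :
    (top : Formula L n).subst σ = top := by
  simp only [top, subst]
  congr 1
  funext i
  exact i.2.elim

@[simp] theorem subst_eqs {n m k : ℕ} (x y : Fin k → Fin n) (σ : Fin n → Fin m) :
    (eqs x y : Formula L n).subst σ = eqs (σ ∘ x) (σ ∘ y) := rfl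

theorem cat_comp {n k m l : ℕ} (x : Fin n → Fin m) (y : Fin k → Fin m) (w : Fin m → Fin l) :
    w ∘ cat x y = cat (w ∘ x) (w ∘ y) := by
  funext i
  refine Fin.addCases (fun i => ?_) (fun i => ?_) i <;> simp [cat]

theorem cat_left {n k m : ℕ} (x : Fin n → Fin m) (y : Fin k → Fin m) :
    cat x y ∘ Fin.castAdd k = x := by
  funext i; simp [cat]

theorem cat_right {n k m : ℕ} (x : Fin n → Fin m) (y : Fin k → Fin m) :
    cat x y ∘ Fin.natAdd n = y := by
  funext i; simp [cat]

theorem sub2_subst {n k m l : ℕ} (φ : Formula L (n + k)) (x : Fin n → Fin m) (y : Fin k → Fin m)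
    (w : Fin m → Fin l) : (φ.sub2 x y).subst w = φ.sub2 (w ∘ x) (w ∘ y) := by
  simp only [sub2, subst_subst, cat_comp]

theorem sub2_exs {n : ℕ} : ∀ (k : ℕ) (φ : Formula L (n + k)) {m : ℕ} (σ : Fin n → Fin m),
    (exs k φ).subst σ = exs k (φ.sub2 (Fin.castAdd k ∘ σ) (Fin.natAdd m))
  | 0, φ, m, σ => by
      simp only [exs, sub2]
      congr 1
      funext i
      exact (Fin.append_left (Fin.castAdd 0 ∘ σ) (Fin.natAdd m) i).symm
  | k + 1, φ, m, σ => by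
      simp only [exs]
      rw [sub2_exs k]
      simp only [sub2, subst]
      congr 3
      funext i
      refine Fin.lastCases ?_ (fun i => ?_) i
      · simp only [liftVar, Fin.snoc_last]
        exact (Fin.append_right (Fin.castAdd (k + 1) ∘ σ) (Fin.natAdd m) (Fin.last k)).symm
      · refine Fin.addCases (fun i => ?_) (fun i => ?_) i
        · simp only [liftVar, Fin.snoc_castSucc, cat, Fin.append_left]
          exact (Fin.append_left (Fin.castAdd (k + 1) ∘ σ) (Fin.natAdd m) i).symm
        · simp only [liftVar, Fin.snoc_castSucc, cat, Fin.append_right]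
          exact (Fin.append_right (Fin.castAdd (k + 1) ∘ σ) (Fin.natAdd m) i.castSucc).symm

end Formula

open Formula

/-! ### Provability -/

/-- Provability in `L_{ω₁ω}`: `Prf T Γ φ` says that the formula `φ` in `n` free variables is
derivable from the axioms (sentences) `T` and the hypotheses `Γ` in the same free variables, in
infinitary classical natural deduction with equality. The free variables are tracked, so empty
structures are not excluded. -/
inductive Prf {L : RelLang} (T : Set (Formula L 0)) :
    {n : ℕ} → Set (Formula L n) → Formula L n → Prop
  | ax {n : ℕ} {Γ : Set (Formula L n)} {χ : Formula L 0} (h : χ ∈ T) :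
      Prf T Γ (χ.subst Fin.elim0)
  | hyp {n : ℕ} {Γ : Set (Formula L n)} {φ : Formula L n} (h : φ ∈ Γ) : Prf T Γ φ
  | conjI {n : ℕ} {Γ : Set (Formula L n)} {I : Set ℕ} {φ : I → Formula L n}
      (h : ∀ i, Prf T Γ (φ i)) : Prf T Γ (conj I φ)
  | conjE {n : ℕ} {Γ : Set (Formula L n)} {I : Set ℕ} {φ : I → Formula L n}
      (h : Prf T Γ (conj I φ)) (i : I) : Prf T Γ (φ i)
  | disjI {n : ℕ} {Γ : Set (Formula L n)} {I : Set ℕ} {φ : I → Formula L n} (i : I)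
      (h : Prf T Γ (φ i)) : Prf T Γ (disj I φ)
  | disjE {n : ℕ} {Γ : Set (Formula L n)} {I : Set ℕ} {φ : I → Formula L n} {ψ : Formula L n}
      (h : Prf T Γ (disj I φ)) (h' : ∀ i, Prf T (insert (φ i) Γ) ψ) : Prf T Γ ψ
  | negI {n : ℕ} {Γ : Set (Formula L n)} {φ : Formula L n}
      (h : Prf T (insert φ Γ) bot) : Prf T Γ (neg φ)
  | negE {n : ℕ} {Γ : Set (Formula L n)} {φ : Formula L n}
      (h : Prf T Γ (neg φ)) (h' : Prf T Γ φ) : Prf T Γ bot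
  | raa {n : ℕ} {Γ : Set (Formula L n)} {φ : Formula L n}
      (h : Prf T (insert (neg φ) Γ) bot) : Prf T Γ φ
  | allI {n : ℕ} {Γ : Set (Formula L n)} {φ : Formula L (n + 1)}
      (h : Prf T ((fun ψ => ψ.subst Fin.castSucc) '' Γ) φ) : Prf T Γ (all φ)
  | allE {n : ℕ} {Γ : Set (Formula L n)} {φ : Formula L (n + 1)} (h : Prf T Γ (all φ))
      (i : Fin n) : Prf T Γ (φ.subst (instVar i))
  | exI {n : ℕ} {Γ : Set (Formula L n)} {φ : Formula L (n + 1)} (i : Fin n)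
      (h : Prf T Γ (φ.subst (instVar i))) : Prf T Γ (ex φ)
  | exE {n : ℕ} {Γ : Set (Formula L n)} {φ : Formula L (n + 1)} {ψ : Formula L n}
      (h : Prf T Γ (ex φ))
      (h' : Prf T (insert φ ((fun ψ => ψ.subst Fin.castSucc) '' Γ)) (ψ.subst Fin.castSucc)) :
      Prf T Γ ψ
  | eqI {n : ℕ} {Γ : Set (Formula L n)} (i : Fin n) : Prf T Γ (eq i i)
  | eqE {n : ℕ} {Γ : Set (Formula L n)} {φ : Formula L (n + 1)} {i j : Fin n}
      (h : Prf T Γ (eq i j)) (h' : Prf T Γ (φ.subst (instVar i))) :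
      Prf T Γ (φ.subst (instVar j))

namespace Prf

variable {L : RelLang} {T : Set (Formula L 0)}

theorem subst {n : ℕ} {Γ : Set (Formula L n)} {φ : Formula L n} (h : Prf T Γ φ) :
    ∀ {m : ℕ} (σ : Fin n → Fin m) (Δ : Set (Formula L m)),
      (∀ ψ ∈ Γ, ψ.subst σ ∈ Δ) → Prf T Δ (φ.subst σ) := by
  have ins : ∀ {n m : ℕ} {Γ : Set (Formula L n)} {Δ : Set (Formula L m)} {σ : Fin n → Fin m}
      (φ : Formula L n), (∀ ψ ∈ Γ, ψ.subst σ ∈ Δ) →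
      ∀ ψ ∈ insert φ Γ, ψ.subst σ ∈ insert (φ.subst σ) Δ := by
    rintro n m Γ Δ σ φ h ψ (rfl | hψ)
    · exact Or.inl rfl
    · exact Or.inr (h _ hψ)
  have wk : ∀ {n m : ℕ} {Γ : Set (Formula L n)} {Δ : Set (Formula L m)} {σ : Fin n → Fin m},
      (∀ ψ ∈ Γ, ψ.subst σ ∈ Δ) →
      ∀ ψ ∈ (fun ψ : Formula L n => ψ.subst Fin.castSucc) '' Γ, ψ.subst (liftVar σ) ∈
        (fun ψ : Formula L m => ψ.subst Fin.castSucc) '' Δ := by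
    rintro n m Γ Δ σ h _ ⟨ψ, hψ, rfl⟩
    exact ⟨_, h _ hψ, subst_wk _ _⟩
  have hbot : ∀ {n m : ℕ} (σ : Fin n → Fin m), (bot : Formula L n).subst σ = bot := by
    intro n m σ
    simp only [bot, Formula.subst]
    congr 1
    funext i
    exact i.2.elim
  induction h with
  | ax h =>
    intro m σ Δ _
    rw [subst_subst, Subsingleton.elim (σ ∘ Fin.elim0) Fin.elim0]
    exact ax h
  | hyp h => intro m σ Δ hΔ; exact hyp (hΔ _ h)
  | conjI _ ih => intro m σ Δ hΔ; exact conjI fun i => ih i σ Δ hΔ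
  | conjE _ i ih => intro m σ Δ hΔ; exact conjE (ih σ Δ hΔ) i
  | disjI i _ ih => intro m σ Δ hΔ; exact disjI i (ih σ Δ hΔ)
  | disjE _ _ ih ih' =>
    intro m σ Δ hΔ
    exact disjE (ih σ Δ hΔ) fun i => ih' i σ _ (ins _ hΔ)
  | negI _ ih =>
    intro m σ Δ hΔ
    have := ih σ _ (ins _ hΔ)
    rw [hbot] at this
    exact negI this
  | negE _ _ ih ih' =>
    intro m σ Δ hΔ
    rw [hbot]
    exact negE (ih σ Δ hΔ) (ih' σ Δ hΔ)
  | raa _ ih =>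
    intro m σ Δ hΔ
    have := ih σ _ (ins _ hΔ)
    rw [hbot] at this
    exact raa this
  | allI _ ih => intro m σ Δ hΔ; exact allI (ih _ _ (wk hΔ))
  | allE _ i ih =>
    intro m σ Δ hΔ
    rw [subst_inst]
    exact allE (ih σ Δ hΔ) _
  | exI i _ ih =>
    intro m σ Δ hΔ
    have := ih σ Δ hΔ
    rw [subst_inst] at this
    exact exI _ this
  | exE _ _ ih ih' =>
    intro m σ Δ hΔ
    have := ih' (liftVar σ) _ (ins _ (wk hΔ))
    rw [← subst_wk] at this
    exact exE (ih σ Δ hΔ) this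
  | eqI i => intro m σ Δ hΔ; exact eqI _
  | eqE _ _ ih ih' =>
    intro m σ Δ hΔ
    have h1 := ih σ Δ hΔ
    have h2 := ih' σ Δ hΔ
    rw [subst_inst] at h2 ⊢
    exact eqE h1 h2

theorem mono {n : ℕ} {Γ Δ : Set (Formula L n)} {φ : Formula L n} (h : Prf T Γ φ) (hs : Γ ⊆ Δ) :
    Prf T Δ φ := by
  have := h.subst id Δ (fun ψ hψ => by rw [subst_id]; exact hs hψ)
  rwa [subst_id] at this

theorem cut {n : ℕ} {Γ : Set (Formula L n)} {φ : Formula L n} (h : Prf T Γ φ) :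
    ∀ {Δ : Set (Formula L n)}, (∀ ψ ∈ Γ, Prf T Δ ψ) → Prf T Δ φ := by
  have ins : ∀ {n : ℕ} {Γ Δ : Set (Formula L n)} (φ : Formula L n), (∀ ψ ∈ Γ, Prf T Δ ψ) →
      ∀ ψ ∈ insert φ Γ, Prf T (insert φ Δ) ψ := by
    rintro n Γ Δ φ h ψ (rfl | hψ)
    · exact hyp (Or.inl rfl)
    · exact (h _ hψ).mono (Set.subset_insert _ _)
  have wk : ∀ {n : ℕ} {Γ Δ : Set (Formula L n)}, (∀ ψ ∈ Γ, Prf T Δ ψ) →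
      ∀ ψ ∈ (fun ψ : Formula L n => ψ.subst Fin.castSucc) '' Γ,
        Prf T ((fun ψ : Formula L n => ψ.subst Fin.castSucc) '' Δ) ψ := by
    rintro n Γ Δ h _ ⟨ψ, hψ, rfl⟩
    exact (h _ hψ).subst _ _ (fun ψ hψ => ⟨ψ, hψ, rfl⟩)
  induction h with
  | ax h => intro Δ _; exact ax h
  | hyp h => intro Δ hΔ; exact hΔ _ h
  | conjI _ ih => intro Δ hΔ; exact conjI fun i => ih i hΔ
  | conjE _ i ih => intro Δ hΔ; exact conjE (ih hΔ) i
  | disjI i _ ih => intro Δ hΔ; exact disjI i (ih hΔ)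
  | disjE _ _ ih ih' => intro Δ hΔ; exact disjE (ih hΔ) fun i => ih' i (ins _ hΔ)
  | negI _ ih => intro Δ hΔ; exact negI (ih (ins _ hΔ))
  | negE _ _ ih ih' => intro Δ hΔ; exact negE (ih hΔ) (ih' hΔ)
  | raa _ ih => intro Δ hΔ; exact raa (ih (ins _ hΔ))
  | allI _ ih => intro Δ hΔ; exact allI (ih (wk hΔ))
  | allE _ i ih => intro Δ hΔ; exact allE (ih hΔ) i
  | exI i _ ih => intro Δ hΔ; exact exI i (ih hΔ)
  | exE _ _ ih ih' => intro Δ hΔ; exact exE (ih hΔ) (ih' (ins _ (wk hΔ)))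
  | eqI i => intro Δ _; exact eqI i
  | eqE _ _ ih ih' => intro Δ hΔ; exact eqE (ih hΔ) (ih' hΔ)

theorem cut1 {n : ℕ} {Γ : Set (Formula L n)} {φ ψ : Formula L n} (h : Prf T {φ} ψ)
    (h' : Prf T Γ φ) : Prf T Γ ψ :=
  h.cut (by rintro _ rfl; exact h')

theorem cut2 {n : ℕ} {Γ : Set (Formula L n)} {φ φ' ψ : Formula L n} (h : Prf T {φ, φ'} ψ)
    (h1 : Prf T Γ φ) (h2 : Prf T Γ φ') : Prf T Γ ψ :=
  h.cut (by rintro _ (rfl | rfl); exacts [h1, h2])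

theorem hyp1 {n : ℕ} {φ : Formula L n} : Prf T {φ} φ := hyp rfl

theorem hypl {n : ℕ} {φ ψ : Formula L n} : Prf T {φ, ψ} φ := hyp (Or.inl rfl)

theorem hypr {n : ℕ} {φ ψ : Formula L n} : Prf T {φ, ψ} ψ := hyp (Or.inr rfl)

variable {n : ℕ} {Γ : Set (Formula L n)}

theorem topI : Prf T Γ top := conjI fun i => i.2.elim

theorem andI {φ ψ : Formula L n} (h : Prf T Γ φ) (h' : Prf T Γ ψ) : Prf T Γ (φ.and ψ) :=
  conjI fun i => by split_ifs; exacts [h, h']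

theorem andL {φ ψ : Formula L n} (h : Prf T Γ (φ.and ψ)) : Prf T Γ φ := by
  simpa using conjE h ⟨0, by simp⟩

theorem andR {φ ψ : Formula L n} (h : Prf T Γ (φ.and ψ)) : Prf T Γ ψ := by
  simpa using conjE h ⟨1, by simp⟩

theorem eq_symm {i j : Fin n} (h : Prf T Γ (eq i j)) : Prf T Γ (eq j i) := by
  have := eqE (φ := eq (Fin.last n) i.castSucc) h
    (by simpa [Formula.subst, instVar] using eqI i)
  simpa [Formula.subst, instVar] using this

theorem eq_trans {i j k : Fin n} (h : Prf T Γ (eq i j)) (h' : Prf T Γ (eq j k)) :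
    Prf T Γ (eq i k) := by
  have := eqE (φ := eq i.castSucc (Fin.last n)) h' (by simpa [Formula.subst, instVar] using h)
  simpa [Formula.subst, instVar] using this

theorem eqsE {k : ℕ} {x y : Fin k → Fin n} (h : Prf T Γ (eqs x y)) (i : Fin k) :
    Prf T Γ (eq (x i) (y i)) :=
  conjE h ⟨i.1, i.2⟩

theorem eqsI {k : ℕ} {x y : Fin k → Fin n} (h : ∀ i, Prf T Γ (eq (x i) (y i))) :
    Prf T Γ (eqs x y) :=
  conjI fun i => h ⟨i.1, i.2⟩

theorem eqs_subst {k : ℕ} {x y : Fin k → Fin n} (h : Prf T Γ (eqs x y)) (φ : Formula L k)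
    (hφ : Prf T Γ (φ.subst x)) : Prf T Γ (φ.subst y) := by
  have key : ∀ j : ℕ, j ≤ k → Prf T Γ (φ.subst fun i => if i.1 < j then y i else x i) := by
    intro j
    induction j with
    | zero => intro _; simpa using hφ
    | succ j ih =>
      intro hj
      have h0 := ih (by omega)
      let φ' : Formula L (n + 1) := φ.subst fun i =>
        if i.1 = j then Fin.last n else (if i.1 < j then y i else x i).castSucc
      have h1 : φ'.subst (instVar (x ⟨j, hj⟩)) =
          φ.subst fun i => if i.1 < j then y i else x i := by
        simp only [φ', subst_subst]
        congr 1
        funext i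
        by_cases hi : i.1 = j
        · have : i = ⟨j, hj⟩ := Fin.ext hi
          subst this
          simp [instVar]
        · simp [hi, instVar]
      have h2 : φ'.subst (instVar (y ⟨j, hj⟩)) =
          φ.subst fun i => if i.1 < j + 1 then y i else x i := by
        simp only [φ', subst_subst]
        congr 1
        funext i
        by_cases hi : i.1 = j
        · have : i = ⟨j, hj⟩ := Fin.ext hi
          subst this
          simp [instVar]
        · have : i.1 < j + 1 ↔ i.1 < j := by omega
          simp [hi, instVar, this]
      rw [← h2]
      rw [← h1] at h0
      exact eqE (eqsE h ⟨j, hj⟩) h0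
  have := key k le_rfl
  simpa using this

theorem exsI : ∀ (k : ℕ) {φ : Formula L (n + k)} (y : Fin k → Fin n),
    Prf T Γ (φ.sub2 id y) → Prf T Γ (exs k φ)
  | 0, φ, y, h => by
      have : cat id y = id := by
        funext i
        exact Fin.append_left id y i
      simp only [sub2, this] at h
      rwa [subst_id] at h
  | k + 1, φ, y, h => by
      refine exsI k (φ := ex φ) (y ∘ Fin.castSucc) (exI (y (Fin.last k)) ?_)
      rw [subst_subst]
      convert h using 1
      rw [sub2]
      congr 1
      funext i
      refine Fin.lastCases ?_ (fun i => ?_) i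
      · simp only [Function.comp, liftVar, instVar, Fin.snoc_last]
        exact (Fin.append_right id y (Fin.last k)).symm
      · refine Fin.addCases (fun i => ?_) (fun i => ?_) i
        · simp only [Function.comp, liftVar, instVar, Fin.snoc_castSucc, cat, Fin.append_left]
          exact (Fin.append_left id y i).symm
        · simp only [Function.comp, liftVar, instVar, Fin.snoc_castSucc, cat, Fin.append_right]
          exact (Fin.append_right id y i.castSucc).symm

theorem exsE : ∀ (k : ℕ) {φ : Formula L (n + k)} {ψ : Formula L n}, Prf T Γ (exs k φ) →
    Prf T (insert φ ((fun χ => χ.subst (Fin.castAdd k)) '' Γ)) (ψ.subst (Fin.castAdd k)) →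
    Prf T Γ ψ
  | 0, φ, ψ, h, h' => by
      have h2 : Prf T Γ (ψ.subst (Fin.castAdd 0)) := h'.cut (by
        rintro _ (rfl | ⟨χ, hχ, rfl⟩)
        · exact h
        · refine hyp ?_
          change χ.subst id ∈ Γ
          rwa [subst_id])
      change Prf T Γ (ψ.subst id) at h2
      rwa [subst_id] at h2
  | k + 1, φ, ψ, h, h' => by
      refine exsE k (φ := ex φ) h (exE (hyp (Or.inl rfl)) ?_)
      have e : ∀ χ : Formula L n, (χ.subst (Fin.castAdd k)).subst Fin.castSucc =
          χ.subst (Fin.castAdd (k + 1)) := fun χ => by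
        rw [subst_subst]
        rfl
      rw [e]
      refine h'.mono ?_
      rintro _ (rfl | ⟨χ, hχ, rfl⟩)
      · exact Or.inl rfl
      · exact Or.inr ⟨_, Or.inr ⟨χ, hχ, rfl⟩, e χ⟩

theorem bigExI {N : ℕ} {Γ : Set (Formula L N)} {J : Set ℕ} {m : J → ℕ}
    {φ : (k : J) → Formula L (n + m k)} {x : Fin n → Fin N} (k : J) (y : Fin (m k) → Fin N)
    (h : Prf T Γ ((φ k).sub2 x y)) : Prf T Γ ((bigEx J m φ).subst x) := by
  refine disjI k ?_
  rw [sub2_exs]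
  refine exsI _ y ?_
  rw [sub2_subst_aux]
  exact h
where
  sub2_subst_aux {N : ℕ} {J : Set ℕ} {m : J → ℕ} {φ : (k : J) → Formula L (n + m k)}
      {x : Fin n → Fin N} {k : J} {y : Fin (m k) → Fin N} :
      ((φ k).sub2 (Fin.castAdd (m k) ∘ x) (Fin.natAdd N)).sub2 id y = (φ k).sub2 x y := by
    rw [sub2, sub2_subst, ← Function.comp_assoc, cat_left, cat_right]
    rfl

theorem bigExE {N : ℕ} {Γ : Set (Formula L N)} {J : Set ℕ} {m : J → ℕ}
    {φ : (k : J) → Formula L (n + m k)} {x : Fin n → Fin N} {χ : Formula L N}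
    (h : Prf T Γ ((bigEx J m φ).subst x))
    (H : ∀ (k : J) (N' : ℕ) (w : Fin N → Fin N') (Δ : Set (Formula L N'))
      (y : Fin (m k) → Fin N'), (∀ ψ ∈ Γ, ψ.subst w ∈ Δ) → Prf T Δ ((φ k).sub2 (w ∘ x) y) →
      Prf T Δ (χ.subst w)) : Prf T Γ χ := by
  refine disjE h fun k => ?_
  rw [sub2_exs]
  refine exsE (m k) (hyp (Or.inl rfl)) (H k _ _ _ (Fin.natAdd N) ?_ (hyp (Or.inl rfl)))
  intro ψ hψ
  exact Or.inr ⟨ψ, Or.inr hψ, rfl⟩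

end Prf

/-! ### Theories, imaginary sorts and definable functions -/

/-- A countable `L_{ω₁ω}`-theory in a countable relational language. -/
structure Theory : Type 1 where
  L : RelLang
  /-- the axioms -/
  ax : Set (Formula L 0)
  countable : ax.Countable

/-- An imaginary sort `(⨆ᵢ αᵢ)/(⨆ᵢⱼ εᵢⱼ)` of a theory `T`: a countable family of formulas
`αᵢ(xᵢ)` in `nᵢ` variables and formulas `εᵢⱼ(xᵢ, xⱼ)` which `T` proves to define an equivalence
relation on `⨆ᵢ αᵢ`. The conditions are stated for all tuples of variables `x`, `y`, `z` in any
context; equivalently, for tuples of distinct variables. -/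
structure ImSort (T : Theory) : Type where
  I : Set ℕ
  n : I → ℕ
  α : (i : I) → Formula T.L (n i)
  ε : (i j : I) → Formula T.L (n i + n j)
  ε_dom : ∀ (i j : I) {N : ℕ} (x : Fin (n i) → Fin N) (y : Fin (n j) → Fin N),
    Prf T.ax {(ε i j).sub2 x y} (((α i).subst x).and ((α j).subst y))
  ε_refl : ∀ (i : I) {N : ℕ} (x : Fin (n i) → Fin N),
    Prf T.ax {(α i).subst x} ((ε i i).sub2 x x)
  ε_symm : ∀ (i j : I) {N : ℕ} (x : Fin (n i) → Fin N) (y : Fin (n j) → Fin N),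
    Prf T.ax {(ε i j).sub2 x y} ((ε j i).sub2 y x)
  ε_trans : ∀ (i j k : I) {N : ℕ} (x : Fin (n i) → Fin N) (y : Fin (n j) → Fin N)
    (z : Fin (n k) → Fin N), Prf T.ax {(ε i j).sub2 x y, (ε j k).sub2 y z} ((ε i k).sub2 x z)

section Syn

variable {T : Theory}

/-- A family of formulas `φᵢₖ(xᵢ, yₖ)` which `T` proves to be the lift to
`(⨆ᵢ αᵢ) × (⨆ₖ βₖ)` of the graph of a function `A → B`. -/
structure FunFamily (A B : ImSort T) : Type where
  φ : (i : A.I) → (k : B.I) → Formula T.L (A.n i + B.n k)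
  dom : ∀ (i : A.I) (k : B.I) {N : ℕ} (x : Fin (A.n i) → Fin N) (y : Fin (B.n k) → Fin N),
    Prf T.ax {(φ i k).sub2 x y} (((A.α i).subst x).and ((B.α k).subst y))
  congr_left : ∀ (i j : A.I) (k : B.I) {N : ℕ} (x : Fin (A.n i) → Fin N)
    (x' : Fin (A.n j) → Fin N) (y : Fin (B.n k) → Fin N),
    Prf T.ax {(φ i k).sub2 x y, (A.ε i j).sub2 x x'} ((φ j k).sub2 x' y)
  congr_right : ∀ (i : A.I) (k l : B.I) {N : ℕ} (x : Fin (A.n i) → Fin N)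
    (y : Fin (B.n k) → Fin N) (y' : Fin (B.n l) → Fin N),
    Prf T.ax {(φ i k).sub2 x y, (B.ε k l).sub2 y y'} ((φ i l).sub2 x y')
  unique : ∀ (i : A.I) (k l : B.I) {N : ℕ} (x : Fin (A.n i) → Fin N)
    (y : Fin (B.n k) → Fin N) (y' : Fin (B.n l) → Fin N),
    Prf T.ax {(φ i k).sub2 x y, (φ i l).sub2 x y'} ((B.ε k l).sub2 y y')
  total : ∀ (i : A.I) {N : ℕ} (x : Fin (A.n i) → Fin N),
    Prf T.ax {(A.α i).subst x} ((bigEx B.I B.n fun k => φ i k).subst x)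

/-- `T`-equivalence of families of formulas. -/
instance FunFamily.setoid (A B : ImSort T) : Setoid (FunFamily A B) where
  r f g := ∀ (i : A.I) (k : B.I) {N : ℕ} (x : Fin (A.n i) → Fin N) (y : Fin (B.n k) → Fin N),
    Prf T.ax {(f.φ i k).sub2 x y} ((g.φ i k).sub2 x y) ∧
      Prf T.ax {(g.φ i k).sub2 x y} ((f.φ i k).sub2 x y)
  iseqv :=
    { refl := fun _ _ _ _ _ _ => ⟨Prf.hyp1, Prf.hyp1⟩
      symm := fun h i k _ x y => (h i k x y).symm
      trans := fun h h' i k _ x y =>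
        ⟨(h' i k x y).1.cut1 (h i k x y).1, (h i k x y).2.cut1 (h' i k x y).2⟩ }

/-- A definable function `A → B`: a `T`-equivalence class of families of formulas. -/
def DefFun (A B : ImSort T) : Type := Quotient (FunFamily.setoid A B)

namespace FunFamily

/-- The identity function `[(εᵢⱼ)]`. -/
def id (A : ImSort T) : FunFamily A A where
  φ := A.ε
  dom := A.ε_dom
  congr_left i j k _ x x' y :=
    (A.ε_trans j i k x' x y).cut2 ((A.ε_symm i j x x').cut1 Prf.hypr) Prf.hypl
  congr_right i k l _ x y y' := A.ε_trans i k l x y y'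
  unique i k l _ x y y' :=
    (A.ε_trans k i l y x y').cut2 ((A.ε_symm i k x y).cut1 Prf.hypl) Prf.hypr
  total i _ x := Prf.bigExI i x (A.ε_refl i x)

variable {A B C D : ImSort T}

/-- The formulas `θᵢₘ(x, z) = ⋁ₖ ∃ y, φᵢₖ(x, y) ∧ ψₖₘ(y, z)` of a composite. -/
def compFormula (f : FunFamily A B) (g : FunFamily B C) (i : A.I) (m : C.I) :
    Formula T.L (A.n i + C.n m) :=
  bigEx B.I B.n fun k =>
    ((f.φ i k).sub2 (Fin.castAdd _ ∘ Fin.castAdd _) (Fin.natAdd _)).and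
      ((g.φ k m).sub2 (Fin.natAdd _) (Fin.castAdd _ ∘ Fin.natAdd _))

theorem compFormula_intro {f : FunFamily A B} {g : FunFamily B C} {i : A.I} {m : C.I} {N : ℕ}
    {Γ : Set (Formula T.L N)} {x : Fin (A.n i) → Fin N} {z : Fin (C.n m) → Fin N} (k : B.I)
    (y : Fin (B.n k) → Fin N) (h : Prf T.ax Γ ((f.φ i k).sub2 x y))
    (h' : Prf T.ax Γ ((g.φ k m).sub2 y z)) : Prf T.ax Γ ((compFormula f g i m).sub2 x z) := by
  refine Prf.bigExI k y ?_
  rw [sub2, subst_and, sub2_subst, sub2_subst, ← Function.comp_assoc, cat_left, cat_left,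
    cat_right, ← Function.comp_assoc, cat_left, cat_right]
  exact Prf.andI h h'

theorem compFormula_elim {f : FunFamily A B} {g : FunFamily B C} {i : A.I} {m : C.I} {N : ℕ}
    {Γ : Set (Formula T.L N)} {x : Fin (A.n i) → Fin N} {z : Fin (C.n m) → Fin N}
    {χ : Formula T.L N} (h : Prf T.ax Γ ((compFormula f g i m).sub2 x z))
    (H : ∀ (k : B.I) (N' : ℕ) (w : Fin N → Fin N') (Δ : Set (Formula T.L N'))
      (y : Fin (B.n k) → Fin N'), (∀ ψ ∈ Γ, ψ.subst w ∈ Δ) →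
      Prf T.ax Δ ((f.φ i k).sub2 (w ∘ x) y) → Prf T.ax Δ ((g.φ k m).sub2 y (w ∘ z)) →
      Prf T.ax Δ (χ.subst w)) : Prf T.ax Γ χ := by
  refine Prf.bigExE h fun k N' w Δ y hw hy => ?_
  rw [sub2, subst_and, sub2_subst, sub2_subst, ← Function.comp_assoc, cat_left, cat_comp,
    cat_left, cat_right, ← Function.comp_assoc, cat_left, cat_right] at hy
  exact H k N' w Δ y hw hy.andL hy.andR

/-- Composition of definable functions. -/
def comp (f : FunFamily A B) (g : FunFamily B C) : FunFamily A C where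
  φ := compFormula f g
  dom i m N x z := by
    refine compFormula_elim Prf.hyp1 fun k N' w Δ y hw h1 h2 => ?_
    rw [subst_and, subst_subst, subst_subst]
    exact Prf.andI ((f.dom i k _ _).cut1 h1).andL ((g.dom k m _ _).cut1 h2).andR
  congr_left i j m N x x' z := by
    refine compFormula_elim Prf.hypl fun k N' w Δ y hw h1 h2 => ?_
    have h3 := Prf.hyp (T := T.ax) (hw _ (Or.inr rfl))
    rw [sub2_subst] at h3 ⊢
    exact compFormula_intro k y ((f.congr_left i j k _ _ _).cut2 h1 h3) h2
  congr_right i m l N x z z' := by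
    refine compFormula_elim Prf.hypl fun k N' w Δ y hw h1 h2 => ?_
    have h3 := Prf.hyp (T := T.ax) (hw _ (Or.inr rfl))
    rw [sub2_subst] at h3 ⊢
    exact compFormula_intro k y h1 ((g.congr_right k m l _ _ _).cut2 h2 h3)
  unique i m l N x z z' := by
    refine compFormula_elim Prf.hypl fun k N' w Δ y hw h1 h2 => ?_
    have h3 := Prf.hyp (T := T.ax) (hw _ (Or.inr rfl))
    rw [sub2_subst] at h3 ⊢
    refine compFormula_elim h3 fun k' N'' w' Δ' y' hw' h4 h5 => ?_
    have h1' := h1.subst w' Δ' hw'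
    have h2' := h2.subst w' Δ' hw'
    rw [sub2_subst] at h1' h2' ⊢
    have h6 := (f.unique i k k' _ _ _).cut2 h1' h4
    exact (g.unique k' m l _ _ _).cut2 ((g.congr_left k k' m _ _ _).cut2 h2' h6) h5
  total i N x := by
    refine Prf.bigExE (f.total i x) fun k N' w Δ y hw h1 => ?_
    have h2 := (g.total k y).cut1 ((f.dom i k _ _).cut1 h1).andR
    rw [subst_subst]
    refine Prf.bigExE h2 fun m N'' w' Δ' z hw' h3 => ?_
    rw [subst_subst]
    have h1' := h1.subst w' Δ' hw'
    rw [sub2_subst] at h1'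
    exact Prf.bigExI m z (compFormula_intro k (w' ∘ y) h1' h3)

theorem comp_congr_aux {f f' : FunFamily A B} {g g' : FunFamily B C} (hf : f ≈ f') (hg : g ≈ g')
    (i : A.I) (m : C.I) {N : ℕ} (x : Fin (A.n i) → Fin N) (z : Fin (C.n m) → Fin N) :
    Prf T.ax {((comp f g).φ i m).sub2 x z} (((comp f' g').φ i m).sub2 x z) := by
  refine compFormula_elim Prf.hyp1 fun k N' w Δ y hw h1 h2 => ?_
  rw [sub2_subst]
  exact compFormula_intro k y ((hf i k _ _).1.cut1 h1) ((hg k m _ _).1.cut1 h2)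

theorem comp_congr {f f' : FunFamily A B} {g g' : FunFamily B C} (hf : f ≈ f') (hg : g ≈ g') :
    comp f g ≈ comp f' g' := fun i m _ x z =>
  ⟨comp_congr_aux hf hg i m x z,
    comp_congr_aux (Setoid.symm hf) (Setoid.symm hg) i m x z⟩

theorem id_comp (f : FunFamily A B) : comp (id A) f ≈ f := fun i k N x y => by
  constructor
  · refine compFormula_elim Prf.hyp1 fun k' N' w Δ y' hw h1 h2 => ?_
    rw [sub2_subst]
    exact (f.congr_left k' i k _ _ _).cut2 h2 ((A.ε_symm i k' _ _).cut1 h1)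
  · exact compFormula_intro (f := id A) i x
      ((A.ε_refl i x).cut1 (f.dom i k x y).andL) Prf.hyp1

theorem comp_id (f : FunFamily A B) : comp f (id B) ≈ f := fun i k N x y => by
  constructor
  · refine compFormula_elim Prf.hyp1 fun k' N' w Δ y' hw h1 h2 => ?_
    rw [sub2_subst]
    exact (f.congr_right i k' k _ _ _).cut2 h1 h2
  · exact compFormula_intro (g := id B) k y Prf.hyp1
      ((B.ε_refl k y).cut1 (f.dom i k x y).andR)

theorem assoc (f : FunFamily A B) (g : FunFamily B C) (h : FunFamily C D) :
    comp (comp f g) h ≈ comp f (comp g h) := fun i m N x y => by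
  constructor
  · refine compFormula_elim Prf.hyp1 fun l N' w Δ z hw h1 h2 => ?_
    rw [sub2_subst]
    refine compFormula_elim h1 fun k N'' w' Δ' u hw' h3 h4 => ?_
    have h2' := h2.subst w' Δ' hw'
    rw [sub2_subst] at h2' ⊢
    exact compFormula_intro k u h3 (compFormula_intro (f := g) (g := h) l (w' ∘ z) h4 h2')
  · refine compFormula_elim Prf.hyp1 fun k N' w Δ z hw h1 h2 => ?_
    rw [sub2_subst]
    refine compFormula_elim h2 fun l N'' w' Δ' u hw' h3 h4 => ?_
    have h1' := h1.subst w' Δ' hw'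
    rw [sub2_subst] at h1' ⊢
    exact compFormula_intro l u (compFormula_intro (f := f) (g := g) k (w' ∘ z) h1' h3) h4

end FunFamily

/-- The syntactic Boolean `ω₁`-pretopos of `T`: the category of imaginary sorts and definable
functions, with arbitrary `L_{ω₁ω}`-formulas allowed in both. -/
instance synCategory (T : Theory) : Category.{0} (ImSort T) where
  Hom A B := DefFun A B
  id A := Quotient.mk _ (FunFamily.id A)
  comp f g := Quotient.map₂ FunFamily.comp
    (fun _ _ hf _ _ hg => FunFamily.comp_congr hf hg) f g
  id_comp f := Quotient.inductionOn f fun f => Quotient.sound (FunFamily.id_comp f)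
  comp_id f := Quotient.inductionOn f fun f => Quotient.sound (FunFamily.comp_id f)
  assoc f g h := Quotient.inductionOn₃ f g h fun f g h =>
    Quotient.sound (FunFamily.assoc f g h)

/-- The formula `ε(x, y) = α(x) ∧ (x = y)` in the variables `(x, y)`. -/
def epsFormula {L : RelLang} {n : ℕ} (α : Formula L n) : Formula L (n + n) :=
  (α.subst (Fin.castAdd n)).and (eqs (Fin.castAdd n) (Fin.natAdd n))

theorem epsFormula_sub2 {L : RelLang} {n : ℕ} (α : Formula L n) {N : ℕ} (x y : Fin n → Fin N) :
    (epsFormula α).sub2 x y = (α.subst x).and (eqs x y) := by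
  simp [epsFormula, sub2, subst_subst, cat_left, cat_right]

/-- A formula `α(x)` regarded as an imaginary sort, with `ε(x, y) = α(x) ∧ (x = y)`. -/
def ImSort.ofFormula {n : ℕ} (α : Formula T.L n) : ImSort T where
  I := {0}
  n _ := n
  α _ := α
  ε _ _ := epsFormula α
  ε_dom _ _ N x y := by
    rw [epsFormula_sub2]
    exact Prf.andI Prf.hyp1.andL (Prf.eqs_subst Prf.hyp1.andR α Prf.hyp1.andL)
  ε_refl _ N x := by
    rw [epsFormula_sub2]
    exact Prf.andI Prf.hyp1 (Prf.eqsI fun i => Prf.eqI (x i))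
  ε_symm _ _ N x y := by
    rw [epsFormula_sub2, epsFormula_sub2]
    exact Prf.andI (Prf.eqs_subst Prf.hyp1.andR α Prf.hyp1.andL)
      (Prf.eqsI fun i => (Prf.eqsE Prf.hyp1.andR i).eq_symm)
  ε_trans _ _ _ N x y z := by
    rw [epsFormula_sub2, epsFormula_sub2, epsFormula_sub2]
    exact Prf.andI Prf.hypl.andL
      (Prf.eqsI fun i => (Prf.eqsE Prf.hypl.andR i).eq_trans (Prf.eqsE Prf.hypr.andR i))

/-- The home sort `X`, given by the true formula in one variable. -/
def homeSort (T : Theory) : ImSort T := ImSort.ofFormula (n := 1) top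

/-- The formula `R(x_0, …, x_{n-1})`. -/
def relFormula {L : RelLang} (R : L.Sym) : Formula L (L.arity R) := rel R id

/-- The formula `α(x) ∧ (x_i = y)` in the variables `(x, y)`. -/
def coordFormula {L : RelLang} {n : ℕ} (α : Formula L n) (i : Fin n) : Formula L (n + 1) :=
  (α.subst (Fin.castAdd 1)).and (eq (Fin.castAdd 1 i) (Fin.natAdd n 0))

section coord

variable {n : ℕ} (α : Formula T.L n) (i : Fin n) {N : ℕ} (x x' : Fin n → Fin N)
  (y y' : Fin 1 → Fin N)

theorem coordFormula_sub2 :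
    (coordFormula α i).sub2 x y = (α.subst x).and (eq (x i) (y 0)) := by
  have h1 : cat x y (Fin.castAdd 1 i) = x i := congrFun (cat_left x y) i
  have h2 : cat x y (Fin.natAdd n 0) = y 0 := congrFun (cat_right x y) 0
  rw [coordFormula, sub2, subst_and, subst_subst, cat_left, Formula.subst, h1, h2]

theorem coord_dom : Prf T.ax {(coordFormula α i).sub2 x y}
    ((α.subst x).and ((top : Formula T.L 1).subst y)) := by
  rw [coordFormula_sub2, subst_top]
  exact Prf.andI Prf.hyp1.andL Prf.topI

theorem coord_congr_left : Prf T.ax {(coordFormula α i).sub2 x y, (epsFormula α).sub2 x x'}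
    ((coordFormula α i).sub2 x' y) := by
  rw [coordFormula_sub2, coordFormula_sub2, epsFormula_sub2]
  exact Prf.andI (Prf.eqs_subst Prf.hypr.andR α Prf.hypl.andL)
    ((Prf.eqsE Prf.hypr.andR i).eq_symm.eq_trans Prf.hypl.andR)

theorem coord_congr_right : Prf T.ax {(coordFormula α i).sub2 x y, (epsFormula top).sub2 y y'}
    ((coordFormula α i).sub2 x y') := by
  rw [coordFormula_sub2, coordFormula_sub2, epsFormula_sub2]
  exact Prf.andI Prf.hypl.andL (Prf.hypl.andR.eq_trans (Prf.eqsE Prf.hypr.andR 0))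

theorem coord_unique : Prf T.ax {(coordFormula α i).sub2 x y, (coordFormula α i).sub2 x y'}
    ((epsFormula top).sub2 y y') := by
  rw [coordFormula_sub2, coordFormula_sub2, epsFormula_sub2, subst_top]
  refine Prf.andI Prf.topI (Prf.eqsI fun j => ?_)
  rw [Subsingleton.elim j 0]
  exact Prf.hypl.andR.eq_symm.eq_trans Prf.hypr.andR

theorem coord_total (J : Set ℕ) (hJ : 0 ∈ J) :
    Prf T.ax {α.subst x} ((bigEx J (fun _ => 1) fun _ => coordFormula α i).subst x) := by
  refine Prf.bigExI ⟨0, hJ⟩ (fun _ => x i) ?_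
  rw [coordFormula_sub2]
  exact Prf.andI Prf.hyp1 (Prf.eqI _)

end coord

/-- For a formula `α` in `n` variables, the family defining the `i`-th coordinate `α → X`, i.e.
the composite of the inclusion `α ↪ X^n` with the `i`-th projection `X^n → X`: it is given by the
formula `α(x) ∧ (x_i = y)`. -/
def coordFamily {n : ℕ} (α : Formula T.L n) (i : Fin n) :
    FunFamily (ImSort.ofFormula α) (homeSort T) where
  φ _ _ := coordFormula α i
  dom _ _ _ x y := coord_dom α i x y
  congr_left _ _ _ _ x x' y := coord_congr_left α i x x' y
  congr_right _ _ _ _ x y y' := coord_congr_right α i x y y'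
  unique _ _ _ _ x y y' := coord_unique α i x y y'
  total _ _ x := coord_total α i x {0} rfl

/-- The `i`-th coordinate `α → X`, as a definable function. -/
def coord {n : ℕ} (α : Formula T.L n) (i : Fin n) : ImSort.ofFormula α ⟶ homeSort T :=
  Quotient.mk _ (coordFamily α i)

end Syn

/-! ### `ω₁`-coherent functors -/

section coherent

open Limits

/-- `(p, q) : E ⇉ X` is an internal equivalence relation: a subobject of `X × X` which is
reflexive, symmetric and transitive. -/
structure IsEqRel {C : Type} [Category.{0} C] {E X : C} (p q : E ⟶ X) : Prop where
  mono : ∃ (P : BinaryFan X X) (_ : IsLimit P) (m : E ⟶ P.pt),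
    Mono m ∧ m ≫ P.fst = p ∧ m ≫ P.snd = q
  refl : ∃ r : X ⟶ E, r ≫ p = 𝟙 X ∧ r ≫ q = 𝟙 X
  symm : ∃ s : E ⟶ E, s ≫ p = q ∧ s ≫ q = p
  trans : ∃ (W : C) (a b : W ⟶ E) (_ : IsPullback a b q p) (t : W ⟶ E),
    t ≫ p = a ≫ p ∧ t ≫ q = b ≫ q

/-- `ω₁`-coherent functors (between small `ω₁`-pretoposes): functors preserving finite limits,
countable coproducts (disjoint unions), and quotients of equivalence relations. -/
structure IsCoherent {C D : Type} [Category.{0} C] [Category.{0} D] (F : C ⥤ D) : Prop where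
  finLim : PreservesFiniteLimits F
  coprod : ∀ (J : Type) [Countable J], PreservesColimitsOfShape (Discrete J) F
  quot : ∀ {E X : C} (p q : E ⟶ X), IsEqRel p q → PreservesColimit (parallelPair p q) F

theorem IsEqRel.map {C D : Type} [Category.{0} C] [Category.{0} D] (F : C ⥤ D)
    [PreservesFiniteLimits F] {E X : C} {p q : E ⟶ X} (h : IsEqRel p q) :
    IsEqRel (F.map p) (F.map q) where
  mono := by
    obtain ⟨P, hP, m, hm, h1, h2⟩ := h.mono
    refine ⟨BinaryFan.mk (F.map P.fst) (F.map P.snd), ?_, F.map m, ?_, ?_, ?_⟩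
    · exact mapIsLimitOfPreservesOfIsLimit F P.fst P.snd
        (hP.ofIsoLimit (BinaryFan.ext (Iso.refl _) (Category.id_comp _).symm
          (Category.id_comp _).symm))
    · exact F.map_mono m
    · exact (F.map_comp _ _).symm.trans (congrArg F.map h1)
    · exact (F.map_comp _ _).symm.trans (congrArg F.map h2)
  refl := by
    obtain ⟨r, h1, h2⟩ := h.refl
    exact ⟨F.map r, by simp [← F.map_comp, h1], by simp [← F.map_comp, h2]⟩
  symm := by
    obtain ⟨r, h1, h2⟩ := h.symm
    exact ⟨F.map r, by simp [← F.map_comp, h1], by simp [← F.map_comp, h2]⟩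
  trans := by
    obtain ⟨W, a, b, hW, t, h1, h2⟩ := h.trans
    exact ⟨F.obj W, F.map a, F.map b, hW.map F, F.map t, by rw [← F.map_comp, h1, F.map_comp],
      by rw [← F.map_comp, h2, F.map_comp]⟩

theorem IsCoherent.id (C : Type) [Category.{0} C] : IsCoherent (𝟭 C) where
  finLim := inferInstance
  coprod _ _ := inferInstance
  quot _ _ _ := inferInstance

theorem IsCoherent.comp {C D E : Type} [Category.{0} C] [Category.{0} D] [Category.{0} E]
    {F : C ⥤ D} {G : D ⥤ E} (hF : IsCoherent F) (hG : IsCoherent G) : IsCoherent (F ⋙ G) where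
  finLim := by
    have := hF.finLim
    have := hG.finLim
    exact comp_preservesFiniteLimits F G
  coprod J _ := by
    have := hF.coprod J
    have := hG.coprod J
    infer_instance
  quot p q h := by
    have := hF.finLim
    have h1 := hF.quot p q h
    have h2 := hG.quot _ _ (h.map F)
    have h3 : PreservesColimit (parallelPair p q ⋙ F) G :=
      preservesColimit_of_iso_diagram G (parallelPair.ext (Iso.refl _) (Iso.refl _)
        (by simp) (by simp) : parallelPair (F.map p) (F.map q) ≅ parallelPair p q ⋙ F)
    infer_instance

end coherent

/-- An `ω₁`-coherent functor. -/
structure CohFun (C D : Type) [Category.{0} C] [Category.{0} D] : Type where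
  functor : C ⥤ D
  coh : IsCoherent functor

section CohFun

variable {C D E : Type} [Category.{0} C] [Category.{0} D] [Category.{0} E]

/-- Morphisms of `ω₁`-coherent functors: natural isomorphisms. -/
@[ext] structure CohFun.Hom (F G : CohFun C D) : Type where
  iso : F.functor ≅ G.functor

/-- The groupoid of `ω₁`-coherent functors and natural isomorphisms. -/
@[simps id_iso comp_iso inv_iso]
instance CohFun.groupoid : Groupoid.{0} (CohFun C D) where
  Hom F G := CohFun.Hom F G
  id F := ⟨Iso.refl F.functor⟩
  comp f g := ⟨f.iso ≪≫ g.iso⟩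
  inv f := ⟨f.iso.symm⟩

namespace CohFun

@[ext] theorem hom_ext {F G : CohFun C D} {f g : F ⟶ G}
    (h : ∀ X, f.iso.hom.app X = g.iso.hom.app X) : f = g :=
  Hom.ext (Iso.ext (NatTrans.ext (funext h)))

/-- The identity functor. -/
abbrev idFun (C : Type) [Category.{0} C] : CohFun C C := ⟨𝟭 C, IsCoherent.id C⟩

/-- Composition of functors. -/
abbrev comp (F : CohFun C D) (G : CohFun D E) : CohFun C E :=
  ⟨F.functor ⋙ G.functor, F.coh.comp G.coh⟩

/-- Whiskering on the left: precomposition of a natural isomorphism with `F`. -/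
@[simps] abbrev whL (F : CohFun C D) {G H : CohFun D E} (f : G ⟶ H) : F.comp G ⟶ F.comp H where
  iso := Functor.isoWhiskerLeft F.functor f.iso

/-- Whiskering on the right: postcomposition of a natural isomorphism with `H`. -/
@[simps] abbrev whR {F G : CohFun C D} (f : F ⟶ G) (H : CohFun D E) : F.comp H ⟶ G.comp H where
  iso := Functor.isoWhiskerRight f.iso H.functor

/-- A natural isomorphism as an isomorphism of coherent functors. -/
@[simps] abbrev isoOf {F G : CohFun C D} (f : F.functor ≅ G.functor) : F ≅ G where
  hom := ⟨f⟩
  inv := ⟨f.symm⟩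

/-- Precomposition `F^*` with an `ω₁`-coherent functor. -/
@[simps] def precomp (F : CohFun C D) (E : Type) [Category.{0} E] : CohFun D E ⥤ CohFun C E where
  obj G := F.comp G
  map f := F.whL f

end CohFun

end CohFun

open CohFun in
/-- The 2-category `ω₁ωThy` of countable `L_{ω₁ω}`-theories, interpretations (`ω₁`-coherent
functors between the syntactic Boolean `ω₁`-pretoposes), and natural isomorphisms. -/
instance thyBicategory : Bicategory.{0, 0} Theory where
  Hom T T' := CohFun (ImSort T) (ImSort T')
  id T := idFun (ImSort T)
  comp F G := CohFun.comp F G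
  homCategory T T' := inferInstanceAs (Category (CohFun (ImSort T) (ImSort T')))
  whiskerLeft F _ _ f := whL F f
  whiskerRight f H := whR f H
  associator F G H := isoOf (Functor.associator F.functor G.functor H.functor)
  leftUnitor F := isoOf (Functor.leftUnitor F.functor)
  rightUnitor F := isoOf (Functor.rightUnitor F.functor)
  whiskerLeft_id F G := by apply CohFun.hom_ext; intro X; simp
  whiskerLeft_comp F _ _ _ f g := by apply CohFun.hom_ext; intro X; simp
  id_whiskerLeft f := by apply CohFun.hom_ext; intro X; simp
  comp_whiskerLeft F G _ _ f := by apply CohFun.hom_ext; intro X; simp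
  id_whiskerRight F G := by apply CohFun.hom_ext; intro X; simp
  comp_whiskerRight f g H := by apply CohFun.hom_ext; intro X; simp
  whiskerRight_id f := by apply CohFun.hom_ext; intro X; simp
  whiskerRight_comp f G H := by apply CohFun.hom_ext; intro X; simp
  whisker_assoc F _ _ f H := by apply CohFun.hom_ext; intro X; simp
  whisker_exchange f g := by apply CohFun.hom_ext; intro X; simp
  pentagon F G H I := by apply CohFun.hom_ext; intro X; simp
  triangle F G := by apply CohFun.hom_ext; intro X; simp

/-! ### Countable sets and countable models on initial segments of `ℕ` -/

/-- An object of `Count`: one of the initial segments `0, 1, 2, …, ℕ` of `ℕ`. -/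
@[ext] structure Count : Type where
  size : ℕ∞

/-- The underlying set `{k | k < size}`. -/
abbrev Count.El (M : Count) : Type := {k : ℕ // (k : ℕ∞) < M.size}

/-- The category `Count` of initial segments of `ℕ` and all functions. -/
instance countCategory : Category.{0} Count where
  Hom M N := M.El → N.El
  id _ := fun a => a
  comp f g := fun a => g (f a)

/-- The Borel structure on the space `⨆_{M, N} N^M` of morphisms of `Count`. -/
instance : MeasurableSpace (Arrow Count) :=
  MeasurableSpace.comap
    (fun f => (⟨f.left, f.right, f.hom⟩ : Σ M : Count, Σ N : Count, (M.El → N.El))) inferInstance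

/-- A countable `L`-structure whose underlying set is an initial segment of `ℕ`. -/
@[ext] structure Str (L : RelLang) : Type where
  dom : Count
  rel : (R : L.Sym) → Set (Fin (L.arity R) → dom.El)

namespace Str

variable {L : RelLang}

/-- Satisfaction of formulas. -/
def Sat (M : Str L) : {n : ℕ} → Formula L n → (Fin n → M.dom.El) → Prop
  | _, Formula.rel R x, v => v ∘ x ∈ M.rel R
  | _, Formula.eq i j, v => v i = v j
  | _, Formula.neg φ, v => ¬ M.Sat φ v
  | _, Formula.conj _ φ, v => ∀ i, M.Sat (φ i) v
  | _, Formula.disj _ φ, v => ∃ i, M.Sat (φ i) v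
  | _, Formula.all φ, v => ∀ a : M.dom.El, M.Sat φ (Fin.snoc (α := fun _ => M.dom.El) v a)
  | _, Formula.ex φ, v => ∃ a : M.dom.El, M.Sat φ (Fin.snoc (α := fun _ => M.dom.El) v a)

/-- An isomorphism of structures. -/
@[ext] structure Iso (M N : Str L) : Type where
  equiv : M.dom.El ≃ N.dom.El
  map_rel : ∀ (R : L.Sym) (a : Fin (L.arity R) → M.dom.El),
    (fun i => equiv (a i)) ∈ N.rel R ↔ a ∈ M.rel R

/-- The groupoid `MOD(L)` of countable `L`-structures and isomorphisms. -/
@[simps id_equiv comp_equiv inv_equiv]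
instance groupoid : Groupoid.{0} (Str L) where
  Hom M N := Iso M N
  id M := ⟨Equiv.refl _, fun _ _ => Iff.rfl⟩
  comp f g := ⟨f.equiv.trans g.equiv, fun R a =>
    (g.map_rel R fun i => f.equiv (a i)).trans (f.map_rel R a)⟩
  inv f := ⟨f.equiv.symm, fun R a => by
    rw [← f.map_rel]
    simp⟩
  inv_comp f := Iso.ext (by simp)
  comp_inv f := Iso.ext (by simp)

/-- `a ∈ ℕ^n` lies in `M^n` and satisfies `R`. -/
def Holds (M : Str L) (R : L.Sym) (a : Fin (L.arity R) → ℕ) : Prop :=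
  ∃ h : ∀ i, (a i : ℕ∞) < M.dom.size, (fun i => (⟨a i, h i⟩ : M.dom.El)) ∈ M.rel R

/-- The size of the universe of `M` and its relations as predicates on tuples from `ℕ`. -/
def code (M : Str L) : ℕ∞ × ((R : L.Sym) → (Fin (L.arity R) → ℕ) → Prop) :=
  (M.dom.size, fun R a => M.Holds R a)

/-- The Borel structure on the space `Model(L)` of countable `L`-structures: the `σ`-algebra
generated by the sets `{M | |M| ≥ n}` and `{M | a ∈ M^n ∧ R^M(a)}`. -/
instance : MeasurableSpace (Str L) := MeasurableSpace.comap code inferInstance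

end Str

/-- A countable model of `T` whose underlying set is an initial segment of `ℕ`. -/
@[ext] structure Model (T : Theory) : Type where
  str : Str T.L
  models : ∀ χ ∈ T.ax, str.Sat χ Fin.elim0

/-- The groupoid `MOD(T)` of countable models of `T` and isomorphisms, a full subgroupoid
of `MOD(L)`. -/
instance modGroupoid (T : Theory) : Groupoid.{0} (Model T) where
  Hom M N := M.str ⟶ N.str
  id M := 𝟙 M.str
  comp f g := f ≫ g
  inv f := Groupoid.inv f

/-- The inclusion of `MOD(T)` in `MOD(L)`. -/
def Model.incl (T : Theory) : Model T ⥤ Str T.L where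
  obj M := M.str
  map f := f

/-- The Borel structure on the space of models. -/
instance (T : Theory) : MeasurableSpace (Model T) := MeasurableSpace.comap Model.str inferInstance

/-- `k` lies in the source of the isomorphism `f` and is mapped to `l`. -/
def Model.Maps {T : Theory} (f : Arrow (Model T)) (k l : ℕ) : Prop :=
  ∃ h : (k : ℕ∞) < f.left.str.dom.size, ((f.hom : f.left.str ⟶ f.right.str).equiv ⟨k, h⟩ : ℕ) = l

/-- Source, target and graph of an isomorphism. -/
def Model.arrowCode {T : Theory} (f : Arrow (Model T)) : Model T × Model T × (ℕ → ℕ → Prop) :=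
  (f.left, f.right, fun k l => Model.Maps f k l)

/-- The Borel structure on the space of isomorphisms: the `σ`-algebra generated by the source
and target maps and the sets `{g | k ∈ dom g ∧ g(k) = l}`. -/
instance (T : Theory) : MeasurableSpace (Arrow (Model T)) :=
  MeasurableSpace.comap Model.arrowCode inferInstance

/-! ### The space of models is standard Borel -/

theorem standardBorel_comap {α β : Type} [MeasurableSpace β] [StandardBorelSpace β] (f : α → β)
    (hf : Function.Injective f) (hr : MeasurableSet (Set.range f)) :
    @StandardBorelSpace α (MeasurableSpace.comap f inferInstance) := by
  let : MeasurableSpace α := MeasurableSpace.comap f inferInstance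
  have := hr.standardBorel
  let _ := upgradeStandardBorel (Set.range f)
  let e : α ≃ Set.range f := Equiv.ofInjective f hf
  let τ : TopologicalSpace α := TopologicalSpace.induced e inferInstance
  have hP : PolishSpace α := e.polishSpace_induced
  have hB : BorelSpace α := ⟨by
    rw [borel_comap, ← BorelSpace.measurable_eq (α := Set.range f)]
    change MeasurableSpace.comap f _ = MeasurableSpace.comap e (MeasurableSpace.comap _ _)
    rw [MeasurableSpace.comap_comp]
    rfl⟩
  exact ⟨τ, hB, hP⟩

theorem _root_.Measurable.congr_prop {α : Type} [MeasurableSpace α] {p q : α → Prop}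
    (hp : Measurable p) (h : ∀ a, p a ↔ q a) : Measurable q := by
  rwa [show q = p from funext fun a => propext (h a).symm]

namespace Str

variable {L : RelLang}

theorem code_injective : Function.Injective (code (L := L)) := by
  rintro ⟨⟨s⟩, r⟩ ⟨⟨s'⟩, r'⟩ h
  simp only [code, Prod.mk.injEq] at h
  obtain ⟨h1, h2⟩ := h
  subst h1
  congr 1
  funext R
  ext a
  have := congrFun (congrFun h2 R) (fun i => (a i : ℕ))
  simp only [Holds, eq_iff_iff] at this
  constructor
  · intro ha
    obtain ⟨_, h⟩ := this.1 ⟨fun i => (a i).2, ha⟩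
    exact h
  · intro ha
    obtain ⟨_, h⟩ := this.2 ⟨fun i => (a i).2, ha⟩
    exact h

theorem measurable_code : Measurable (code (L := L)) := comap_measurable _

theorem measurable_lt (k : ℕ) : Measurable fun M : Str L => (k : ℕ∞) < M.dom.size := by
  have h : Measurable fun s : ℕ∞ => (k : ℕ∞) < s := measurable_from_top
  exact h.comp (measurable_fst.comp measurable_code)

theorem measurable_holds (R : L.Sym) (a : Fin (L.arity R) → ℕ) :
    Measurable fun M : Str L => M.Holds R a :=
  (measurable_pi_apply a).comp ((measurable_pi_apply R).comp
    (measurable_snd.comp measurable_code))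

theorem range_code : Set.range (code (L := L)) =
    {p | ∀ (R : L.Sym) (a : Fin (L.arity R) → ℕ), p.2 R a → ∀ i, (a i : ℕ∞) < p.1} := by
  ext ⟨s, r⟩
  constructor
  · rintro ⟨M, h⟩
    simp only [code, Prod.mk.injEq] at h
    obtain ⟨rfl, rfl⟩ := h
    rintro R a ⟨h, _⟩
    exact h
  · intro h
    refine ⟨⟨⟨s⟩, fun R => {a | r R fun i => (a i : ℕ)}⟩, ?_⟩
    refine Prod.ext rfl ?_
    funext R a
    exact propext ⟨fun ⟨_, h'⟩ => h', fun h' => ⟨h R a h', h'⟩⟩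

instance : StandardBorelSpace (Str L) := by
  have := L.countable
  refine standardBorel_comap code code_injective ?_
  rw [range_code, measurableSet_setOfPred]
  refine Measurable.forall fun R => Measurable.forall fun a => Measurable.imp ?_ ?_
  · exact (measurable_pi_apply a).comp ((measurable_pi_apply R).comp measurable_snd)
  · refine Measurable.forall fun i => ?_
    have h : Measurable fun s : ℕ∞ => (a i : ℕ∞) < s := measurable_from_top
    exact h.comp measurable_fst

/-- For a formula `φ` and `a ∈ ℕ^n`, the set of those `M` with `a ∈ M^n` and `φ^M(a)` is Borel. -/
theorem measurable_sat {n : ℕ} (φ : Formula L n) : ∀ v : Fin n → ℕ, Measurable fun M : Str L =>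
    ∃ h : ∀ i, (v i : ℕ∞) < M.dom.size, M.Sat φ fun i => ⟨v i, h i⟩ := by
  have hv : ∀ {n : ℕ} (v : Fin n → ℕ),
      Measurable fun M : Str L => ∀ i, (v i : ℕ∞) < M.dom.size :=
    fun v => Measurable.forall fun i => measurable_lt _
  have hsnoc : ∀ {n : ℕ} (M : Str L) (v : Fin n → ℕ) (h : ∀ i, (v i : ℕ∞) < M.dom.size)
      (k : ℕ) (hk : (k : ℕ∞) < M.dom.size)
      (h' : ∀ i, ((Fin.snoc (α := fun _ => ℕ) v k i : ℕ) : ℕ∞) < M.dom.size),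
      Fin.snoc (α := fun _ => M.dom.El) (fun i => ⟨v i, h i⟩) ⟨k, hk⟩ =
        fun i => ⟨Fin.snoc (α := fun _ => ℕ) v k i, h' i⟩ := by
    intro n M v h k hk h'
    funext i
    refine Fin.lastCases ?_ (fun i => ?_) i
    · simp
    · simp
  have hsnoc' : ∀ {n : ℕ} (M : Str L) (v : Fin n → ℕ) (_ : ∀ i, (v i : ℕ∞) < M.dom.size)
      (k : ℕ) (_ : (k : ℕ∞) < M.dom.size) (i : Fin (n + 1)),
      ((Fin.snoc (α := fun _ => ℕ) v k i : ℕ) : ℕ∞) < M.dom.size := by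
    intro n M v h k hk i
    refine Fin.lastCases ?_ (fun i => ?_) i
    · simpa using hk
    · simpa using h i
  induction φ with
  | rel R x =>
    intro v
    refine ((hv v).and (measurable_holds R (v ∘ x))).congr_prop fun M => ?_
    exact ⟨fun ⟨h, _, h'⟩ => ⟨h, h'⟩, fun ⟨h, h'⟩ => ⟨h, fun i => h (x i), h'⟩⟩
  | eq i j =>
    intro v
    refine ((hv v).and (measurable_const (a := v i = v j))).congr_prop fun M => ?_
    exact ⟨fun ⟨h, h'⟩ => ⟨h, Subtype.ext h'⟩, fun ⟨h, h'⟩ => ⟨h, congrArg Subtype.val h'⟩⟩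
  | neg φ ih =>
    intro v
    refine ((hv v).and (ih v).not).congr_prop fun M => ?_
    exact ⟨fun ⟨h, h'⟩ => ⟨h, fun h'' => h' ⟨h, h''⟩⟩, fun ⟨h, h'⟩ => ⟨h, fun ⟨_, h''⟩ => h' h''⟩⟩
  | conj I φ ih =>
    intro v
    refine ((hv v).and (Measurable.forall fun i => ih i v)).congr_prop fun M => ?_
    exact ⟨fun ⟨h, h'⟩ => ⟨h, fun i => (h' i).2⟩, fun ⟨h, h'⟩ => ⟨h, fun i => ⟨h, h' i⟩⟩⟩
  | disj I φ ih =>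
    intro v
    refine ((hv v).and (Measurable.exists fun i => ih i v)).congr_prop fun M => ?_
    exact ⟨fun ⟨h, i, _, h'⟩ => ⟨h, i, h'⟩, fun ⟨h, i, h'⟩ => ⟨h, i, h, h'⟩⟩
  | all φ ih =>
    intro v
    refine ((hv v).and (Measurable.forall fun k =>
      (measurable_lt k).imp (ih (Fin.snoc (α := fun _ => ℕ) v k)))).congr_prop fun M => ?_
    constructor
    · rintro ⟨h, h'⟩
      refine ⟨h, fun a => ?_⟩
      obtain ⟨h1, h2⟩ := h' a.1 a.2
      rw [← hsnoc M v h a.1 a.2] at h2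
      exact h2
    · rintro ⟨h, h'⟩
      refine ⟨h, fun k hk => ⟨hsnoc' M v h k hk, ?_⟩⟩
      rw [← hsnoc M v h k hk]
      exact h' ⟨k, hk⟩
  | ex φ ih =>
    intro v
    refine ((hv v).and (Measurable.exists fun k =>
      (measurable_lt k).and (ih (Fin.snoc (α := fun _ => ℕ) v k)))).congr_prop fun M => ?_
    constructor
    · rintro ⟨h, k, hk, h1, h2⟩
      refine ⟨h, ⟨k, hk⟩, ?_⟩
      rw [← hsnoc M v h k hk] at h2
      exact h2
    · rintro ⟨h, a, h'⟩
      refine ⟨h, a.1, a.2, hsnoc' M v h a.1 a.2, ?_⟩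
      rw [← hsnoc M v h a.1 a.2]
      exact h'

end Str

namespace Model

variable {T : Theory}

theorem measurable_str : Measurable (Model.str (T := T)) := comap_measurable _

instance : StandardBorelSpace (Model T) := by
  refine standardBorel_comap Model.str (fun M N h => Model.ext h) ?_
  have : Set.range (Model.str (T := T)) = ⋂ χ ∈ T.ax, {M | ∃ h : ∀ i : Fin 0,
      (((Fin.elim0 i : ℕ)) : ℕ∞) < M.dom.size, M.Sat χ fun i => ⟨Fin.elim0 i, h i⟩} := by
    ext M
    simp only [Set.mem_range, Set.mem_iInter]
    constructor
    · rintro ⟨M, rfl⟩ χ hχ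
      refine ⟨fun i => i.elim0, ?_⟩
      convert M.models χ hχ
    · intro h
      refine ⟨⟨M, fun χ hχ => ?_⟩, rfl⟩
      obtain ⟨_, h'⟩ := h χ hχ
      convert h'
  rw [this]
  exact MeasurableSet.biInter T.countable fun χ _ =>
    measurableSet_setOfPred.2 (Str.measurable_sat χ Fin.elim0)

theorem measurable_arrowCode : Measurable (arrowCode (T := T)) := comap_measurable _

theorem measurable_src : Measurable fun f : Arrow (Model T) => f.left :=
  measurable_fst.comp measurable_arrowCode

theorem measurable_tgt : Measurable fun f : Arrow (Model T) => f.right :=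
  measurable_fst.comp (measurable_snd.comp measurable_arrowCode)

theorem measurable_maps (k l : ℕ) : Measurable fun f : Arrow (Model T) => Maps f k l :=
  (measurable_pi_apply l).comp ((measurable_pi_apply k).comp
    (measurable_snd.comp (measurable_snd.comp measurable_arrowCode)))

theorem measurable_to_arrow {α : Type} [MeasurableSpace α] {f : α → Arrow (Model T)}
    (h1 : Measurable fun a => (f a).left) (h2 : Measurable fun a => (f a).right)
    (h3 : ∀ k l, Measurable fun a => Maps (f a) k l) : Measurable f :=
  measurable_comap_iff.2 (h1.prodMk (h2.prodMk
    (measurable_pi_lambda _ fun k => measurable_pi_lambda _ fun l => h3 k l)))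

theorem arrowCode_injective : Function.Injective (arrowCode (T := T)) := by
  rintro ⟨M, N, f⟩ ⟨M', N', f'⟩ h
  simp only [arrowCode, Prod.mk.injEq] at h
  obtain ⟨rfl, rfl, h⟩ := h
  congr 1
  refine Str.Iso.ext (Equiv.ext fun a => Subtype.ext ?_)
  have := (congrFun (congrFun h a.1) (Str.Iso.equiv f a)).mp ⟨a.2, rfl⟩
  obtain ⟨_, h⟩ := this
  exact h.symm

theorem range_arrowCode : Set.range (arrowCode (T := T)) =
    {p | (∀ k l : ℕ, p.2.2 k l → (k : ℕ∞) < p.1.str.dom.size ∧ (l : ℕ∞) < p.2.1.str.dom.size) ∧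
      (∀ k : ℕ, (k : ℕ∞) < p.1.str.dom.size → ∃ l : ℕ, p.2.2 k l) ∧
      (∀ l : ℕ, (l : ℕ∞) < p.2.1.str.dom.size → ∃ k : ℕ, p.2.2 k l) ∧
      (∀ k l l' : ℕ, p.2.2 k l → p.2.2 k l' → l = l') ∧
      (∀ k k' l : ℕ, p.2.2 k l → p.2.2 k' l → k = k') ∧
      ∀ (R : T.L.Sym) (a b : Fin (T.L.arity R) → ℕ), (∀ i, p.2.2 (a i) (b i)) →
        (p.2.1.str.Holds R b ↔ p.1.str.Holds R a)} := by
  ext ⟨M, N, r⟩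
  constructor
  · rintro ⟨⟨M, N, f⟩, h⟩
    simp only [arrowCode, Prod.mk.injEq] at h
    obtain ⟨rfl, rfl, rfl⟩ := h
    let e : M.str.dom.El ≃ N.str.dom.El := Str.Iso.equiv f
    refine ⟨?_, ?_, ?_, ?_, ?_, ?_⟩
    · rintro k l ⟨h, rfl⟩
      exact ⟨h, (e ⟨k, h⟩).2⟩
    · intro k h
      exact ⟨_, h, rfl⟩
    · intro l h
      refine ⟨e.symm ⟨l, h⟩, (e.symm ⟨l, h⟩).2, ?_⟩
      exact congrArg Subtype.val (e.apply_symm_apply ⟨l, h⟩)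
    · rintro k l l' ⟨h, rfl⟩ ⟨_, rfl⟩
      rfl
    · rintro k k' l ⟨h, rfl⟩ ⟨h', h2⟩
      exact (congrArg Subtype.val (e.injective (Subtype.ext h2))).symm
    · intro R a b h
      choose ha hb using h
      obtain rfl : (fun i => (e ⟨a i, ha i⟩ : ℕ)) = b := funext hb
      have := Str.Iso.map_rel f R fun i => ⟨a i, ha i⟩
      exact ⟨fun ⟨_, h⟩ => ⟨ha, this.1 h⟩, fun ⟨_, h⟩ => ⟨fun i => (e ⟨a i, ha i⟩).2, this.2 h⟩⟩
  · rintro ⟨h1, h2, h3, h4, h5, h6⟩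
    choose u hu using h2
    choose w hw using h3
    let e : M.str.dom.El ≃ N.str.dom.El :=
      { toFun := fun a => ⟨u a.1 a.2, (h1 _ _ (hu a.1 a.2)).2⟩
        invFun := fun a => ⟨w a.1 a.2, (h1 _ _ (hw a.1 a.2)).1⟩
        left_inv := fun a => Subtype.ext (h5 _ _ _ (hw _ _) (hu a.1 a.2))
        right_inv := fun a => Subtype.ext (h4 _ _ _ (hu _ _) (hw a.1 a.2)) }
    let f : M ⟶ N := (⟨e, fun R a => by
      have := h6 R (fun i => (a i : ℕ)) (fun i => (e (a i) : ℕ)) (fun i => hu (a i).1 (a i).2)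
      exact ⟨fun h => (this.1 ⟨fun i => (e (a i)).2, h⟩).2,
        fun h => (this.2 ⟨fun i => (a i).2, h⟩).2⟩⟩ : Str.Iso M.str N.str)
    refine ⟨Arrow.mk f, ?_⟩
    refine Prod.ext rfl (Prod.ext rfl ?_)
    funext k l
    refine propext ⟨?_, fun h => ⟨(h1 k l h).1, h4 _ _ _ (hu k (h1 k l h).1) h⟩⟩
    rintro ⟨h, rfl⟩
    exact hu k h

instance : StandardBorelSpace (Arrow (Model T)) := by
  have := T.L.countable
  refine standardBorel_comap arrowCode arrowCode_injective ?_
  rw [range_arrowCode, measurableSet_setOfPred]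
  have hr : ∀ k l, Measurable fun p : Model T × Model T × (ℕ → ℕ → Prop) => p.2.2 k l := fun k l =>
    (measurable_pi_apply l).comp ((measurable_pi_apply k).comp
      (measurable_snd.comp measurable_snd))
  have h1 : Measurable fun p : Model T × Model T × (ℕ → ℕ → Prop) => p.1.str :=
    measurable_str.comp measurable_fst
  have h2 : Measurable fun p : Model T × Model T × (ℕ → ℕ → Prop) => p.2.1.str :=
    measurable_str.comp (measurable_fst.comp measurable_snd)
  have hl1 : ∀ k : ℕ, Measurable fun p : Model T × Model T × (ℕ → ℕ → Prop) =>
      (k : ℕ∞) < p.1.str.dom.size := fun k => (Str.measurable_lt k).comp h1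
  have hl2 : ∀ k : ℕ, Measurable fun p : Model T × Model T × (ℕ → ℕ → Prop) =>
      (k : ℕ∞) < p.2.1.str.dom.size := fun k => (Str.measurable_lt k).comp h2
  refine Measurable.and ?_ (Measurable.and ?_ (Measurable.and ?_ (Measurable.and ?_
    (Measurable.and ?_ ?_))))
  · exact Measurable.forall fun k => Measurable.forall fun l =>
      (hr k l).imp ((hl1 k).and (hl2 l))
  · exact Measurable.forall fun k => (hl1 k).imp (Measurable.exists fun l => hr k l)
  · exact Measurable.forall fun l => (hl2 l).imp (Measurable.exists fun k => hr k l)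
  · exact Measurable.forall fun k => Measurable.forall fun l => Measurable.forall fun l' =>
      (hr k l).imp ((hr k l').imp measurable_const)
  · exact Measurable.forall fun k => Measurable.forall fun k' => Measurable.forall fun l =>
      (hr k l).imp ((hr k' l).imp measurable_const)
  · exact Measurable.forall fun R => Measurable.forall fun a => Measurable.forall fun b =>
      (Measurable.forall fun i => hr (a i) (b i)).imp
        (((Str.measurable_holds R b).comp h2).iff ((Str.measurable_holds R a).comp h1))

end Model

/-! ### Standard Borel groupoids -/

section Borel

variable {G H : Type} [Category.{0} G] [Category.{0} H]

/-- The space of composable pairs of morphisms. -/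
abbrev Composable (G : Type) [Category.{0} G] : Type :=
  {p : Arrow G × Arrow G // p.1.right = p.2.left}

/-- Composition as a map on composable pairs. -/
def Composable.mul (p : Composable G) : Arrow G :=
  Arrow.mk (p.1.1.hom ≫ eqToHom p.2 ≫ p.1.2.hom)

theorem Composable.mul_mk {x y z : G} (f : x ⟶ y) (g : y ⟶ z) :
    Composable.mul (⟨(Arrow.mk f, Arrow.mk g), rfl⟩ : Composable G) = Arrow.mk (f ≫ g) := by
  change Arrow.mk (f ≫ 𝟙 y ≫ g) = _
  rw [Category.id_comp]

end Borel

/-- A standard Borel groupoid: the sets of objects and of morphisms are standard Borel spaces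
and all structure maps are Borel. -/
structure BorGpd : Type 1 where
  Obj : Type
  [gpd : Groupoid.{0} Obj]
  [mObj : MeasurableSpace Obj]
  [sObj : StandardBorelSpace Obj]
  [mArr : MeasurableSpace (Arrow Obj)]
  [sArr : StandardBorelSpace (Arrow Obj)]
  src : Measurable fun f : Arrow Obj => f.left
  tgt : Measurable fun f : Arrow Obj => f.right
  one : Measurable fun x : Obj => Arrow.mk (𝟙 x)
  mul : Measurable fun p : Composable Obj => p.mul
  inv : Measurable fun f : Arrow Obj => Arrow.mk (Groupoid.inv f.hom)

attribute [instance] BorGpd.gpd BorGpd.mObj BorGpd.sObj BorGpd.mArr BorGpd.sArr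

namespace BorGpd

/-- A Borel functor. -/
structure Fun (G H : BorGpd) : Type where
  functor : G.Obj ⥤ H.Obj
  obj : Measurable fun x : G.Obj => functor.obj x
  map : Measurable fun f : Arrow G.Obj => Arrow.mk (functor.map f.hom)

/-- A Borel natural transformation (automatically invertible, between groupoids). -/
@[ext] structure Trans {G H : BorGpd} (F F' : Fun G H) : Type where
  nat : F.functor ⟶ F'.functor
  app : Measurable fun x : G.Obj => Arrow.mk (nat.app x)

variable {G H K : BorGpd}

theorem measurable_comp {α : Type} [MeasurableSpace α] {x y z : α → G.Obj}
    {f : (a : α) → x a ⟶ y a} {g : (a : α) → y a ⟶ z a}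
    (hf : Measurable fun a => Arrow.mk (f a)) (hg : Measurable fun a => Arrow.mk (g a)) :
    Measurable fun a => Arrow.mk (f a ≫ g a) := by
  have h : Measurable fun a =>
      (⟨(Arrow.mk (f a), Arrow.mk (g a)), rfl⟩ : Composable G.Obj) :=
    (hf.prodMk hg).subtype_mk
  exact (funext fun a => Composable.mul_mk (f a) (g a)) ▸ G.mul.comp h

instance (G H : BorGpd) : Category.{0} (Fun G H) where
  Hom F F' := Trans F F'
  id F := ⟨𝟙 F.functor, H.one.comp F.obj⟩
  comp s t := ⟨s.nat ≫ t.nat, measurable_comp s.app t.app⟩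
  id_comp _ := Trans.ext (Category.id_comp _)
  comp_id _ := Trans.ext (Category.comp_id _)
  assoc _ _ _ := Trans.ext (Category.assoc _ _ _)

@[simp] theorem id_nat (F : Fun G H) : Trans.nat (𝟙 F) = 𝟙 F.functor := rfl

@[simp] theorem comp_nat {F F' F'' : Fun G H} (s : F ⟶ F') (t : F' ⟶ F'') :
    Trans.nat (s ≫ t) = Trans.nat s ≫ Trans.nat t := rfl

theorem hom_ext {F F' : Fun G H} {s t : F ⟶ F'}
    (h : ∀ x, (Trans.nat s).app x = (Trans.nat t).app x) : s = t :=
  Trans.ext (NatTrans.ext (funext h))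

/-- The identity functor. -/
abbrev idFun (G : BorGpd) : Fun G G := ⟨𝟭 G.Obj, measurable_id, measurable_id⟩

/-- Composition of Borel functors. -/
abbrev comp (F : Fun G H) (F' : Fun H K) : Fun G K :=
  ⟨F.functor ⋙ F'.functor, F'.obj.comp F.obj, F'.map.comp F.map⟩

/-- Whiskering on the left. -/
@[simps] abbrev whL (F : Fun G H) {F' F'' : Fun H K} (s : F' ⟶ F'') :
    comp F F' ⟶ comp F F'' where
  nat := Functor.whiskerLeft F.functor s.nat
  app := s.app.comp F.obj

/-- Whiskering on the right. -/
@[simps] abbrev whR {F F' : Fun G H} (s : F ⟶ F') (F'' : Fun H K) :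
    comp F F'' ⟶ comp F' F'' where
  nat := Functor.whiskerRight s.nat F''.functor
  app := F''.map.comp s.app

/-- A natural isomorphism with identity components. -/
@[simps] abbrev isoOf {F F' : Fun G H} (h : F.functor ≅ F'.functor)
    (h1 : Measurable fun x => Arrow.mk (h.hom.app x))
    (h2 : Measurable fun x => Arrow.mk (h.inv.app x)) : F ≅ F' where
  hom := ⟨h.hom, h1⟩
  inv := ⟨h.inv, h2⟩
  hom_inv_id := Trans.ext h.hom_inv_id
  inv_hom_id := Trans.ext h.inv_hom_id

end BorGpd

open BorGpd in
/-- The 2-category of standard Borel groupoids, Borel functors, and Borel natural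
isomorphisms. -/
instance borGpdBicategory : Bicategory.{0, 0} BorGpd where
  Hom G H := Fun G H
  id G := idFun G
  comp F F' := BorGpd.comp F F'
  homCategory G H := inferInstanceAs (Category (Fun G H))
  whiskerLeft F _ _ s := whL F s
  whiskerRight s F := whR s F
  associator {_ _ _ K} F F' F'' := isoOf (Functor.associator F.functor F'.functor F''.functor)
    (K.one.comp ((F''.obj.comp F'.obj).comp F.obj))
    (K.one.comp ((F''.obj.comp F'.obj).comp F.obj))
  leftUnitor {_ H} F := isoOf (Functor.leftUnitor F.functor) (H.one.comp F.obj) (H.one.comp F.obj)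
  rightUnitor {_ H} F :=
    isoOf (Functor.rightUnitor F.functor) (H.one.comp F.obj) (H.one.comp F.obj)
  whiskerLeft_id F G := by apply BorGpd.hom_ext; intro X; simp
  whiskerLeft_comp F _ _ _ f g := by apply BorGpd.hom_ext; intro X; simp
  id_whiskerLeft f := by apply BorGpd.hom_ext; intro X; simp
  comp_whiskerLeft F G _ _ f := by apply BorGpd.hom_ext; intro X; simp
  id_whiskerRight F G := by apply BorGpd.hom_ext; intro X; simp
  comp_whiskerRight f g H := by apply BorGpd.hom_ext; intro X; simp
  whiskerRight_id f := by apply BorGpd.hom_ext; intro X; simp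
  whiskerRight_comp f G H := by apply BorGpd.hom_ext; intro X; simp
  whisker_assoc F _ _ f H := by apply BorGpd.hom_ext; intro X; simp
  whisker_exchange f g := by apply BorGpd.hom_ext; intro X; simp
  pentagon F G H I := by apply BorGpd.hom_ext; intro X; simp
  triangle F G := by apply BorGpd.hom_ext; intro X; simp

/-- A small groupoid. -/
structure Gpd : Type 1 where
  Obj : Type
  [gpd : Groupoid.{0} Obj]

attribute [instance] Gpd.gpd

/-- The 2-category of small groupoids, functors, and natural transformations (automatically
isomorphisms). -/
instance gpdBicategory : Bicategory.{0, 0} Gpd where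
  Hom G H := G.Obj ⥤ H.Obj
  id G := 𝟭 G.Obj
  comp F F' := F ⋙ F'
  homCategory G H := inferInstanceAs (Category (G.Obj ⥤ H.Obj))
  whiskerLeft F _ _ s := Functor.whiskerLeft F s
  whiskerRight s F := Functor.whiskerRight s F
  associator F F' F'' := Functor.associator F F' F''
  leftUnitor F := Functor.leftUnitor F
  rightUnitor F := Functor.rightUnitor F
  whiskerLeft_id F G := by apply NatTrans.ext; funext X; simp
  whiskerLeft_comp F _ _ _ f g := by apply NatTrans.ext; funext X; simp
  id_whiskerLeft f := by apply NatTrans.ext; funext X; simp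
  comp_whiskerLeft F G _ _ f := by apply NatTrans.ext; funext X; simp
  id_whiskerRight F G := by apply NatTrans.ext; funext X; simp
  comp_whiskerRight f g H := by apply NatTrans.ext; funext X; simp
  whiskerRight_id f := by apply NatTrans.ext; funext X; simp
  whiskerRight_comp f G H := by apply NatTrans.ext; funext X; simp
  whisker_assoc F _ _ f H := by apply NatTrans.ext; funext X; simp
  whisker_exchange f g := by apply NatTrans.ext; funext X; simp
  pentagon F G H I := by apply NatTrans.ext; funext X; simp
  triangle F G := by apply NatTrans.ext; funext X; simp

/-! ### The groupoid of models as a standard Borel groupoid -/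

namespace Model

variable {T : Theory}

theorem maps_id (M : Model T) (k l : ℕ) :
    Maps (Arrow.mk (𝟙 M)) k l ↔ (k : ℕ∞) < M.str.dom.size ∧ k = l :=
  ⟨fun ⟨h, h'⟩ => ⟨h, h'⟩, fun ⟨h, h'⟩ => ⟨h, h'⟩⟩

theorem maps_inv (f : Arrow (Model T)) (k l : ℕ) :
    Maps (Arrow.mk (Groupoid.inv f.hom)) k l ↔ Maps f l k := by
  let e : f.left.str.dom.El ≃ f.right.str.dom.El := Str.Iso.equiv f.hom
  constructor
  · rintro ⟨h, rfl⟩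
    exact ⟨(e.symm ⟨k, h⟩).2, congrArg Subtype.val (e.apply_symm_apply ⟨k, h⟩)⟩
  · rintro ⟨h, rfl⟩
    exact ⟨(e ⟨l, h⟩).2, congrArg Subtype.val (e.symm_apply_apply ⟨l, h⟩)⟩

theorem maps_mul (p : Composable (Model T)) (k l : ℕ) :
    Maps p.mul k l ↔ ∃ m, Maps p.1.1 k m ∧ Maps p.1.2 m l := by
  obtain ⟨⟨⟨M, N, f⟩, ⟨N', P, g⟩⟩, h⟩ := p
  change N = N' at h
  subst h
  have := Composable.mul_mk f g
  change Maps (Composable.mul (⟨(Arrow.mk f, Arrow.mk g), rfl⟩ : Composable (Model T))) k l ↔ _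
  rw [this]
  constructor
  · rintro ⟨h, h'⟩
    exact ⟨_, ⟨h, rfl⟩, (Str.Iso.equiv f ⟨k, h⟩).2, h'⟩
  · rintro ⟨m, ⟨h, rfl⟩, h', h''⟩
    exact ⟨h, h''⟩

end Model

open Model in
/-- The standard Borel groupoid `MOD(T)` of countable models of `T`. -/
def modGpd (T : Theory) : BorGpd where
  Obj := Model T
  src := measurable_src
  tgt := measurable_tgt
  one := measurable_to_arrow measurable_id measurable_id fun k l =>
    (((Str.measurable_lt k).comp measurable_str).and measurable_const).congr_prop
      fun M => (maps_id M k l).symm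
  mul := by
    have h1 : Measurable fun p : Composable (Model T) => p.1.1 :=
      measurable_fst.comp measurable_subtype_coe
    have h2 : Measurable fun p : Composable (Model T) => p.1.2 :=
      measurable_snd.comp measurable_subtype_coe
    have h3 : Measurable fun p : Composable (Model T) => p.1.1.left := measurable_src.comp h1
    have h4 : Measurable fun p : Composable (Model T) => p.1.2.right := measurable_tgt.comp h2
    refine measurable_to_arrow h3 h4 fun k l => ?_
    exact (Measurable.exists fun m : ℕ => ((measurable_maps k m).comp h1).and
      ((measurable_maps m l).comp h2)).congr_prop fun p => (maps_mul p k l).symm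
  inv := measurable_to_arrow measurable_tgt measurable_src fun k l =>
    (measurable_maps l k).congr_prop fun f => (maps_inv f k l).symm

/-! ### The pseudofunctors -/

open Opposite Bicategory

/-- The forgetful 2-functor from standard Borel groupoids to small groupoids. -/
def forgetBorel : Pseudofunctor BorGpd Gpd where
  obj G := ⟨G.Obj⟩
  map F := F.functor
  map₂ s := s.nat
  mapId G := Iso.refl (𝟭 G.Obj)
  mapComp F F' := Iso.refl (F.functor ⋙ F'.functor)
  map₂_whisker_left {_ _ K} F _ _ s := by
    apply NatTrans.ext; funext X
    exact ((Category.id_comp _).trans (Category.comp_id _)).symm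
  map₂_whisker_right {_ _ K} _ _ s F := by
    apply NatTrans.ext; funext X
    exact ((Category.id_comp _).trans (Category.comp_id _)).symm
  map₂_associator F F' F'' := by
    apply NatTrans.ext; funext X
    change 𝟙 _ = 𝟙 _ ≫ F''.functor.map (𝟙 _) ≫ 𝟙 _ ≫ 𝟙 _ ≫ 𝟙 _
    simp
  map₂_left_unitor F := by
    apply NatTrans.ext; funext X
    change 𝟙 _ = 𝟙 _ ≫ F.functor.map (𝟙 _) ≫ 𝟙 _
    simp
  map₂_right_unitor F := by
    apply NatTrans.ext; funext X
    change 𝟙 _ = 𝟙 _ ≫ 𝟙 _ ≫ 𝟙 _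
    simp

/-- The groupoid of `ω₁`-coherent functors from the syntactic category of `T` to `Count`. -/
def cohGpd (T : Theory) : Gpd where
  Obj := CohFun (ImSort T) Count

/-- The 2-functor `T ↦ ω₁PTop(syntactic category of T, Count)`, contravariant on
interpretations, which act by precomposition. -/
def cohPsf : Pseudofunctor Theoryᵒᵖ Gpd where
  obj T := cohGpd T.unop
  map F := CohFun.precomp F.unop Count
  map₂ s :=
    { app := fun M => CohFun.whR s.unop2 M
      naturality := fun M N f => by
        apply CohFun.hom_ext; intro X
        exact (f.iso.hom.naturality (s.unop2.iso.hom.app X)).symm }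
  map₂_id F := by
    apply NatTrans.ext; funext M; apply CohFun.hom_ext; intro X
    exact M.functor.map_id _
  map₂_comp s t := by
    apply NatTrans.ext; funext M; apply CohFun.hom_ext; intro X
    exact M.functor.map_comp _ _
  mapId T := Iso.refl (𝟭 (CohFun (ImSort T.unop) Count))
  mapComp F F' := Iso.refl (CohFun.precomp F.unop Count ⋙ CohFun.precomp F'.unop Count)
  map₂_whisker_left F _ _ s := by
    apply NatTrans.ext; funext M; apply CohFun.hom_ext; intro X
    exact ((Category.id_comp _).trans (Category.comp_id _)).symm
  map₂_whisker_right s F := by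
    apply NatTrans.ext; funext M; apply CohFun.hom_ext; intro X
    exact ((Category.id_comp _).trans (Category.comp_id _)).symm
  map₂_associator F F' F'' := by
    apply NatTrans.ext; funext M; apply CohFun.hom_ext; intro X
    exact M.functor.map_id _
  map₂_left_unitor F := by
    apply NatTrans.ext; funext M; apply CohFun.hom_ext; intro X
    exact M.functor.map_id _
  map₂_right_unitor F := by
    apply NatTrans.ext; funext M; apply CohFun.hom_ext; intro X
    exact M.functor.map_id _

/-! ### Models versus coherent functors -/

/-- The bijection underlying an isomorphism of `Count`. -/
def Count.equivOfIso {M N : Count} (f : M ≅ N) : M.El ≃ N.El where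
  toFun := f.hom
  invFun := f.inv
  left_inv := congrFun f.hom_inv_id
  right_inv := congrFun f.inv_hom_id

/-- The functor `F ↦ F_*(X)`, where `X` is the universal model in the syntactic category: the
underlying set is `F(X)`, and `R` is interpreted as the image of `F(R) ↪ F(X^n) ≅ F(X)^n`. -/
def push (T : Theory) : CohFun (ImSort T) Count ⥤ Str T.L where
  obj F :=
    { dom := F.functor.obj (homeSort T)
      rel := fun R => {a | ∃ r : (F.functor.obj (ImSort.ofFormula (relFormula R))).El,
        ∀ i, a i = F.functor.map (coord (relFormula R) i) r} }
  map {F G} τ :=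
    { equiv := Count.equivOfIso (τ.iso.app (homeSort T))
      map_rel := fun R a => by
        have nat : ∀ i r, τ.iso.hom.app (homeSort T) (F.functor.map (coord (relFormula R) i) r) =
            G.functor.map (coord (relFormula R) i) (τ.iso.hom.app _ r) := fun i r =>
          congrFun (τ.iso.hom.naturality (coord (relFormula R) i)) r
        constructor
        · rintro ⟨r, hr⟩
          let e := Count.equivOfIso (τ.iso.app (ImSort.ofFormula (relFormula R)))
          refine ⟨e.symm r, fun i => (Count.equivOfIso (τ.iso.app (homeSort T))).injective ?_⟩
          refine (hr i).trans ?_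
          refine Eq.trans ?_ (nat i (e.symm r)).symm
          exact congrArg _ (e.apply_symm_apply r).symm
        · rintro ⟨r, hr⟩
          exact ⟨τ.iso.hom.app _ r, fun i => (congrArg _ (hr i)).trans (nat i r)⟩ }
  map_id F := Str.Iso.ext (Equiv.ext fun _ => rfl)
  map_comp f g := Str.Iso.ext (Equiv.ext fun _ => rfl)

/-- `K` and `L` are mutually inverse equivalences, via `ζ : K ∘ L ≅ 1`, between the groupoid of
countable models of `T` and that of `ω₁`-coherent functors to `Count`, where `L` is `F ↦ F_*(X)`,
and `K`, `ζ` are Borel in the following sense. -/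
structure IsRetraction (T : Theory) (K : Model T ⥤ CohFun (ImSort T) Count)
    (L : CohFun (ImSort T) Count ⥤ Model T) (ζ : L ⋙ K ⟶ 𝟭 (CohFun (ImSort T) Count)) :
    Prop where
  /-- `L` is the functor `F ↦ F_*(X)` -/
  push_eq : L ⋙ Model.incl T = push T
  /-- `L ∘ K = 1` on the nose, and `ζ_{K(M)} = 1` -/
  retract : ∃ h : K ⋙ L = 𝟭 (Model T), ∀ M : Model T,
    ζ.app (K.obj M) = eqToHom (congrArg K.obj (Functor.congr_obj h M))
  /-- for each imaginary sort `A`, the functor `K(-)(A)` is Borel -/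
  borel_obj : ∀ A : ImSort T, Measurable fun M : Model T => ((K.obj M).functor.obj A).size
  borel_map : ∀ A : ImSort T, Measurable fun g : Arrow (Model T) =>
    Arrow.mk ((K.map g.hom).iso.hom.app A)
  /-- for each definable function `f`, the natural transformation `K(-)(f)` is Borel -/
  borel_nat : ∀ {A B : ImSort T} (f : A ⟶ B), Measurable fun M : Model T =>
    Arrow.mk ((K.obj M).functor.map f)
  /-- for each imaginary sort `A`, there is a countable subcategory `S` such that `ζ_{F,A}` depends
  only on `F|S`, in a Borel way -/
  borel_zeta : ∀ A : ImSort T, ∃ S : Set (Arrow (ImSort T)), S.Countable ∧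
    (∀ f ∈ S, Arrow.mk (𝟙 f.left) ∈ S ∧ Arrow.mk (𝟙 f.right) ∈ S) ∧
    (∀ p : Composable (ImSort T), p.1.1 ∈ S → p.1.2 ∈ S → p.mul ∈ S) ∧
    ∃ b : (S → Arrow Count) → Arrow Count, Measurable b ∧
      ∀ F : CohFun (ImSort T) Count, Arrow.mk ((ζ.app F).iso.hom.app A) =
        b fun s => Arrow.mk (F.functor.map s.1.hom)

/-- `IsRetraction` for a groupoid which is equal to `MOD(T)`. -/
def IsRetractionAt (T : Theory) {G : BorGpd} (h : modGpd T = G)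
    (K : G.Obj ⥤ CohFun (ImSort T) Count) (L : CohFun (ImSort T) Count ⥤ G.Obj)
    (ζ : L ⋙ K ⟶ 𝟭 (CohFun (ImSort T) Count)) : Prop :=
  match G, h, K, L, ζ with
  | _, rfl, K, L, ζ => IsRetraction T K L ζ

end Lw1w

open scoped CategoryTheory.Pseudofunctor.StrongTrans

/-! A countable model `M` and a coherent functor `F` to `Count` carry the same information. From
`M`, interpret each imaginary sort `A` as the set `Sem M A` of classes of points and each definable
function by its graph. From `F`, take the set `F(X)` with the relations cut out by the `F(R)`, which
is the structure `F_*(X)`. The proof shows that these constructions are inverse up to an isomorphism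
`ζ`, and that the first can be carried out on initial segments of `ℕ` in a Borel way.

The logical input is completeness of the deduction calculus for countable theories (`complete`),
proved by a generic term model for a countable fragment. It makes the syntactic category
transparent: definable functions are equal as soon as they agree in all countable models
(`syn_hom_ext`), and a relation given by formulas which is functional in all of them is the graph of
a definable function (`IsDef.exists_hom`). Hence limits and colimits of sorts are recognised
elementwise in models, and the interpretation in a model is coherent (`isCoherent_of_sem`).

Conversely, a coherent `F` preserves countable covers (`CohFun.exists_of_sem_cover`), pullbacks and
emptiness. By induction on `α`, a tuple in `F(X)` then comes from `F(α)` exactly when it satisfies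
`α` in `F_*(X)` (`CohFun.hits_iff`). So `F_*(X)` is a model. Since `A` is covered by its formulas
`αᵢ`, glued along the `εᵢⱼ`, the set `F(A)` is recovered from `F_*(X)`, and this is `ζ`. At the home
sort `ζ` does not change the underlying numbers, and a natural isomorphism is determined there
(`CohFun.hom_ext_homeSort`), so most coherence equations become comparisons of natural numbers.

To land in `Count`, a point is named by its index `i` and a tuple of naturals. Names are numbered
injectively, once for all models, and a class is numbered by the rank of its least name. For the
home sort a name is numbered by its single entry, so the universe is recovered unchanged and `L ∘ K
= 1` holds as an equality. Borelness follows because every condition is a countable combination of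
conditions that a fixed formula holds at a fixed tuple of naturals. For `ζ`, only countably many
morphisms of `F` are read, and a measurable factorisation gives the Borel dependence.

Finally, `MOD` on interpretations is the conjugate `L ∘ F^* ∘ K`. Its constraints, and the
pseudonaturality of `K` and `L`, are built from `ζ` and the equality `L ∘ K = 1`; the axioms reduce
to naturality of `ζ` and the two triangle identities. -/

namespace Lw1w

open Formula

/-! ### Satisfaction and substitution -/

namespace Str

variable {L : RelLang} (M : Str L)

theorem snoc_liftVar {D : Type} {n m : ℕ} (σ : Fin n → Fin m) (v : Fin m → D) (a : D) :
    Fin.snoc (α := fun _ => D) v a ∘ liftVar σ = Fin.snoc (α := fun _ => D) (v ∘ σ) a := by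
  funext i
  refine Fin.lastCases ?_ (fun i => ?_) i <;> simp [liftVar]

theorem sat_subst {n : ℕ} (φ : Formula L n) : ∀ {m : ℕ} (σ : Fin n → Fin m)
    (v : Fin m → M.dom.El), M.Sat (φ.subst σ) v ↔ M.Sat φ (v ∘ σ) := by
  induction φ with
  | rel R x => intros; rfl
  | eq i j => intros; rfl
  | neg φ ih => intro m σ v; exact not_congr (ih σ v)
  | conj I φ ih => intro m σ v; exact forall_congr' fun i => ih i σ v
  | disj I φ ih => intro m σ v; exact exists_congr fun i => ih i σ v
  | all φ ih =>
    intro m σ v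
    refine forall_congr' fun a => (ih _ _).trans ?_
    rw [snoc_liftVar]
  | ex φ ih =>
    intro m σ v
    refine exists_congr fun a => (ih _ _).trans ?_
    rw [snoc_liftVar]

theorem append_cat {D : Type} {n k m : ℕ} (x : Fin n → Fin m) (y : Fin k → Fin m)
    (v : Fin m → D) : v ∘ cat x y = Fin.append (v ∘ x) (v ∘ y) := by
  funext i
  refine Fin.addCases (fun i => ?_) (fun i => ?_) i <;> simp [cat]

@[simp] theorem append_castAdd {D : Type} {n k : ℕ} (a : Fin n → D) (b : Fin k → D) :
    Fin.append a b ∘ Fin.castAdd k = a := by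
  funext i; simp

@[simp] theorem append_natAdd {D : Type} {n k : ℕ} (a : Fin n → D) (b : Fin k → D) :
    Fin.append a b ∘ Fin.natAdd n = b := by
  funext i; simp

theorem exists_append {D : Type} {n k : ℕ} (v : Fin (n + k) → D) :
    ∃ a b, v = Fin.append a b :=
  ⟨v ∘ Fin.castAdd k, v ∘ Fin.natAdd n, by
    funext i
    refine Fin.addCases (fun i => ?_) (fun i => ?_) i <;> simp⟩

theorem sat_sub2 {n k m : ℕ} (φ : Formula L (n + k)) (x : Fin n → Fin m) (y : Fin k → Fin m)
    (v : Fin m → M.dom.El) :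
    M.Sat (φ.sub2 x y) v ↔ M.Sat φ (Fin.append (v ∘ x) (v ∘ y)) := by
  rw [sub2, sat_subst, append_cat]

theorem sat_and {n : ℕ} (φ ψ : Formula L n) (v : Fin n → M.dom.El) :
    M.Sat (φ.and ψ) v ↔ M.Sat φ v ∧ M.Sat ψ v := by
  constructor
  · intro h
    exact ⟨by simpa using h ⟨0, by simp⟩, by simpa using h ⟨1, by simp⟩⟩
  · rintro ⟨h, h'⟩ i
    change M.Sat (if i.1 = 0 then φ else ψ) v
    split_ifs
    exacts [h, h']

theorem sat_top {n : ℕ} (v : Fin n → M.dom.El) : M.Sat top v := fun i => i.2.elim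

theorem not_sat_bot {n : ℕ} (v : Fin n → M.dom.El) : ¬ M.Sat bot v := fun ⟨i, _⟩ => i.2.elim

theorem sat_eqs {n k : ℕ} (x y : Fin k → Fin n) (v : Fin n → M.dom.El) :
    M.Sat (eqs x y) v ↔ v ∘ x = v ∘ y :=
  ⟨fun h => funext fun i => h ⟨i.1, i.2⟩, fun h i => congrFun h ⟨i.1, i.2⟩⟩

theorem sat_exs {n : ℕ} : ∀ (k : ℕ) (φ : Formula L (n + k)) (v : Fin n → M.dom.El),
    M.Sat (exs k φ) v ↔ ∃ y : Fin k → M.dom.El, M.Sat φ (Fin.append v y)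
  | 0, φ, v => by
      have h : ∀ y : Fin 0 → M.dom.El, Fin.append v y = v := fun y => by
        funext i
        exact Fin.append_left v y i
      constructor
      · intro h'
        exact ⟨Fin.elim0, by rw [h]; exact h'⟩
      · rintro ⟨y, hy⟩
        rw [h] at hy
        exact hy
  | k + 1, φ, v => by
      refine (sat_exs k (ex φ) v).trans ?_
      have key : ∀ (y : Fin k → M.dom.El) (a : M.dom.El),
          Fin.snoc (α := fun _ => M.dom.El) (Fin.append v y) a =
            Fin.append v (Fin.snoc (α := fun _ => M.dom.El) y a) := fun y a =>
        (Fin.append_snoc v y a).symm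
      constructor
      · rintro ⟨y, a, h⟩
        exact ⟨Fin.snoc (α := fun _ => M.dom.El) y a, by rw [← key]; exact h⟩
      · rintro ⟨y, h⟩
        refine ⟨y ∘ Fin.castSucc, y (Fin.last k), ?_⟩
        have hy : Fin.snoc (α := fun _ => M.dom.El) (y ∘ Fin.castSucc) (y (Fin.last k)) = y :=
          Fin.snoc_init_self (α := fun _ => M.dom.El) y
        rw [key, hy]
        exact h

theorem sat_bigEx {n : ℕ} (J : Set ℕ) (m : J → ℕ) (φ : (k : J) → Formula L (n + m k))
    (v : Fin n → M.dom.El) :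
    M.Sat (bigEx J m φ) v ↔ ∃ (k : J) (y : Fin (m k) → M.dom.El), M.Sat (φ k) (Fin.append v y) :=
  exists_congr fun k => M.sat_exs (m k) (φ k) v

theorem snoc_instVar {D : Type} {n : ℕ} (v : Fin n → D) (i : Fin n) :
    v ∘ instVar i = Fin.snoc (α := fun _ => D) v (v i) := by
  funext j
  refine Fin.lastCases ?_ (fun j => ?_) j <;> simp [instVar]

theorem snoc_castSucc {D : Type} {n : ℕ} (v : Fin n → D) (a : D) :
    Fin.snoc (α := fun _ => D) v a ∘ Fin.castSucc = v := by
  funext j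
  simp

/-- Soundness of natural deduction. -/
theorem sound {T : Set (Formula L 0)} (hT : ∀ χ ∈ T, M.Sat χ Fin.elim0) {n : ℕ}
    {Γ : Set (Formula L n)} {φ : Formula L n} (h : Prf T Γ φ) :
    ∀ v : Fin n → M.dom.El, (∀ ψ ∈ Γ, M.Sat ψ v) → M.Sat φ v := by
  have ins : ∀ {n : ℕ} {Γ : Set (Formula L n)} {φ : Formula L n} {v : Fin n → M.dom.El},
      (∀ ψ ∈ Γ, M.Sat ψ v) → M.Sat φ v → ∀ ψ ∈ insert φ Γ, M.Sat ψ v := by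
    rintro n Γ φ v h h' ψ (rfl | hψ)
    exacts [h', h _ hψ]
  have wk : ∀ {n : ℕ} {Γ : Set (Formula L n)} {v : Fin n → M.dom.El} (a : M.dom.El),
      (∀ ψ ∈ Γ, M.Sat ψ v) → ∀ ψ ∈ (fun ψ : Formula L n => ψ.subst Fin.castSucc) '' Γ,
        M.Sat ψ (Fin.snoc (α := fun _ => M.dom.El) v a) := by
    rintro n Γ v a h _ ⟨ψ, hψ, rfl⟩
    rw [sat_subst, snoc_castSucc]
    exact h _ hψ
  induction h with
  | ax h =>
    intro v _
    rw [sat_subst, Subsingleton.elim (v ∘ Fin.elim0) Fin.elim0]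
    exact hT _ h
  | hyp h => intro v hv; exact hv _ h
  | conjI _ ih => intro v hv i; exact ih i v hv
  | conjE _ i ih => intro v hv; exact ih v hv i
  | disjI i _ ih => intro v hv; exact ⟨i, ih v hv⟩
  | disjE _ _ ih ih' =>
    intro v hv
    obtain ⟨i, hi⟩ := ih v hv
    exact ih' i v (ins hv hi)
  | negI _ ih => intro v hv h; exact M.not_sat_bot v (ih v (ins hv h))
  | negE _ _ ih ih' => intro v hv; exact (ih v hv (ih' v hv)).elim
  | raa _ ih =>
    intro v hv
    by_contra h
    exact M.not_sat_bot v (ih v (ins hv h))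
  | allI _ ih => intro v hv a; exact ih _ (wk a hv)
  | allE _ i ih =>
    intro v hv
    rw [sat_subst, snoc_instVar]
    exact ih v hv _
  | exI i _ ih =>
    intro v hv
    have := ih v hv
    rw [sat_subst, snoc_instVar] at this
    exact ⟨_, this⟩
  | exE _ _ ih ih' =>
    intro v hv
    obtain ⟨a, ha⟩ := ih v hv
    have := ih' _ (ins (wk a hv) ha)
    rwa [sat_subst, snoc_castSucc] at this
  | eqI i => intro v hv; rfl
  | eqE _ _ ih ih' =>
    intro v hv
    have h1 := ih v hv
    have h2 := ih' v hv
    rw [sat_subst, snoc_instVar] at h2 ⊢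
    rwa [← show _ = _ from h1]

end Str


/-! ### Completeness of natural deduction -/

section Completeness

variable {L : RelLang}

/-- The set of subformulas of a formula. -/
def Formula.subs : {n : ℕ} → Formula L n → Set (Σ n, Formula L n)
  | n, rel R x => {⟨n, rel R x⟩}
  | n, eq i j => {⟨n, eq i j⟩}
  | n, neg φ => insert ⟨n, neg φ⟩ φ.subs
  | n, conj I φ => insert ⟨n, conj I φ⟩ (⋃ i, (φ i).subs)
  | n, disj I φ => insert ⟨n, disj I φ⟩ (⋃ i, (φ i).subs)
  | n, all φ => insert ⟨n, all φ⟩ φ.subs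
  | n, ex φ => insert ⟨n, ex φ⟩ φ.subs

theorem Formula.countable_subs {n : ℕ} (φ : Formula L n) : φ.subs.Countable := by
  induction φ with
  | rel R x => exact Set.countable_singleton _
  | eq i j => exact Set.countable_singleton _
  | neg φ ih => exact ih.insert _
  | conj I φ ih => exact (Set.countable_iUnion ih).insert _
  | disj I φ ih => exact (Set.countable_iUnion ih).insert _
  | all φ ih => exact ih.insert _
  | ex φ ih => exact ih.insert _

theorem Formula.mem_subs {n : ℕ} (φ : Formula L n) : (⟨n, φ⟩ : Σ n, Formula L n) ∈ φ.subs := by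
  cases φ <;> simp [subs]

/-- A consistent set of formulas in finitely many variables. -/
structure Cond (T : Set (Formula L 0)) where
  N : ℕ
  Γ : Set (Formula L N)
  cons : ¬ Prf T Γ bot

/-! ### Forcing with consistent sets of formulas. -/

namespace Cond

variable {T : Set (Formula L 0)}

/-- A larger condition may use more variables, and the variables of the smaller one are its first
ones. A natural number therefore names the same variable in every condition above a given one. -/
instance : Preorder (Cond T) where
  le p q := ∃ h : p.N ≤ q.N, ∀ ψ ∈ p.Γ, ψ.subst (Fin.castLE h) ∈ q.Γ
  le_refl p := ⟨le_rfl, fun ψ hψ => by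
    change ψ.subst id ∈ _
    rwa [subst_id]⟩
  le_trans p q r := fun ⟨h, h1⟩ ⟨h', h2⟩ => ⟨h.trans h', fun ψ hψ => by
    have := h2 _ (h1 ψ hψ)
    rwa [subst_subst] at this⟩

/-- The condition `p` proves `φ(x)`. -/
def Forces (p : Cond T) {n : ℕ} (φ : Formula L n) (x : Fin n → ℕ) : Prop :=
  ∃ h : ∀ i, x i < p.N, Prf T p.Γ (φ.subst fun i => ⟨x i, h i⟩)

theorem Forces.mono {p q : Cond T} (h : p ≤ q) {n : ℕ} {φ : Formula L n} {x : Fin n → ℕ}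
    (hp : p.Forces φ x) : q.Forces φ x := by
  obtain ⟨h1, h2⟩ := h
  obtain ⟨h3, h4⟩ := hp
  refine ⟨fun i => (h3 i).trans_le h1, ?_⟩
  have := h4.subst (Fin.castLE h1) q.Γ h2
  rwa [subst_subst] at this

theorem Forces.not_neg {p : Cond T} {n : ℕ} {φ : Formula L n} {x : Fin n → ℕ}
    (hp : p.Forces φ x) : ¬ p.Forces (neg φ) x :=
  fun ⟨_, h⟩ => p.cons (h.negE hp.2)

/-- The condition `p` decides `φ(x)`, with a witness where there should be one. -/
def Handles (p : Cond T) : {n : ℕ} → Formula L n → (Fin n → ℕ) → Prop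
  | _, conj I φ, x => p.Forces (conj I φ) x ∨ ∃ i, p.Forces (neg (φ i)) x
  | _, disj I φ, x => p.Forces (neg (disj I φ)) x ∨ ∃ i, p.Forces (φ i) x
  | _, all φ, x => p.Forces (all φ) x ∨ ∃ a, p.Forces (neg φ) (Fin.snoc (α := fun _ => ℕ) x a)
  | _, ex φ, x => p.Forces (neg (ex φ)) x ∨ ∃ a, p.Forces φ (Fin.snoc (α := fun _ => ℕ) x a)
  | _, φ, x => p.Forces φ x ∨ p.Forces (neg φ) x

/-- Extension of a condition by a formula in the same variables. -/
theorem exists_insert (p : Cond T) (ψ : Formula L p.N) (h : ¬ Prf T (insert ψ p.Γ) bot) {n : ℕ}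
    {φ : Formula L n} {x : Fin n → ℕ} (hx : ∀ i, x i < p.N)
    (hψ : φ.subst (fun i => (⟨x i, hx i⟩ : Fin p.N)) = ψ) : ∃ q, p ≤ q ∧ q.Forces φ x :=
  ⟨⟨p.N, insert ψ p.Γ, h⟩, ⟨le_rfl, fun χ hχ => by
    change χ.subst id ∈ _
    rw [subst_id]
    exact Or.inr hχ⟩, hx, Prf.hyp (Or.inl hψ)⟩

/-- Extension of a condition by a formula in one more variable. -/
theorem exists_insert_succ (p : Cond T) (ψ : Formula L (p.N + 1))
    (h : ¬ Prf T (insert ψ ((fun ψ => ψ.subst Fin.castSucc) '' p.Γ)) bot) {n : ℕ}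
    {φ : Formula L (n + 1)} {x : Fin n → ℕ} (hx : ∀ i, x i < p.N)
    (hψ : φ.subst (liftVar fun i => (⟨x i, hx i⟩ : Fin p.N)) = ψ) :
    ∃ q, p ≤ q ∧ q.Forces φ (Fin.snoc (α := fun _ => ℕ) x p.N) := by
  refine ⟨⟨p.N + 1, _, h⟩, ⟨Nat.le_succ _, fun χ hχ => Or.inr ⟨χ, hχ, rfl⟩⟩, ?_, ?_⟩
  · intro i
    refine Fin.lastCases ?_ (fun i => ?_) i
    · simp
    · simpa using (hx i).trans (Nat.lt_succ_self _)
  · refine Prf.hyp (Or.inl (Eq.trans ?_ hψ))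
    congr 1
    funext i
    refine Fin.lastCases ?_ (fun i => ?_) i <;> ext <;> simp [liftVar]

/-- If no extension that would supply the witness is consistent, those inconsistencies are the
premises of an introduction rule, so the condition itself already proves the other alternative. For
quantifiers the witness is the fresh variable `p.N`. -/
theorem exists_handles (p : Cond T) {n : ℕ} (φ : Formula L n) (x : Fin n → ℕ)
    (hx : ∀ i, x i < p.N) : ∃ q, p ≤ q ∧ q.Handles φ x := by
  have key : ∀ {n : ℕ} (φ : Formula L n) (x : Fin n → ℕ) (_ : ∀ i, x i < p.N),
      ∃ q, p ≤ q ∧ (q.Forces φ x ∨ q.Forces (neg φ) x) := by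
    intro n φ x hx
    by_cases h : Prf T p.Γ (φ.subst fun i => ⟨x i, hx i⟩)
    · exact ⟨p, le_rfl, Or.inl ⟨hx, h⟩⟩
    · obtain ⟨q, h1, h2⟩ := p.exists_insert (φ := neg φ) _ (fun h' => h h'.raa) hx rfl
      exact ⟨q, h1, Or.inr h2⟩
  cases φ with
  | rel R y => exact key _ x hx
  | eq i j => exact key _ x hx
  | neg φ => exact key _ x hx
  | conj I φ =>
    by_cases h : ∃ i, ¬ Prf T (insert (neg ((φ i).subst fun i => ⟨x i, hx i⟩)) p.Γ) bot
    · obtain ⟨i, hi⟩ := h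
      obtain ⟨q, h1, h2⟩ := p.exists_insert (φ := neg (φ i)) _ hi hx rfl
      exact ⟨q, h1, Or.inr ⟨i, h2⟩⟩
    · push Not at h
      exact ⟨p, le_rfl, Or.inl ⟨hx, Prf.conjI fun i => (h i).raa⟩⟩
  | disj I φ =>
    by_cases h : ∃ i, ¬ Prf T (insert ((φ i).subst fun i => ⟨x i, hx i⟩) p.Γ) bot
    · obtain ⟨i, hi⟩ := h
      obtain ⟨q, h1, h2⟩ := p.exists_insert (φ := φ i) _ hi hx rfl
      exact ⟨q, h1, Or.inr ⟨i, h2⟩⟩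
    · push Not at h
      refine ⟨p, le_rfl, Or.inl ⟨hx, Prf.negI (Prf.disjE (Prf.hyp (Or.inl rfl)) fun i => ?_)⟩⟩
      exact (h i).mono (Set.insert_subset_insert (Set.subset_insert _ _))
  | all φ =>
    by_cases h : Prf T (insert (neg (φ.subst (liftVar fun i => (⟨x i, hx i⟩ : Fin p.N))))
        ((fun ψ => ψ.subst Fin.castSucc) '' p.Γ)) bot
    · exact ⟨p, le_rfl, Or.inl ⟨hx, Prf.allI h.raa⟩⟩
    · obtain ⟨q, h1, h2⟩ := p.exists_insert_succ (φ := neg φ) _ h hx rfl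
      exact ⟨q, h1, Or.inr ⟨_, h2⟩⟩
  | ex φ =>
    by_cases h : Prf T (insert (φ.subst (liftVar fun i => (⟨x i, hx i⟩ : Fin p.N)))
        ((fun ψ => ψ.subst Fin.castSucc) '' p.Γ)) bot
    · refine ⟨p, le_rfl, Or.inl ⟨hx, Prf.negI (Prf.exE (Prf.hyp (Or.inl rfl)) ?_)⟩⟩
      have hbot : (bot : Formula L p.N).subst Fin.castSucc = bot := by
        simp only [bot, Formula.subst]
        congr 1
        funext i
        exact i.2.elim
      rw [hbot]
      exact h.mono (Set.insert_subset_insert (Set.image_mono (Set.subset_insert _ _)))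
    · obtain ⟨q, h1, h2⟩ := p.exists_insert_succ (φ := φ) _ h hx rfl
      exact ⟨q, h1, Or.inr ⟨_, h2⟩⟩

/-- The conditions that handle `φ(x)`, unless `x` stays out of range. -/
def cofinal {n : ℕ} (φ : Formula L n) (x : Fin n → ℕ) : Order.Cofinal (Cond T) where
  carrier := {q | q.Handles φ x ∨ ∀ r, q ≤ r → ¬ ∀ i, x i < r.N}
  isCofinal := fun p => by
    -- The second alternative cannot be dropped, because empty structures are allowed: a condition
    -- without variables may prove that nothing exists, and then no extension of it has variables.
    by_cases h : ∃ r, p ≤ r ∧ ∀ i, x i < r.N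
    · obtain ⟨r, h1, h2⟩ := h
      obtain ⟨q, h3, h4⟩ := r.exists_handles φ x h2
      exact ⟨q, Or.inl h4, h1.trans h3⟩
    · push Not at h
      exact ⟨p, Or.inr fun r hr hx => by
        obtain ⟨i, hi⟩ := h r hr
        exact absurd (hx i) (not_lt.2 hi), le_rfl⟩

end Cond

/-- Every countable set is in bijection with an object of `Count`. -/
theorem Count.exists_equiv (Q : Type) [Countable Q] : ∃ c : Count, Nonempty (Q ≃ c.El) := by
  cases finite_or_infinite Q with
  | inl h =>
    refine ⟨⟨(Nat.card Q : ℕ∞)⟩, ⟨(Finite.equivFin Q).trans ⟨fun i => ⟨i.1, ?_⟩,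
      fun k => ⟨k.1, ?_⟩, fun _ => rfl, fun _ => rfl⟩⟩⟩
    · exact Nat.cast_lt.2 i.2
    · exact Nat.cast_lt.1 k.2
  | inr h =>
    have : Encodable Q := Encodable.ofCountable Q
    have : Denumerable Q := Denumerable.ofEncodableOfInfinite Q
    exact ⟨⟨⊤⟩, ⟨(Denumerable.eqv Q).trans ⟨fun i => ⟨i, ENat.natCast_lt_top i⟩, fun k => k.1,
      fun _ => rfl, fun _ => rfl⟩⟩⟩

/-- A generic set of conditions, relative to a set of formulas. -/
structure Generic (T : Set (Formula L 0)) (Fr : Set (Σ n, Formula L n)) where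
  G : Order.Ideal (Cond T)
  handles : ∀ {n : ℕ} (φ : Formula L n), (⟨n, φ⟩ : Σ n, Formula L n) ∈ Fr → ∀ x : Fin n → ℕ,
    (∃ p ∈ G, ∀ i, x i < p.N) → ∃ p ∈ G, p.Handles φ x

/-- There are countably many pairs of a formula in `Fr` and a tuple of naturals, so one ideal meets
all the cofinal sets. If the tuple is in range at some `r` in the ideal, a common upper bound with
`r` excludes the out-of-range alternative. -/
theorem exists_generic {T : Set (Formula L 0)} {Fr : Set (Σ n, Formula L n)}
    (hFr : Fr.Countable) (p : Cond T) : ∃ 𝒢 : Generic T Fr, p ∈ 𝒢.G := by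
  have : Countable Fr := hFr
  let ι := Σ f : Fr, (Fin f.1.1 → ℕ)
  have : Encodable ι := Encodable.ofCountable ι
  let 𝒟 : ι → Order.Cofinal (Cond T) := fun i => Cond.cofinal i.1.1.2 i.2
  refine ⟨⟨Order.idealOfCofinals p 𝒟, ?_⟩, Order.mem_idealOfCofinals p 𝒟⟩
  rintro n φ hφ x ⟨r, hr, hx⟩
  obtain ⟨q, hq, hqG⟩ := Order.cofinal_meets_idealOfCofinals p 𝒟 ⟨⟨⟨n, φ⟩, hφ⟩, x⟩
  rcases hq with hq | hq
  · exact ⟨q, hqG, hq⟩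
  · obtain ⟨s, _, h1, h2⟩ := (Order.idealOfCofinals p 𝒟).directed q hqG r hr
    exact absurd (fun i => (hx i).trans_le h2.1) (hq s h1)

/-! ### Truth in a generic ideal and the term model. -/

namespace Generic

variable {T : Set (Formula L 0)} {Fr : Set (Σ n, Formula L n)} (𝒢 : Generic T Fr)

/-- Truth of `φ(x)` in the generic model. -/
def Tr {n : ℕ} (φ : Formula L n) (x : Fin n → ℕ) : Prop := ∃ p ∈ 𝒢.G, p.Forces φ x

theorem exists_common {ι : Type} [Finite ι] {P : ι → Cond T → Prop}
    (hP : ∀ i p q, p ≤ q → P i p → P i q) (h : ∀ i, ∃ p ∈ 𝒢.G, P i p) :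
    ∃ p ∈ 𝒢.G, ∀ i, P i p := by
  choose f hf hP' using h
  have hd : Directed (· ≤ ·) (fun p : 𝒢.G => (p : Cond T)) :=
    directedOn_iff_directed.1 𝒢.G.directed
  have : Nonempty 𝒢.G := 𝒢.G.nonempty.to_subtype
  obtain ⟨z, hz⟩ := hd.finite_le fun i => (⟨f i, hf i⟩ : 𝒢.G)
  exact ⟨z, z.2, fun i => hP i _ _ (hz i) (hP' i)⟩

variable {𝒢}

theorem Tr.not_neg {n : ℕ} {φ : Formula L n} {x : Fin n → ℕ} (h : 𝒢.Tr φ x) :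
    ¬ 𝒢.Tr (neg φ) x := by
  rintro ⟨q, hq, h'⟩
  obtain ⟨p, hp, h⟩ := h
  obtain ⟨r, _, h1, h2⟩ := 𝒢.G.directed p hp q hq
  exact (h.mono h1).not_neg (h'.mono h2)

/-- A consequence of true formulas is true. -/
theorem Tr.of_prf {n : ℕ} {Γ : Set (Formula L n)} [Finite Γ] {ψ : Formula L n} {x : Fin n → ℕ}
    (hx : ∃ p ∈ 𝒢.G, ∀ i, x i < p.N) (h : ∀ φ ∈ Γ, 𝒢.Tr φ x) (h' : Prf T Γ ψ) : 𝒢.Tr ψ x := by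
  obtain ⟨p, hp, hpx⟩ := hx
  obtain ⟨q, hq, hqΓ⟩ := 𝒢.exists_common (P := fun (φ : Γ) p => p.Forces φ.1 x)
    (fun _ _ _ h => Cond.Forces.mono h) fun φ => h φ.1 φ.2
  obtain ⟨r, hr, h1, h2⟩ := 𝒢.G.directed p hp q hq
  refine ⟨r, hr, fun i => (hpx i).trans_le h1.1, ?_⟩
  have h3 := h'.subst (fun i => (⟨x i, (hpx i).trans_le h1.1⟩ : Fin r.N))
    ((fun φ : Formula L n => φ.subst fun i => ⟨x i, (hpx i).trans_le h1.1⟩) '' Γ)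
    (fun φ hφ => ⟨φ, hφ, rfl⟩)
  refine h3.cut ?_
  rintro _ ⟨φ, hφ, rfl⟩
  exact ((hqΓ ⟨φ, hφ⟩).mono h2).2

/-- The bound on `x` serves the direction from right to left: `σ` need not be surjective, and
forcing `φ` at `x ∘ σ` says nothing about the entries of `x` that are skipped. -/
theorem tr_subst {n m : ℕ} {φ : Formula L n} {σ : Fin n → Fin m} {x : Fin m → ℕ}
    (hx : ∃ p ∈ 𝒢.G, ∀ i, x i < p.N) : 𝒢.Tr (φ.subst σ) x ↔ 𝒢.Tr φ (x ∘ σ) := by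
  constructor
  · rintro ⟨p, hp, h, h'⟩
    rw [subst_subst] at h'
    exact ⟨p, hp, fun i => h (σ i), h'⟩
  · rintro ⟨p, hp, h, h'⟩
    obtain ⟨q, hq, hqx⟩ := hx
    obtain ⟨r, hr, h1, h2⟩ := 𝒢.G.directed p hp q hq
    refine ⟨r, hr, fun i => (hqx i).trans_le h2.1, ?_⟩
    rw [subst_subst]
    exact (Cond.Forces.mono h1 ⟨h, h'⟩).2

variable (𝒢)

/-- The variables in use. -/
def V : Type := {k : ℕ // ∃ p ∈ 𝒢.G, k < p.N}

variable {𝒢}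

theorem exists_bound {n : ℕ} (x : Fin n → 𝒢.V) : ∃ p ∈ 𝒢.G, ∀ i, (x i).1 < p.N :=
  𝒢.exists_common (P := fun i p => (x i).1 < p.N) (fun _ _ _ h h' => h'.trans_le h.1)
    fun i => (x i).2

/-- Equality of two entries is moved to a context of exactly two variables, so that a single
relation on `𝒢.V` serves for all contexts. -/
theorem tr_eq {n : ℕ} {i j : Fin n} (x : Fin n → 𝒢.V) : 𝒢.Tr (eq i j) (fun i => (x i).1) ↔
    𝒢.Tr (eq 0 1 : Formula L 2) (fun k => ((![x i, x j] : Fin 2 → 𝒢.V) k).1) := by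
  have := tr_subst (𝒢 := 𝒢) (φ := (eq 0 1 : Formula L 2)) (σ := ![i, j]) (exists_bound x)
  simp only [Formula.subst] at this
  refine this.trans (iff_of_eq ?_)
  congr 1
  funext k
  fin_cases k <;> rfl

variable (𝒢)

/-- Provable equality of variables. -/
def setoid : Setoid 𝒢.V where
  r a b := 𝒢.Tr (eq 0 1 : Formula L 2) (fun k => ((![a, b] : Fin 2 → 𝒢.V) k).1)
  iseqv :=
    { refl := fun a => (tr_eq (i := 0) (j := 0) ![a]).1
        (Tr.of_prf (Γ := ∅) (exists_bound _) (by simp) (Prf.eqI 0))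
      symm := fun {a b} h => (tr_eq (i := 1) (j := 0) ![a, b]).1
        (Tr.of_prf (Γ := {eq 0 1}) (exists_bound _) (by simpa using h) Prf.hyp1.eq_symm)
      trans := fun {a b c} h h' => (tr_eq (i := 0) (j := 2) ![a, b, c]).1
        (Tr.of_prf (Γ := {eq 0 1, eq 1 2}) (exists_bound _) (by
            rintro _ (rfl | rfl)
            · exact (tr_eq (i := 0) (j := 1) ![a, b, c]).2 h
            · exact (tr_eq (i := 1) (j := 2) ![a, b, c]).2 h')
          (Prf.eq_trans Prf.hypl Prf.hypr)) }

/-- Both tuples are placed in one context of `n + n` variables, where replacing equals by equals is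
a derivation. -/
theorem tr_congr {n : ℕ} (φ : Formula L n) (x y : Fin n → 𝒢.V) (h : ∀ i, 𝒢.setoid (x i) (y i))
    (hx : 𝒢.Tr φ fun i => (x i).1) : 𝒢.Tr φ fun i => (y i).1 := by
  let z : Fin (n + n) → 𝒢.V := Fin.append x y
  have e : ∀ φ : Formula L n, 𝒢.Tr φ (fun i => (x i).1) ↔
      𝒢.Tr (φ.subst (Fin.castAdd n)) (fun i => (z i).1) := fun φ => by
    rw [tr_subst (exists_bound z)]
    refine iff_of_eq (congrArg _ ?_)
    funext i
    simp [z]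
  have e' : 𝒢.Tr φ (fun i => (y i).1) ↔
      𝒢.Tr (φ.subst (Fin.natAdd n)) (fun i => (z i).1) := by
    rw [tr_subst (exists_bound z)]
    refine iff_of_eq (congrArg _ ?_)
    funext i
    simp only [z, Function.comp, Fin.append_right]
  rw [e']
  refine Tr.of_prf (Γ := insert (φ.subst (Fin.castAdd n))
    (Set.range fun i => eq (Fin.castAdd n i) (Fin.natAdd n i))) (exists_bound z) ?_
    (Prf.eqs_subst (x := Fin.castAdd n) (Prf.eqsI fun i => Prf.hyp (Or.inr ⟨i, rfl⟩)) φ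
      (Prf.hyp (Or.inl rfl)))
  rintro _ (rfl | ⟨i, rfl⟩)
  · exact (e φ).1 hx
  · refine (tr_eq z).2 ?_
    simp only [z, Fin.append_left, Fin.append_right]
    exact h i

instance : Countable 𝒢.V := inferInstanceAs (Countable {k : ℕ // ∃ p ∈ 𝒢.G, k < p.N})

/-- The term model. -/
theorem exists_model : ∃ (M : Str L) (e : 𝒢.V → M.dom.El), Function.Surjective e ∧
    ∀ {n : ℕ} (φ : Formula L n), φ.subs ⊆ Fr → ∀ x : Fin n → 𝒢.V,
      M.Sat φ (e ∘ x) ↔ 𝒢.Tr φ fun i => (x i).1 := by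
  obtain ⟨c, ⟨f⟩⟩ := Count.exists_equiv (Quotient 𝒢.setoid)
  let e : 𝒢.V → c.El := fun a => f (Quotient.mk _ a)
  have he : Function.Surjective e := f.surjective.comp Quotient.mk_surjective
  have hee : ∀ {a b}, e a = e b ↔ 𝒢.setoid a b := fun {a b} =>
    f.injective.eq_iff.trans Quotient.eq
  -- A tuple of classes satisfies `R` when some choice of representatives does; by `tr_congr` every
  -- choice then does.
  let M : Str L := ⟨c, fun R => {v | ∃ x : Fin (L.arity R) → 𝒢.V, e ∘ x = v ∧
    𝒢.Tr (relFormula R) fun i => (x i).1}⟩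
  have dec : ∀ {n : ℕ} {φ : Formula L n}, φ.subs ⊆ Fr → ∀ x : Fin n → 𝒢.V,
      ∃ p ∈ 𝒢.G, p.Handles φ fun i => (x i).1 := fun h x =>
    𝒢.handles _ (h (Formula.mem_subs _)) _ (exists_bound x)
  have hsnoc : ∀ {n : ℕ} (x : Fin n → 𝒢.V) (a : 𝒢.V),
      Fin.snoc (α := fun _ => c.El) (e ∘ x) (e a) = e ∘ Fin.snoc (α := fun _ => 𝒢.V) x a := by
    intro n x a
    funext i
    refine Fin.lastCases ?_ (fun i => ?_) i <;> simp
  have hsnoc' : ∀ {n : ℕ} (x : Fin n → 𝒢.V) (a : 𝒢.V),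
      (fun i => (Fin.snoc (α := fun _ => 𝒢.V) x a i).1) =
        Fin.snoc (α := fun _ => ℕ) (fun i => (x i).1) a.1 := by
    intro n x a
    funext i
    refine Fin.lastCases ?_ (fun i => ?_) i <;> simp
  -- Forcing at a tuple includes that its entries are variables of the condition, so the witnesses
  -- supplied by `Handles` are elements of the term model.
  have hV : ∀ {n : ℕ} {φ : Formula L (n + 1)} {x : Fin n → ℕ} {a : ℕ},
      𝒢.Tr φ (Fin.snoc (α := fun _ => ℕ) x a) → ∃ p ∈ 𝒢.G, a < p.N := by
    rintro n φ x a ⟨p, hp, h, _⟩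
    exact ⟨p, hp, by simpa using h (Fin.last n)⟩
  refine ⟨M, e, he, ?_⟩
  intro n φ
  induction φ with
  | rel R y =>
    intro _ x
    have h1 : 𝒢.Tr (rel R y) (fun i => (x i).1) ↔ 𝒢.Tr (relFormula R) (fun i => (x (y i)).1) :=
      tr_subst (φ := relFormula R) (σ := y) (exists_bound x)
    rw [h1]
    constructor
    · rintro ⟨z, hz, h⟩
      exact 𝒢.tr_congr _ z (x ∘ y) (fun i => hee.1 (congrFun hz i)) h
    · intro h
      exact ⟨x ∘ y, rfl, h⟩
  | eq i j =>
    intro _ x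
    rw [tr_eq]
    exact hee
  | neg φ ih =>
    intro hs x
    refine (not_congr (ih (fun _ h => hs (Or.inr h)) x)).trans ?_
    constructor
    · intro h
      obtain ⟨p, hp, h1 | h1⟩ := dec hs x
      · exact ⟨p, hp, h1⟩
      -- A condition handling `neg φ` might force `neg (neg φ)` instead; by reductio `φ` would then
      -- be true.
      · refine absurd (Tr.of_prf (Γ := {neg (neg φ)}) (exists_bound x) ?_
          (Prf.raa (Prf.negE (Prf.hyp (Or.inr rfl)) (Prf.hyp (Or.inl rfl))))) h
        rintro _ rfl
        exact ⟨p, hp, h1⟩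
    · intro h h'
      exact h'.not_neg h
  | conj I φ ih =>
    intro hs x
    refine (forall_congr' fun i =>
      ih i (fun _ h => hs (Or.inr (Set.mem_iUnion.2 ⟨i, h⟩))) x).trans ?_
    constructor
    · intro h
      obtain ⟨p, hp, h1 | ⟨i, h1⟩⟩ := dec hs x
      · exact ⟨p, hp, h1⟩
      · exact absurd ⟨p, hp, h1⟩ (h i).not_neg
    · rintro ⟨p, hp, h, h'⟩ i
      exact ⟨p, hp, h, Prf.conjE h' i⟩
  | disj I φ ih =>
    intro hs x
    refine (exists_congr fun i =>
      ih i (fun _ h => hs (Or.inr (Set.mem_iUnion.2 ⟨i, h⟩))) x).trans ?_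
    constructor
    · rintro ⟨i, p, hp, h, h'⟩
      exact ⟨p, hp, h, Prf.disjI i h'⟩
    · intro h
      obtain ⟨p, hp, h1 | ⟨i, h1⟩⟩ := dec hs x
      · exact absurd ⟨p, hp, h1⟩ h.not_neg
      · exact ⟨i, p, hp, h1⟩
  | all φ ih =>
    intro hs x
    have ih := fun a => ih (fun _ h => hs (Or.inr h)) (Fin.snoc (α := fun _ => 𝒢.V) x a)
    simp only [← hsnoc, hsnoc'] at ih
    refine (he.forall.trans (forall_congr' ih)).trans ?_
    constructor
    · intro h
      obtain ⟨p, hp, h1 | ⟨a, h1⟩⟩ := dec hs x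
      · exact ⟨p, hp, h1⟩
      · exact absurd ⟨p, hp, h1⟩ (h ⟨a, hV ⟨p, hp, h1⟩⟩).not_neg
    · intro h a
      have h2 := hsnoc' x a
      rw [← h2]
      have h3 : 𝒢.Tr ((all φ).subst Fin.castSucc)
          (fun i => (Fin.snoc (α := fun _ => 𝒢.V) x a i).1) := by
        rw [tr_subst (exists_bound _)]
        convert h using 1
        funext i
        simp
      refine Tr.of_prf (Γ := {(all φ).subst Fin.castSucc}) (exists_bound _)
        (by rintro _ rfl; exact h3) ?_
      have h4 := Prf.allE (Prf.hyp1 (T := T) (φ := (all φ).subst Fin.castSucc)) (Fin.last _)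
      rw [subst_subst] at h4
      convert h4 using 1
      conv_lhs => rw [← subst_id φ]
      congr 1
      funext i
      refine Fin.lastCases ?_ (fun i => ?_) i <;> simp [liftVar, instVar]
  | ex φ ih =>
    intro hs x
    have ih := fun a => ih (fun _ h => hs (Or.inr h)) (Fin.snoc (α := fun _ => 𝒢.V) x a)
    simp only [← hsnoc, hsnoc'] at ih
    refine (he.exists.trans (exists_congr ih)).trans ?_
    constructor
    · rintro ⟨a, h⟩
      rw [← hsnoc' x a] at h
      have h3 : 𝒢.Tr ((ex φ).subst Fin.castSucc)
          (fun i => (Fin.snoc (α := fun _ => 𝒢.V) x a i).1) := by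
        refine Tr.of_prf (Γ := {φ}) (exists_bound _) (by rintro _ rfl; exact h) ?_
        refine Prf.exI (Fin.last _) ?_
        rw [subst_subst]
        convert Prf.hyp1 (T := T) (φ := φ) using 1
        conv_rhs => rw [← subst_id φ]
        congr 1
        funext i
        refine Fin.lastCases ?_ (fun i => ?_) i <;> simp [liftVar, instVar]
      rw [tr_subst (exists_bound _)] at h3
      convert h3 using 1
      funext i
      simp
    · intro h
      obtain ⟨p, hp, h1 | ⟨a, h1⟩⟩ := dec hs x
      · exact absurd ⟨p, hp, h1⟩ h.not_neg
      · exact ⟨⟨a, hV ⟨p, hp, h1⟩⟩, p, hp, h1⟩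

end Generic

/-- Completeness of natural deduction for countable theories. -/
theorem complete {T : Set (Formula L 0)} (hT : T.Countable) {n : ℕ} {Γ : Set (Formula L n)}
    (hΓ : Γ.Countable) {φ : Formula L n}
    (h : ∀ M : Str L, (∀ χ ∈ T, M.Sat χ Fin.elim0) → ∀ v : Fin n → M.dom.El,
      (∀ ψ ∈ Γ, M.Sat ψ v) → M.Sat φ v) : Prf T Γ φ := by
  by_contra hφ
  let p : Cond T := ⟨n, insert (neg φ) Γ, fun h => hφ h.raa⟩
  -- The fragment of formulas whose truth must be controlled. Its countability, and with it the
  -- existence of a generic ideal, is what the countability of `T` and `Γ` is for.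
  let Fr : Set (Σ n, Formula L n) := (⋃ χ ∈ T, χ.subs) ∪ (⋃ ψ ∈ insert (neg φ) Γ, ψ.subs)
  have hFr : Fr.Countable := (hT.biUnion fun χ _ => χ.countable_subs).union
    ((hΓ.insert _).biUnion fun χ _ => χ.countable_subs)
  obtain ⟨𝒢, hp⟩ := exists_generic hFr p
  obtain ⟨M, e, _, hM⟩ := 𝒢.exists_model
  let x : Fin n → 𝒢.V := fun i => ⟨i.1, p, hp, i.2⟩
  have hx : ∀ ψ ∈ insert (neg φ) Γ, M.Sat ψ (e ∘ x) := fun ψ hψ => by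
    refine (hM ψ (fun _ h => Or.inr (Set.mem_biUnion hψ h)) x).2 ⟨p, hp, fun i => i.2, ?_⟩
    change Prf T p.Γ (ψ.subst id)
    rw [subst_id]
    exact Prf.hyp hψ
  refine hx (neg φ) (Or.inl rfl) (h M (fun χ hχ => ?_) _ fun ψ hψ => hx ψ (Or.inr hψ))
  have h1 := hM χ (fun _ h => Or.inl (Set.mem_biUnion hχ h)) Fin.elim0
  rw [Subsingleton.elim (e ∘ Fin.elim0) Fin.elim0] at h1
  refine h1.2 ⟨p, hp, fun i => i.elim0, ?_⟩
  convert Prf.ax hχ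

end Completeness


/-! ### Interpretation of imaginary sorts in models -/

namespace Model

variable {T : Theory} (M : Model T)

theorem sound {n : ℕ} {Γ : Set (Formula T.L n)} {φ : Formula T.L n} (h : Prf T.ax Γ φ)
    (v : Fin n → M.str.dom.El) (hv : ∀ ψ ∈ Γ, M.str.Sat ψ v) : M.str.Sat φ v :=
  M.str.sound M.models h v hv

theorem sound1 {n : ℕ} {φ ψ : Formula T.L n} (h : Prf T.ax {φ} ψ) (v : Fin n → M.str.dom.El)
    (hv : M.str.Sat φ v) : M.str.Sat ψ v :=
  M.sound h v (by rintro _ rfl; exact hv)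

theorem sound2 {n : ℕ} {φ φ' ψ : Formula T.L n} (h : Prf T.ax {φ, φ'} ψ)
    (v : Fin n → M.str.dom.El) (hv : M.str.Sat φ v) (hv' : M.str.Sat φ' v) : M.str.Sat ψ v :=
  M.sound h v (by rintro _ (rfl | rfl); exacts [hv, hv'])

end Model

/-- The form in which completeness is used: instead of writing a derivation, one verifies the
implication in every model on an initial segment of `ℕ`. -/
theorem prf1 {T : Theory} {n : ℕ} {φ ψ : Formula T.L n}
    (h : ∀ (M : Model T) (v : Fin n → M.str.dom.El), M.str.Sat φ v → M.str.Sat ψ v) :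
    Prf T.ax {φ} ψ :=
  complete T.countable (Set.countable_singleton _) fun M hM v hv => h ⟨M, hM⟩ v (hv _ rfl)

theorem prf2 {T : Theory} {n : ℕ} {φ φ' ψ : Formula T.L n}
    (h : ∀ (M : Model T) (v : Fin n → M.str.dom.El), M.str.Sat φ v → M.str.Sat φ' v →
      M.str.Sat ψ v) : Prf T.ax {φ, φ'} ψ :=
  complete T.countable ((Set.countable_singleton _).insert _) fun M hM v hv =>
    h ⟨M, hM⟩ v (hv _ (Or.inl rfl)) (hv _ (Or.inr rfl))

section Sem

variable {T : Theory} {A B C : ImSort T}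

/-- A point of `⨆ᵢ αᵢ` in the model `M`. -/
structure Pt (M : Model T) (A : ImSort T) : Type where
  i : A.I
  x : Fin (A.n i) → M.str.dom.El
  sat : M.str.Sat (A.α i) x

variable (M : Model T)

/-- The conditions on imaginary sorts speak of tuples of variables. Instantiated at the consecutive
blocks of a concatenated context, they become, by soundness, statements about arbitrary tuples of
elements. The lemmas on `ε` and on graphs below use the same device. -/
theorem eps_dom {i j : A.I} {x : Fin (A.n i) → M.str.dom.El} {y : Fin (A.n j) → M.str.dom.El}
    (h : M.str.Sat (A.ε i j) (Fin.append x y)) : M.str.Sat (A.α i) x ∧ M.str.Sat (A.α j) y := by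
  have := M.sound1 (A.ε_dom i j (Fin.castAdd _) (Fin.natAdd _)) (Fin.append x y)
    (by simpa only [Str.sat_sub2, Str.append_castAdd, Str.append_natAdd] using h)
  simpa only [Str.sat_and, Str.sat_subst, Str.append_castAdd, Str.append_natAdd] using this

theorem eps_refl {i : A.I} {x : Fin (A.n i) → M.str.dom.El} (h : M.str.Sat (A.α i) x) :
    M.str.Sat (A.ε i i) (Fin.append x x) := by
  have := M.sound1 (A.ε_refl i id) x (by simpa only [Str.sat_subst, Function.comp_id] using h)
  simpa only [Str.sat_sub2, Function.comp_id] using this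

theorem eps_symm {i j : A.I} {x : Fin (A.n i) → M.str.dom.El} {y : Fin (A.n j) → M.str.dom.El}
    (h : M.str.Sat (A.ε i j) (Fin.append x y)) : M.str.Sat (A.ε j i) (Fin.append y x) := by
  have := M.sound1 (A.ε_symm i j (Fin.castAdd _) (Fin.natAdd _)) (Fin.append x y)
    (by simpa only [Str.sat_sub2, Str.append_castAdd, Str.append_natAdd] using h)
  simpa only [Str.sat_sub2, Str.append_castAdd, Str.append_natAdd] using this

theorem append_castAdd_castAdd {D : Type} {n k l : ℕ} (a : Fin n → D) (b : Fin k → D)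
    (c : Fin l → D) : Fin.append (Fin.append a b) c ∘ (Fin.castAdd l ∘ Fin.castAdd k) = a := by
  rw [← Function.comp_assoc, Str.append_castAdd, Str.append_castAdd]

theorem append_castAdd_natAdd {D : Type} {n k l : ℕ} (a : Fin n → D) (b : Fin k → D)
    (c : Fin l → D) : Fin.append (Fin.append a b) c ∘ (Fin.castAdd l ∘ Fin.natAdd n) = b := by
  rw [← Function.comp_assoc, Str.append_castAdd, Str.append_natAdd]

theorem append_natAdd_castAdd {D : Type} {n k l : ℕ} (a : Fin n → D) (b : Fin k → D)
    (c : Fin l → D) : Fin.append a (Fin.append b c) ∘ (Fin.natAdd n ∘ Fin.castAdd l) = b := by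
  rw [← Function.comp_assoc, Str.append_natAdd, Str.append_castAdd]

theorem append_natAdd_natAdd {D : Type} {n k l : ℕ} (a : Fin n → D) (b : Fin k → D)
    (c : Fin l → D) : Fin.append a (Fin.append b c) ∘ (Fin.natAdd n ∘ Fin.natAdd k) = c := by
  rw [← Function.comp_assoc, Str.append_natAdd, Str.append_natAdd]

theorem eps_trans {i j k : A.I} {x : Fin (A.n i) → M.str.dom.El}
    {y : Fin (A.n j) → M.str.dom.El} {z : Fin (A.n k) → M.str.dom.El}
    (h : M.str.Sat (A.ε i j) (Fin.append x y)) (h' : M.str.Sat (A.ε j k) (Fin.append y z)) :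
    M.str.Sat (A.ε i k) (Fin.append x z) := by
  have := M.sound2 (A.ε_trans i j k (Fin.castAdd _ ∘ Fin.castAdd _) (Fin.castAdd _ ∘ Fin.natAdd _)
    (Fin.natAdd _)) (Fin.append (Fin.append x y) z)
    (by simpa only [Str.sat_sub2, append_castAdd_castAdd, append_castAdd_natAdd] using h)
    (by simpa only [Str.sat_sub2, append_castAdd_natAdd, Str.append_natAdd] using h')
  simpa only [Str.sat_sub2, append_castAdd_castAdd, Str.append_natAdd] using this

/-- The equivalence relation `ε` on the points of `⨆ᵢ αᵢ`. -/
instance Pt.setoid (M : Model T) (A : ImSort T) : Setoid (Pt M A) where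
  r p q := M.str.Sat (A.ε p.i q.i) (Fin.append p.x q.x)
  iseqv := ⟨fun p => eps_refl M p.sat, fun h => eps_symm M h, fun h h' => eps_trans M h h'⟩

/-- The interpretation of the imaginary sort `A` in the model `M`. -/
def Sem (M : Model T) (A : ImSort T) : Type := Quotient (Pt.setoid M A)

/-- The class of a point. -/
def Pt.cls {M : Model T} {A : ImSort T} (p : Pt M A) : Sem M A := Quotient.mk _ p

theorem Pt.cls_surj {M : Model T} {A : ImSort T} (a : Sem M A) : ∃ p : Pt M A, p.cls = a :=
  Quotient.exists_rep a

theorem Pt.cls_eq {M : Model T} {A : ImSort T} {p q : Pt M A} :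
    p.cls = q.cls ↔ M.str.Sat (A.ε p.i q.i) (Fin.append p.x q.x) :=
  Quotient.eq

/-- The graph of a definable function on points. -/
def ptGraph (f : A ⟶ B) (p : Pt M A) (q : Pt M B) : Prop :=
  Quotient.lift (fun F : FunFamily A B => M.str.Sat (F.φ p.i q.i) (Fin.append p.x q.x))
    (fun F G h => by
      have key : ∀ {F G : FunFamily A B}, F ≈ G → M.str.Sat (F.φ p.i q.i) (Fin.append p.x q.x) →
          M.str.Sat (G.φ p.i q.i) (Fin.append p.x q.x) := fun {F G} h h' => by
        have := M.sound1 (h p.i q.i (Fin.castAdd _) (Fin.natAdd _)).1 (Fin.append p.x q.x)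
          (by simpa only [Str.sat_sub2, Str.append_castAdd, Str.append_natAdd] using h')
        simpa only [Str.sat_sub2, Str.append_castAdd, Str.append_natAdd] using this
      exact propext ⟨key h, key (Setoid.symm h)⟩) f

theorem ptGraph_congr {f : A ⟶ B} {p p' : Pt M A} {q q' : Pt M B} (hp : p.cls = p'.cls)
    (hq : q.cls = q'.cls) (h : ptGraph M f p q) : ptGraph M f p' q' := by
  induction f using Quotient.ind with | _ F
  change M.str.Sat (F.φ p.i q.i) (Fin.append p.x q.x) at h
  change M.str.Sat (F.φ p'.i q'.i) (Fin.append p'.x q'.x)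
  rw [Pt.cls_eq] at hp hq
  have h1 := M.sound2 (F.congr_left p.i p'.i q.i (Fin.castAdd _ ∘ Fin.castAdd _)
    (Fin.castAdd _ ∘ Fin.natAdd _) (Fin.natAdd _)) (Fin.append (Fin.append p.x p'.x) q.x)
    (by simpa only [Str.sat_sub2, append_castAdd_castAdd, Str.append_natAdd] using h)
    (by simpa only [Str.sat_sub2, append_castAdd_castAdd, append_castAdd_natAdd] using hp)
  simp only [Str.sat_sub2, append_castAdd_natAdd, Str.append_natAdd] at h1
  have h2 := M.sound2 (F.congr_right p'.i q.i q'.i (Fin.castAdd _ ∘ Fin.castAdd _)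
    (Fin.castAdd _ ∘ Fin.natAdd _) (Fin.natAdd _)) (Fin.append (Fin.append p'.x q.x) q'.x)
    (by simpa only [Str.sat_sub2, append_castAdd_castAdd, append_castAdd_natAdd] using h1)
    (by simpa only [Str.sat_sub2, append_castAdd_natAdd, Str.append_natAdd] using hq)
  simpa only [Str.sat_sub2, append_castAdd_castAdd, Str.append_natAdd] using h2

theorem ptGraph_total (f : A ⟶ B) (p : Pt M A) : ∃ q, ptGraph M f p q := by
  induction f using Quotient.ind with | _ F
  have h1 := M.sound1 (F.total p.i id) p.x
    (by simpa only [Str.sat_subst, Function.comp_id] using p.sat)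
  simp only [Str.sat_subst, Function.comp_id] at h1
  obtain ⟨k, y, h⟩ := (M.str.sat_bigEx _ _ _ _).1 h1
  have h2 := M.sound1 (F.dom p.i k (Fin.castAdd _) (Fin.natAdd _)) (Fin.append p.x y)
    (by simpa only [Str.sat_sub2, Str.append_castAdd, Str.append_natAdd] using h)
  simp only [Str.sat_and, Str.sat_subst, Str.append_castAdd, Str.append_natAdd] at h2
  exact ⟨⟨k, y, h2.2⟩, h⟩

theorem ptGraph_unique {f : A ⟶ B} {p : Pt M A} {q q' : Pt M B} (h : ptGraph M f p q)
    (h' : ptGraph M f p q') : q.cls = q'.cls := by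
  induction f using Quotient.ind with | _ F
  change M.str.Sat (F.φ p.i q.i) (Fin.append p.x q.x) at h
  change M.str.Sat (F.φ p.i q'.i) (Fin.append p.x q'.x) at h'
  rw [Pt.cls_eq]
  have h2 := M.sound2 (F.unique p.i q.i q'.i (Fin.castAdd _ ∘ Fin.castAdd _)
    (Fin.castAdd _ ∘ Fin.natAdd _) (Fin.natAdd _)) (Fin.append (Fin.append p.x q.x) q'.x)
    (by simpa only [Str.sat_sub2, append_castAdd_castAdd, append_castAdd_natAdd] using h)
    (by simpa only [Str.sat_sub2, append_castAdd_castAdd, Str.append_natAdd] using h')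
  simpa only [Str.sat_sub2, append_castAdd_natAdd, Str.append_natAdd] using h2

/-- The interpretation of a definable function. -/
noncomputable def smap (f : A ⟶ B) : Sem M A → Sem M B :=
  Quotient.lift (fun p => (ptGraph_total M f p).choose.cls) fun p p' h =>
    ptGraph_unique M (ptGraph_congr M (Quotient.sound h) rfl (ptGraph_total M f p).choose_spec)
      (ptGraph_total M f p').choose_spec

theorem smap_eq {f : A ⟶ B} {p : Pt M A} {q : Pt M B} :
    smap M f p.cls = q.cls ↔ ptGraph M f p q := by
  have h := (ptGraph_total M f p).choose_spec
  exact ⟨fun h' => ptGraph_congr M rfl h' h, fun h' => ptGraph_unique M h h'⟩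

theorem smap_mk {F : FunFamily A B} {p : Pt M A} {q : Pt M B} :
    smap M (Quotient.mk _ F : A ⟶ B) p.cls = q.cls ↔
      M.str.Sat (F.φ p.i q.i) (Fin.append p.x q.x) :=
  smap_eq M

@[simp] theorem smap_id (a : Sem M A) : smap M (𝟙 A) a = a := by
  obtain ⟨p, rfl⟩ := Pt.cls_surj a
  exact (smap_mk M (F := FunFamily.id A)).2 (eps_refl M p.sat)

@[simp] theorem smap_comp (f : A ⟶ B) (g : B ⟶ C) (a : Sem M A) :
    smap M (f ≫ g) a = smap M g (smap M f a) := by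
  obtain ⟨p, rfl⟩ := Pt.cls_surj a
  obtain ⟨q, hq⟩ := Pt.cls_surj (smap M f p.cls)
  obtain ⟨r, hr⟩ := Pt.cls_surj (smap M g q.cls)
  rw [← hq, ← hr]
  induction f using Quotient.ind with | _ F
  induction g using Quotient.ind with | _ G
  refine (smap_mk M (F := FunFamily.comp F G)).2 ?_
  refine (M.str.sat_bigEx _ _ _ _).2 ⟨q.i, q.x, ?_⟩
  simp only [Str.sat_and, Str.sat_sub2, append_castAdd_castAdd, append_castAdd_natAdd,
    Str.append_natAdd]
  exact ⟨(smap_mk M).1 hq.symm, (smap_mk M).1 hr.symm⟩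

/-- By completeness, families of formulas which define the same function in all countable models are
provably equivalent. Equations in the syntactic category may thus be checked on elements. -/
theorem syn_hom_ext {f g : A ⟶ B} (h : ∀ (M : Model T) (a : Sem M A), smap M f a = smap M g a) :
    f = g := by
  induction f using Quotient.ind with | _ F
  induction g using Quotient.ind with | _ G
  have key : ∀ {F G : FunFamily A B}, (∀ (M : Model T) (a : Sem M A),
      smap M (Quotient.mk _ F : A ⟶ B) a = smap M (Quotient.mk _ G : A ⟶ B) a) →
      ∀ (i : A.I) (k : B.I) {N : ℕ} (x : Fin (A.n i) → Fin N) (y : Fin (B.n k) → Fin N),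
        Prf T.ax {(F.φ i k).sub2 x y} ((G.φ i k).sub2 x y) := by
    intro F G h i k N x y
    refine prf1 fun M v hv => ?_
    have h1 := M.sound1 (F.dom i k x y) v hv
    rw [Str.sat_sub2] at hv ⊢
    simp only [Str.sat_and, Str.sat_subst] at h1
    have h2 := (smap_mk M (F := F) (p := ⟨i, _, h1.1⟩) (q := ⟨k, _, h1.2⟩)).2 hv
    rw [h] at h2
    exact (smap_mk M).1 h2
  exact Quotient.sound fun i k N x y =>
    ⟨key h i k x y, key (fun M a => (h M a).symm) i k x y⟩

/-! ### Definable relations -/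

/-- A family of relations between the interpretations of `A` and `B` which is given by
formulas. -/
def IsDef (A B : ImSort T) (R : ∀ M : Model T, Sem M A → Sem M B → Prop) : Prop :=
  ∃ φ : (i : A.I) → (k : B.I) → Formula T.L (A.n i + B.n k), ∀ (M : Model T) (p : Pt M A)
    (q : Pt M B), M.str.Sat (φ p.i q.i) (Fin.append p.x q.x) ↔ R M p.cls q.cls

namespace IsDef

theorem graph (f : A ⟶ B) : IsDef A B fun M a b => smap M f a = b := by
  induction f using Quotient.ind with | _ F
  exact ⟨F.φ, fun M p q => (smap_mk M).symm⟩

theorem congr {R S : ∀ M : Model T, Sem M A → Sem M B → Prop} (hR : IsDef A B R)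
    (h : ∀ M a b, R M a b ↔ S M a b) : IsDef A B S := by
  obtain ⟨φ, hφ⟩ := hR
  exact ⟨φ, fun M p q => (hφ M p q).trans (h _ _ _)⟩

theorem univ : IsDef A B fun _ _ _ => True :=
  ⟨fun _ _ => top, fun M _ _ => ⟨fun _ => trivial, fun _ => M.str.sat_top _⟩⟩

theorem symm {R : ∀ M : Model T, Sem M A → Sem M B → Prop} (hR : IsDef A B R) :
    IsDef B A fun M b a => R M a b := by
  obtain ⟨φ, hφ⟩ := hR
  refine ⟨fun k i => (φ i k).sub2 (Fin.natAdd _) (Fin.castAdd _), fun M q p => ?_⟩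
  rw [Str.sat_sub2, Str.append_castAdd, Str.append_natAdd]
  exact hφ M p q

theorem and {R S : ∀ M : Model T, Sem M A → Sem M B → Prop} (hR : IsDef A B R)
    (hS : IsDef A B S) : IsDef A B fun M a b => R M a b ∧ S M a b := by
  obtain ⟨φ, hφ⟩ := hR
  obtain ⟨ψ, hψ⟩ := hS
  refine ⟨fun i k => (φ i k).and (ψ i k), fun M p q => ?_⟩
  rw [Str.sat_and]
  exact and_congr (hφ M p q) (hψ M p q)

theorem comp {R : ∀ M : Model T, Sem M A → Sem M B → Prop}
    {S : ∀ M : Model T, Sem M B → Sem M C → Prop} (hR : IsDef A B R) (hS : IsDef B C S) :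
    IsDef A C fun M a c => ∃ b, R M a b ∧ S M b c := by
  obtain ⟨φ, hφ⟩ := hR
  obtain ⟨ψ, hψ⟩ := hS
  -- `IsDef` controls the formulas only at points, so the quantified tuple has to be restricted to
  -- `B.α k`.
  refine ⟨fun i m => bigEx B.I B.n fun k => ((B.α k).subst (Fin.natAdd _)).and
    (((φ i k).sub2 (Fin.castAdd _ ∘ Fin.castAdd _) (Fin.natAdd _)).and
      ((ψ k m).sub2 (Fin.natAdd _) (Fin.castAdd _ ∘ Fin.natAdd _))), fun M p r => ?_⟩
  rw [Str.sat_bigEx]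
  simp only [Str.sat_and, Str.sat_sub2, append_castAdd_castAdd, append_castAdd_natAdd,
    Str.append_natAdd, Str.sat_subst]
  constructor
  · rintro ⟨k, y, h, h1, h2⟩
    exact ⟨Pt.cls ⟨k, y, h⟩, (hφ M p ⟨k, y, h⟩).1 h1, (hψ M ⟨k, y, h⟩ r).1 h2⟩
  · rintro ⟨b, h1, h2⟩
    obtain ⟨q, rfl⟩ := Pt.cls_surj b
    exact ⟨q.i, q.x, q.sat, (hφ M p q).2 h1, (hψ M q r).2 h2⟩

theorem iUnion {J : Type} [Countable J] {R : J → ∀ M : Model T, Sem M A → Sem M B → Prop}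
    (hR : ∀ j, IsDef A B (R j)) : IsDef A B fun M a b => ∃ j, R j M a b := by
  choose φ hφ using hR
  obtain ⟨f, hf⟩ := Countable.exists_injective_nat J
  let e : J ≃ Set.range f := Equiv.ofInjective f hf
  refine ⟨fun i k => disj (Set.range f) fun j => φ (e.symm j) i k, fun M p q => ?_⟩
  refine (e.symm.exists_congr_left.trans ?_ : _ ↔ ∃ j, R j M p.cls q.cls)
  exact exists_congr fun j => by
    simp only [Equiv.symm_symm, Equiv.symm_apply_apply]
    exact hφ j M p q

/-- A definable functional relation is the graph of a definable function. -/
theorem exists_hom {R : ∀ M : Model T, Sem M A → Sem M B → Prop} (hR : IsDef A B R)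
    (hf : ∀ M a, ∃! b, R M a b) : ∃ f : A ⟶ B, ∀ M a b, smap M f a = b ↔ R M a b := by
  obtain ⟨φ, hφ⟩ := hR
  -- The restriction to `α` and `β` makes `dom` true; invariance under `ε` then costs nothing, since
  -- `R` is a relation between classes.
  let θ : (i : A.I) → (k : B.I) → Formula T.L (A.n i + B.n k) := fun i k =>
    (((A.α i).subst (Fin.castAdd _)).and ((B.α k).subst (Fin.natAdd _))).and (φ i k)
  have hθ : ∀ (M : Model T) (i : A.I) (k : B.I) (x : Fin (A.n i) → M.str.dom.El)
      (y : Fin (B.n k) → M.str.dom.El), M.str.Sat (θ i k) (Fin.append x y) ↔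
      ∃ (hx : M.str.Sat (A.α i) x) (hy : M.str.Sat (B.α k) y),
        R M (Pt.cls ⟨i, x, hx⟩) (Pt.cls ⟨k, y, hy⟩) := fun M i k x y => by
    simp only [θ, Str.sat_and, Str.sat_subst, Str.append_castAdd, Str.append_natAdd]
    constructor
    · rintro ⟨⟨hx, hy⟩, h⟩
      exact ⟨hx, hy, (hφ M ⟨i, x, hx⟩ ⟨k, y, hy⟩).1 h⟩
    · rintro ⟨hx, hy, h⟩
      exact ⟨⟨hx, hy⟩, (hφ M ⟨i, x, hx⟩ ⟨k, y, hy⟩).2 h⟩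
  let F : FunFamily A B :=
    { φ := θ
      dom := fun i k N x y => prf1 fun M v h => by
        rw [Str.sat_sub2, hθ] at h
        rw [Str.sat_and, Str.sat_subst, Str.sat_subst]
        exact ⟨h.1, h.2.1⟩
      congr_left := fun i j k N x x' y => prf2 fun M v h h' => by
        rw [Str.sat_sub2, hθ] at h
        rw [Str.sat_sub2] at h' ⊢
        rw [hθ]
        obtain ⟨hx, hy, h⟩ := h
        refine ⟨(eps_dom M h').2, hy, ?_⟩
        convert h using 1
        exact Eq.symm (Pt.cls_eq.2 h')
      congr_right := fun i k l N x y y' => prf2 fun M v h h' => by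
        rw [Str.sat_sub2, hθ] at h
        rw [Str.sat_sub2] at h' ⊢
        rw [hθ]
        obtain ⟨hx, hy, h⟩ := h
        refine ⟨hx, (eps_dom M h').2, ?_⟩
        convert h using 1
        exact Eq.symm (Pt.cls_eq.2 h')
      unique := fun i k l N x y y' => prf2 fun M v h h' => by
        rw [Str.sat_sub2, hθ] at h h'
        rw [Str.sat_sub2]
        obtain ⟨hx, hy, h⟩ := h
        obtain ⟨hx', hy', h'⟩ := h'
        exact Pt.cls_eq.1 ((hf M _).unique h h')
      total := fun i N x => prf1 fun M v h => by
        rw [Str.sat_subst] at h ⊢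
        rw [Str.sat_bigEx]
        obtain ⟨b, hb, _⟩ := hf M (Pt.cls ⟨i, _, h⟩)
        obtain ⟨q, rfl⟩ := Pt.cls_surj b
        exact ⟨q.i, q.x, (hθ M i q.i _ q.x).2 ⟨h, q.sat, hb⟩⟩ }
  refine ⟨Quotient.mk _ F, fun M a b => ?_⟩
  obtain ⟨p, rfl⟩ := Pt.cls_surj a
  obtain ⟨q, rfl⟩ := Pt.cls_surj b
  rw [smap_mk, hθ]
  exact ⟨fun ⟨_, _, h⟩ => h, fun h => ⟨p.sat, q.sat, h⟩⟩

end IsDef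

/-! ### Imaginary sorts with an arbitrary countable index set -/

/-- A countable family of formulas with an equivalence relation on the disjoint union of the
sets they define in any model. -/
structure SortData (T : Theory) (ι : Type) where
  n : ι → ℕ
  α : (i : ι) → Formula T.L (n i)
  ε : (i j : ι) → Formula T.L (n i + n j)
  dom : ∀ (M : Model T) {i j : ι} {x : Fin (n i) → M.str.dom.El} {y : Fin (n j) → M.str.dom.El},
    M.str.Sat (ε i j) (Fin.append x y) → M.str.Sat (α i) x ∧ M.str.Sat (α j) y
  refl : ∀ (M : Model T) {i : ι} {x : Fin (n i) → M.str.dom.El},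
    M.str.Sat (α i) x → M.str.Sat (ε i i) (Fin.append x x)
  symm : ∀ (M : Model T) {i j : ι} {x : Fin (n i) → M.str.dom.El}
    {y : Fin (n j) → M.str.dom.El}, M.str.Sat (ε i j) (Fin.append x y) →
      M.str.Sat (ε j i) (Fin.append y x)
  trans : ∀ (M : Model T) {i j k : ι} {x : Fin (n i) → M.str.dom.El}
    {y : Fin (n j) → M.str.dom.El} {z : Fin (n k) → M.str.dom.El},
    M.str.Sat (ε i j) (Fin.append x y) → M.str.Sat (ε j k) (Fin.append y z) →
      M.str.Sat (ε i k) (Fin.append x z)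

namespace SortData

variable {ι : Type} [Countable ι] (D : SortData T ι)

/-- A numbering of the index set. -/
noncomputable def idx (ι : Type) [Countable ι] :
    ι ≃ Set.range (Countable.exists_injective_nat ι).choose :=
  Equiv.ofInjective _ (Countable.exists_injective_nat ι).choose_spec

/-- The imaginary sort. -/
noncomputable def sort : ImSort T where
  I := Set.range (Countable.exists_injective_nat ι).choose
  n i := D.n ((idx ι).symm i)
  α i := D.α ((idx ι).symm i)
  ε i j := D.ε ((idx ι).symm i) ((idx ι).symm j)
  ε_dom i j N x y := prf1 fun M v h => by
    rw [Str.sat_sub2] at h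
    rw [Str.sat_and, Str.sat_subst, Str.sat_subst]
    exact D.dom M h
  ε_refl i N x := prf1 fun M v h => by
    rw [Str.sat_subst] at h
    rw [Str.sat_sub2]
    exact D.refl M h
  ε_symm i j N x y := prf1 fun M v h => by
    rw [Str.sat_sub2] at h ⊢
    exact D.symm M h
  ε_trans i j k N x y z := prf2 fun M v h h' => by
    rw [Str.sat_sub2] at h h' ⊢
    exact D.trans M h h'

/-- The class of `x` in the `i`-th formula. -/
noncomputable def elt {M : Model T} (i : ι) (x : Fin (D.n i) → M.str.dom.El)
    (h : M.str.Sat (D.α i) x) : Sem M D.sort :=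
  Pt.cls ⟨idx ι i, x ∘ Fin.cast (congrArg D.n ((idx ι).symm_apply_apply i)), by
    have key : ∀ (j : ι) (hj : j = i), M.str.Sat (D.α j) (x ∘ Fin.cast (congrArg D.n hj)) := by
      rintro _ rfl
      exact h
    exact key _ ((idx ι).symm_apply_apply i)⟩

/-- The equation between indices is generalised to a variable index, after which substitution
removes the casts. -/
theorem elt_idx {M : Model T} (k : Set.range (Countable.exists_injective_nat ι).choose)
    (x : Fin (D.n ((idx ι).symm k)) → M.str.dom.El)
    (h : M.str.Sat (D.α ((idx ι).symm k)) x) : D.elt _ x h = Pt.cls ⟨k, x, h⟩ := by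
  have key : ∀ (k' : D.sort.I) (hk : k' = k) (h'), (Pt.cls ⟨k', x ∘ Fin.cast
      (congrArg D.n (congrArg (idx ι).symm hk)), h'⟩ : Sem M D.sort) = Pt.cls ⟨k, x, h⟩ := by
    rintro _ rfl _
    rfl
  exact key _ ((idx ι).apply_symm_apply k) _

theorem exists_elt {M : Model T} (a : Sem M D.sort) : ∃ i x h, D.elt i x h = a := by
  obtain ⟨p, rfl⟩ := Pt.cls_surj a
  exact ⟨_, p.x, p.sat, D.elt_idx _ _ _⟩

theorem elt_eq {M : Model T} {i j : ι} {x : Fin (D.n i) → M.str.dom.El}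
    {y : Fin (D.n j) → M.str.dom.El} {h : M.str.Sat (D.α i) x} {h' : M.str.Sat (D.α j) y} :
    D.elt i x h = D.elt j y h' ↔ M.str.Sat (D.ε i j) (Fin.append x y) := by
  obtain ⟨i, rfl⟩ := (idx ι).symm.surjective i
  obtain ⟨j, rfl⟩ := (idx ι).symm.surjective j
  rw [D.elt_idx, D.elt_idx, Pt.cls_eq]
  rfl

theorem isDef {R : ∀ M : Model T, Sem M D.sort → Sem M B → Prop}
    (φ : (i : ι) → (k : B.I) → Formula T.L (D.n i + B.n k))
    (hφ : ∀ (M : Model T) (i : ι) (x : Fin (D.n i) → M.str.dom.El) (h : M.str.Sat (D.α i) x)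
      (q : Pt M B), M.str.Sat (φ i q.i) (Fin.append x q.x) ↔ R M (D.elt i x h) q.cls) :
    IsDef D.sort B R :=
  ⟨fun i k => φ ((idx ι).symm i) k, fun M p q => (hφ M _ p.x p.sat q).trans
    (iff_of_eq (congrArg (fun a => R M a q.cls) (D.elt_idx p.i p.x p.sat)))⟩

end SortData

/-! ### Formulas as imaginary sorts -/

section ofFormula

variable {n : ℕ} {α : Formula T.L n} {M}

theorem sat_epsFormula (x y : Fin n → M.str.dom.El) :
    M.str.Sat (epsFormula α) (Fin.append x y) ↔ M.str.Sat α x ∧ x = y := by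
  simp only [epsFormula, Str.sat_and, Str.sat_eqs, Str.sat_subst, Str.append_castAdd,
    Str.append_natAdd]

/-- The tuple corresponding to an element of the sort `α`. -/
def vec : Sem M (ImSort.ofFormula α) → (Fin n → M.str.dom.El) :=
  Quotient.lift (fun p : Pt M (ImSort.ofFormula α) => p.x) fun p q h =>
    ((sat_epsFormula (α := α) (M := M) p.x q.x).1 h).2

theorem vec_sat (a : Sem M (ImSort.ofFormula α)) : M.str.Sat α (vec a) := by
  obtain ⟨p, rfl⟩ := Pt.cls_surj a
  exact p.sat

theorem vec_injective : Function.Injective (vec (M := M) (α := α)) := by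
  intro a b h
  obtain ⟨p, rfl⟩ := Pt.cls_surj a
  obtain ⟨q, rfl⟩ := Pt.cls_surj b
  exact Pt.cls_eq.2 ((sat_epsFormula (α := α) (M := M) p.x q.x).2 ⟨p.sat, h⟩)

/-- The element of the sort `α` given by a tuple. -/
def ofVec (x : Fin n → M.str.dom.El) (h : M.str.Sat α x) : Sem M (ImSort.ofFormula α) :=
  Pt.cls ⟨⟨0, rfl⟩, x, h⟩

theorem vec_ofVec (x : Fin n → M.str.dom.El) (h : M.str.Sat α x) : vec (ofVec x h) = x := rfl

theorem sat_coordFormula (i : Fin n) (x : Fin n → M.str.dom.El) (y : Fin 1 → M.str.dom.El) :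
    M.str.Sat (coordFormula α i) (Fin.append x y) ↔ M.str.Sat α x ∧ x i = y 0 := by
  rw [coordFormula, Str.sat_and, Str.sat_subst, Str.append_castAdd]
  change _ ∧ Fin.append x y (Fin.castAdd 1 i) = Fin.append x y (Fin.natAdd n 0) ↔ _
  rw [Fin.append_left, Fin.append_right]

/-- The element of the model corresponding to an element of the home sort. -/
def hval (a : Sem M (homeSort T)) : M.str.dom.El := vec (α := (top : Formula T.L 1)) a 0

theorem hval_injective : Function.Injective (hval (M := M)) := fun a b h =>
  vec_injective (α := (top : Formula T.L 1)) (funext fun i => by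
    rw [Subsingleton.elim i 0]
    exact h)

theorem hval_surjective : Function.Surjective (hval (M := M)) := fun a =>
  ⟨ofVec (α := (top : Formula T.L 1)) (fun _ => a) (M.str.sat_top _), rfl⟩

theorem hval_coord (a : Sem M (ImSort.ofFormula α)) (i : Fin n) :
    hval (smap M (coord α i) a) = vec a i := by
  obtain ⟨p, rfl⟩ := Pt.cls_surj a
  obtain ⟨q, hq⟩ := Pt.cls_surj (smap M (coord α i) p.cls)
  have h := (smap_mk M (F := coordFamily α i)).1 hq.symm
  rw [← hq]
  exact ((sat_coordFormula i p.x q.x).1 h).2.symm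

/-- A formula in two tuples of variables defines a relation between sorts given by formulas. -/
theorem isDef_vec {m : ℕ} {β : Formula T.L m} (φ : Formula T.L (n + m)) :
    IsDef (ImSort.ofFormula α) (ImSort.ofFormula β)
      fun M a b => M.str.Sat φ (Fin.append (vec a) (vec b)) :=
  ⟨fun _ _ => φ, fun _ _ _ => Iff.rfl⟩

end ofFormula

end Sem

end Lw1w

namespace Lw1w

open Formula Limits

/-! ### Limits and colimits in the syntactic category -/

section SynLimits

variable {T : Theory} {A B C P E X Q : ImSort T}

/-- The mediating map of a cone is the function with graph `p b = fst a ∧ q b = snd a`. This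
relation is composed of graphs, hence given by formulas, and it is functional in every model by
hypothesis. The equations it must satisfy are checked on elements. -/
theorem syn_isPullback {p : P ⟶ A} {q : P ⟶ B} {f : A ⟶ C} {g : B ⟶ C}
    (w : ∀ (M : Model T) u, smap M f (smap M p u) = smap M g (smap M q u))
    (h : ∀ (M : Model T) a b, smap M f a = smap M g b → ∃! u, smap M p u = a ∧ smap M q u = b) :
    IsPullback p q f g := by
  have key : ∀ s : PullbackCone f g, ∃ l : s.pt ⟶ P, ∀ M a b, smap M l a = b ↔
      smap M p b = smap M s.fst a ∧ smap M q b = smap M s.snd a := fun s =>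
    ((((IsDef.graph s.fst).comp (IsDef.graph p).symm).and
      ((IsDef.graph s.snd).comp (IsDef.graph q).symm)).congr
        fun M a b => by simp only [exists_eq_left']).exists_hom fun M a =>
      h M (smap M s.fst a) (smap M s.snd a) (by rw [← smap_comp, s.condition, smap_comp])
  refine ⟨⟨syn_hom_ext fun M a => by rw [smap_comp, smap_comp, w]⟩,
    ⟨PullbackCone.IsLimit.mk _ (fun s => (key s).choose) (fun s => syn_hom_ext fun M a => ?_)
      (fun s => syn_hom_ext fun M a => ?_) fun s m h1 h2 => syn_hom_ext fun M a => Eq.symm ?_⟩⟩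
  · rw [smap_comp]
    exact (((key s).choose_spec M a _).1 rfl).1
  · rw [smap_comp]
    exact (((key s).choose_spec M a _).1 rfl).2
  · refine ((key s).choose_spec M a _).2 ?_
    rw [← h1, ← h2, smap_comp, smap_comp]
    exact ⟨rfl, rfl⟩

theorem syn_isTerminal (h : ∀ M : Model T, Nonempty (Unique (Sem M A))) :
    Nonempty (IsTerminal A) := by
  have key : ∀ B : ImSort T, ∃ f : B ⟶ A, True := fun B =>
    (IsDef.univ.exists_hom fun M a => by
      obtain ⟨h⟩ := h M
      exact ⟨default, trivial, fun _ _ => Subsingleton.elim _ _⟩).imp fun _ _ => trivial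
  refine ⟨IsTerminal.ofUniqueHom (fun B => (key B).choose) fun B m => syn_hom_ext fun M a => ?_⟩
  obtain ⟨h⟩ := h M
  exact Subsingleton.elim _ _

/-- The graph of the induced map is the union over `j` of the graphs transported along `i j`. It is
given by formulas because `J` is countable. -/
theorem syn_isColimit_cofan {J : Type} [Countable J] {F : J → ImSort T} (i : ∀ j, F j ⟶ X)
    (h : ∀ (M : Model T) a, ∃! s : Σ j, Sem M (F j), smap M (i s.1) s.2 = a) :
    Nonempty (IsColimit (Cofan.mk X i)) := by
  have key : ∀ s : Cofan F, ∃ f : X ⟶ s.pt, ∀ M a b, smap M f a = b ↔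
      ∃ j, ∃ c, smap M (i j) c = a ∧ smap M (s.inj j) c = b := fun s =>
    (IsDef.iUnion fun j => (IsDef.graph (i j)).symm.comp (IsDef.graph (s.inj j))).exists_hom
      fun M a => by
        obtain ⟨⟨j, c⟩, h1, h2⟩ := h M a
        refine ⟨smap M (s.inj j) c, ⟨j, c, h1, rfl⟩, ?_⟩
        rintro _ ⟨j', c', h3, rfl⟩
        cases h2 ⟨j', c'⟩ h3
        rfl
  refine ⟨Cofan.IsColimit.mk _ (fun s => (key s).choose) (fun s j => ?_) fun s m hm => ?_⟩
  · refine syn_hom_ext fun M a => ?_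
    rw [smap_comp]
    exact ((key s).choose_spec M _ _).2 ⟨j, a, rfl, rfl⟩
  · refine syn_hom_ext fun M a => Eq.symm ?_
    obtain ⟨⟨j, c⟩, h1, h2⟩ := h M a
    refine ((key s).choose_spec M _ _).2 ⟨j, c, h1, ?_⟩
    rw [← hm j, smap_comp, ← h1]
    rfl

/-- The induced map has as graph the composite of the converse of `f` with the graph of the given
map. It is single valued because elements with the same image under `f` are related by `E`. -/
theorem syn_isColimit_cofork {p q : E ⟶ X} {f : X ⟶ Q} (w : p ≫ f = q ≫ f)
    (hs : ∀ M : Model T, Function.Surjective (smap M f))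
    (h : ∀ (M : Model T) a b, smap M f a = smap M f b → ∃ e, smap M p e = a ∧ smap M q e = b) :
    Nonempty (IsColimit (Cofork.ofπ f w)) := by
  have key : ∀ s : Cofork p q, ∃ g : Q ⟶ s.pt, ∀ M a b, smap M g a = b ↔
      ∃ c, smap M f c = a ∧ smap M s.π c = b := fun s =>
    ((IsDef.graph f).symm.comp (IsDef.graph s.π)).exists_hom fun M a => by
      obtain ⟨c, rfl⟩ := hs M a
      refine ⟨smap M s.π c, ⟨c, rfl, rfl⟩, ?_⟩
      rintro _ ⟨c', h1, rfl⟩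
      obtain ⟨e, rfl, rfl⟩ := h M _ _ h1
      rw [← smap_comp, ← smap_comp, s.condition]
  refine ⟨Cofork.IsColimit.mk _ (fun s => (key s).choose) (fun s => ?_) fun s m hm => ?_⟩
  · refine syn_hom_ext fun M a => ?_
    refine (smap_comp ..).trans ?_
    exact ((key s).choose_spec M _ _).2 ⟨a, rfl, rfl⟩
  · refine syn_hom_ext fun M a => Eq.symm ?_
    obtain ⟨c, rfl⟩ := hs M a
    refine ((key s).choose_spec M _ _).2 ⟨c, rfl, ?_⟩
    rw [← hm]
    exact smap_comp ..

/-- A definable relation as an imaginary sort. -/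
theorem exists_rel {R : ∀ M : Model T, Sem M A → Sem M B → Prop} (hR : IsDef A B R) :
    ∃ (P : ImSort T) (p : P ⟶ A) (q : P ⟶ B), ∀ M, (∀ u, R M (smap M p u) (smap M q u)) ∧
      ∀ a b, R M a b → ∃! u, smap M p u = a ∧ smap M q u = b := by
  obtain ⟨φ, hφ⟩ := hR
  -- The sort has as points the pairs of points related by `R`, indexed by pairs of indices, and two
  -- pairs are identified when both components are equivalent.
  let α : (i : A.I × B.I) → Formula T.L (A.n i.1 + B.n i.2) := fun i =>
    (((A.α i.1).subst (Fin.castAdd _)).and ((B.α i.2).subst (Fin.natAdd _))).and (φ i.1 i.2)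
  let ε : (i j : A.I × B.I) → Formula T.L ((A.n i.1 + B.n i.2) + (A.n j.1 + B.n j.2)) :=
    fun i j => (((α i).subst (Fin.castAdd _)).and ((α j).subst (Fin.natAdd _))).and
      (((A.ε i.1 j.1).sub2 (Fin.castAdd _ ∘ Fin.castAdd _) (Fin.natAdd _ ∘ Fin.castAdd _)).and
        ((B.ε i.2 j.2).sub2 (Fin.castAdd _ ∘ Fin.natAdd _) (Fin.natAdd _ ∘ Fin.natAdd _)))
  have hα : ∀ (M : Model T) {i : A.I × B.I} {x : Fin (A.n i.1) → M.str.dom.El}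
      {y : Fin (B.n i.2) → M.str.dom.El}, M.str.Sat (α i) (Fin.append x y) ↔
        ∃ (hx : M.str.Sat (A.α i.1) x) (hy : M.str.Sat (B.α i.2) y),
          R M (Pt.cls ⟨i.1, x, hx⟩) (Pt.cls ⟨i.2, y, hy⟩) := by
    intro M i x y
    simp only [α, Str.sat_and, Str.sat_subst, Str.append_castAdd, Str.append_natAdd]
    constructor
    · rintro ⟨⟨hx, hy⟩, h⟩
      exact ⟨hx, hy, (hφ M ⟨i.1, x, hx⟩ ⟨i.2, y, hy⟩).1 h⟩
    · rintro ⟨hx, hy, h⟩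
      exact ⟨⟨hx, hy⟩, (hφ M ⟨i.1, x, hx⟩ ⟨i.2, y, hy⟩).2 h⟩
  have hε : ∀ (M : Model T) {i j : A.I × B.I} {x : Fin (A.n i.1) → M.str.dom.El}
      {y : Fin (B.n i.2) → M.str.dom.El} {x' : Fin (A.n j.1) → M.str.dom.El}
      {y' : Fin (B.n j.2) → M.str.dom.El},
      M.str.Sat (ε i j) (Fin.append (Fin.append x y) (Fin.append x' y')) ↔
        (M.str.Sat (α i) (Fin.append x y) ∧ M.str.Sat (α j) (Fin.append x' y')) ∧
        M.str.Sat (A.ε i.1 j.1) (Fin.append x x') ∧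
          M.str.Sat (B.ε i.2 j.2) (Fin.append y y') := by
    intro M i j x y x' y'
    simp only [ε, Str.sat_and, Str.sat_subst, Str.append_castAdd, Str.append_natAdd,
      Str.sat_sub2, append_castAdd_castAdd, append_castAdd_natAdd, append_natAdd_castAdd,
      append_natAdd_natAdd]
  let D : SortData T (A.I × B.I) :=
    { n := fun i => A.n i.1 + B.n i.2
      α := α
      ε := ε
      dom := by
        intro M i j x y h
        obtain ⟨x, x', rfl⟩ := Str.exists_append x
        obtain ⟨y, y', rfl⟩ := Str.exists_append y
        exact ((hε M).1 h).1
      refl := by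
        intro M i x h
        obtain ⟨x, y, rfl⟩ := Str.exists_append x
        obtain ⟨hx, hy, h'⟩ := (hα M).1 h
        exact (hε M).2 ⟨⟨h, h⟩, eps_refl M hx, eps_refl M hy⟩
      symm := by
        intro M i j x y h
        obtain ⟨x, x', rfl⟩ := Str.exists_append x
        obtain ⟨y, y', rfl⟩ := Str.exists_append y
        obtain ⟨⟨h1, h2⟩, h3, h4⟩ := (hε M).1 h
        exact (hε M).2 ⟨⟨h2, h1⟩, eps_symm M h3, eps_symm M h4⟩
      trans := by
        intro M i j k x y z h h'
        obtain ⟨x, x', rfl⟩ := Str.exists_append x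
        obtain ⟨y, y', rfl⟩ := Str.exists_append y
        obtain ⟨z, z', rfl⟩ := Str.exists_append z
        obtain ⟨⟨h1, h2⟩, h3, h4⟩ := (hε M).1 h
        obtain ⟨⟨h5, h6⟩, h7, h8⟩ := (hε M).1 h'
        exact (hε M).2 ⟨⟨h1, h6⟩, eps_trans M h3 h7, eps_trans M h4 h8⟩ }
  -- elements of the relation and their components
  have hel : ∀ (M : Model T) (u : Sem M D.sort), ∃ (p : Pt M A) (q : Pt M B) (h : _),
      D.elt (p.i, q.i) (Fin.append p.x q.x) h = u := by
    intro M u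
    obtain ⟨i, x, h, rfl⟩ := D.exists_elt u
    obtain ⟨x, y, rfl⟩ := Str.exists_append x
    obtain ⟨hx, hy, h'⟩ := (hα M).1 h
    exact ⟨⟨i.1, x, hx⟩, ⟨i.2, y, hy⟩, h, rfl⟩
  have hel2 : ∀ (M : Model T) (p : Pt M A) (q : Pt M B), R M p.cls q.cls →
      M.str.Sat (D.α (p.i, q.i)) (Fin.append p.x q.x) := fun M p q h =>
    (hα M).2 ⟨p.sat, q.sat, h⟩
  have heq : ∀ (M : Model T) (p p' : Pt M A) (q q' : Pt M B) (h h'),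
      D.elt (p.i, q.i) (Fin.append p.x q.x) h = D.elt (p'.i, q'.i) (Fin.append p'.x q'.x) h' ↔
        p.cls = p'.cls ∧ q.cls = q'.cls := by
    intro M p p' q q' h h'
    rw [D.elt_eq, Pt.cls_eq, Pt.cls_eq]
    exact (hε M).trans ⟨fun h => h.2, fun h2 => ⟨⟨h, h'⟩, h2⟩⟩
  have hd1 : IsDef D.sort A fun M u a => ∃ (p : Pt M A) (q : Pt M B) (h : _),
      D.elt (p.i, q.i) (Fin.append p.x q.x) h = u ∧ p.cls = a := by
    refine D.isDef (fun i k => (A.ε i.1 k).sub2 (Fin.castAdd _ ∘ Fin.castAdd _) (Fin.natAdd _)) ?_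
    intro M i x h r
    obtain ⟨x, y, rfl⟩ := Str.exists_append x
    obtain ⟨hx, hy, h'⟩ := (hα M).1 h
    rw [Str.sat_sub2, append_castAdd_castAdd, Str.append_natAdd]
    refine (Pt.cls_eq (p := ⟨i.1, x, hx⟩) (q := r)).symm.trans ?_
    constructor
    · intro h2
      exact ⟨⟨i.1, x, hx⟩, ⟨i.2, y, hy⟩, h, rfl, h2⟩
    · rintro ⟨p, q, h2, h3, h4⟩
      exact ((heq M p ⟨i.1, x, hx⟩ q ⟨i.2, y, hy⟩ h2 h).1 h3).1.symm.trans h4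
  have hd2 : IsDef D.sort B fun M u b => ∃ (p : Pt M A) (q : Pt M B) (h : _),
      D.elt (p.i, q.i) (Fin.append p.x q.x) h = u ∧ q.cls = b := by
    refine D.isDef (fun i k => (B.ε i.2 k).sub2 (Fin.castAdd _ ∘ Fin.natAdd _) (Fin.natAdd _)) ?_
    intro M i x h r
    obtain ⟨x, y, rfl⟩ := Str.exists_append x
    obtain ⟨hx, hy, h'⟩ := (hα M).1 h
    rw [Str.sat_sub2, append_castAdd_natAdd, Str.append_natAdd]
    refine (Pt.cls_eq (p := ⟨i.2, y, hy⟩) (q := r)).symm.trans ?_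
    constructor
    · intro h2
      exact ⟨⟨i.1, x, hx⟩, ⟨i.2, y, hy⟩, h, rfl, h2⟩
    · rintro ⟨p, q, h2, h3, h4⟩
      exact ((heq M p ⟨i.1, x, hx⟩ q ⟨i.2, y, hy⟩ h2 h).1 h3).2.symm.trans h4
  obtain ⟨f, hf⟩ := hd1.exists_hom fun M u => by
    obtain ⟨p, q, h, rfl⟩ := hel M u
    refine ⟨p.cls, ⟨p, q, h, rfl, rfl⟩, ?_⟩
    rintro _ ⟨p', q', h', h2, rfl⟩
    exact ((heq M p' p q' q h' h).1 h2).1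
  obtain ⟨g, hg⟩ := hd2.exists_hom fun M u => by
    obtain ⟨p, q, h, rfl⟩ := hel M u
    refine ⟨q.cls, ⟨p, q, h, rfl, rfl⟩, ?_⟩
    rintro _ ⟨p', q', h', h2, rfl⟩
    exact ((heq M p' p q' q h' h).1 h2).2
  have hfe : ∀ (M : Model T) (p : Pt M A) (q : Pt M B) (h),
      smap M f (D.elt (p.i, q.i) (Fin.append p.x q.x) h) = p.cls := fun M p q h =>
    (hf M _ _).2 ⟨p, q, h, rfl, rfl⟩
  have hge : ∀ (M : Model T) (p : Pt M A) (q : Pt M B) (h),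
      smap M g (D.elt (p.i, q.i) (Fin.append p.x q.x) h) = q.cls := fun M p q h =>
    (hg M _ _).2 ⟨p, q, h, rfl, rfl⟩
  refine ⟨D.sort, f, g, fun M => ⟨fun u => ?_, fun a b h => ?_⟩⟩
  · obtain ⟨p, q, h, rfl⟩ := hel M u
    rw [hfe, hge]
    exact ((hα M).1 h).2.2
  · obtain ⟨p, rfl⟩ := Pt.cls_surj a
    obtain ⟨q, rfl⟩ := Pt.cls_surj b
    refine ⟨D.elt (p.i, q.i) (Fin.append p.x q.x) (hel2 M p q h), ⟨hfe .., hge ..⟩, ?_⟩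
    rintro u ⟨h1, h2⟩
    obtain ⟨p', q', h', rfl⟩ := hel M u
    rw [hfe] at h1
    rw [hge] at h2
    exact (heq ..).2 ⟨h1, h2⟩

theorem exists_pullback (f : A ⟶ C) (g : B ⟶ C) :
    ∃ (P : ImSort T) (p : P ⟶ A) (q : P ⟶ B), IsPullback p q f g ∧
      ∀ M, (∀ u, smap M f (smap M p u) = smap M g (smap M q u)) ∧
        ∀ a b, smap M f a = smap M g b → ∃! u, smap M p u = a ∧ smap M q u = b := by
  obtain ⟨P, p, q, h⟩ := exists_rel (((IsDef.graph f).comp (IsDef.graph g).symm).congr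
    (S := fun M a b => smap M f a = smap M g b) fun M a b => by simp [eq_comm])
  exact ⟨P, p, q, syn_isPullback (fun M => (h M).1) fun M => (h M).2, h⟩

/-- The interpretation in a model takes pullbacks to pullbacks. -/
theorem sem_pullback {p : P ⟶ A} {q : P ⟶ B} {f : A ⟶ C} {g : B ⟶ C} (h : IsPullback p q f g)
    (M : Model T) {a : Sem M A} {b : Sem M B} (hab : smap M f a = smap M g b) :
    ∃! u, smap M p u = a ∧ smap M q u = b := by
  -- The pullback built by formulas has the property, and any other pullback is isomorphic to it.
  obtain ⟨P', p', q', h', hM⟩ := exists_pullback f g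
  let e : P' ≅ P := h'.isoIsPullback _ _ h
  have h1 : e.hom ≫ p = p' := h'.isoIsPullback_hom_fst _ _ h
  have h2 : e.hom ≫ q = q' := h'.isoIsPullback_hom_snd _ _ h
  obtain ⟨u, ⟨hu1, hu2⟩, hu3⟩ := (hM M).2 a b hab
  refine ⟨smap M e.hom u, ⟨?_, ?_⟩, ?_⟩
  · rw [← smap_comp, h1, hu1]
  · rw [← smap_comp, h2, hu2]
  · rintro v ⟨hv1, hv2⟩
    rw [← hu3 (smap M e.inv v) ⟨?_, ?_⟩, ← smap_comp, e.inv_hom_id, smap_id]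
    · rw [← smap_comp, ← h1, e.inv_hom_id_assoc, hv1]
    · rw [← smap_comp, ← h2, e.inv_hom_id_assoc, hv2]

/-- The families of formulas are put side by side: `ε` is copied within a summand and is false
between different summands. The cast in its definition only aligns types, and `hε1` and `hε2` are
all that is used of it. -/
theorem exists_coprod {J : Type} [Countable J] (F : J → ImSort T) :
    ∃ (X : ImSort T) (i : ∀ j, F j ⟶ X), ∀ (M : Model T) a,
      ∃! s : Σ j, Sem M (F j), smap M (i s.1) s.2 = a := by
  classical
  let ε : (i j : Σ j, (F j).I) → Formula T.L ((F i.1).n i.2 + (F j.1).n j.2) := fun i j =>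
    if h : i.1 = j.1 then
      ((F j.1).ε (cast (congrArg (fun j => ((F j).I : Type)) h) i.2) j.2).subst
        (Fin.cast (by
          obtain ⟨i, i'⟩ := i
          obtain ⟨j, j'⟩ := j
          obtain rfl : i = j := h
          rfl))
    else bot
  have hε1 : ∀ (M : Model T) (j : J) (i i' : (F j).I) (x : Fin ((F j).n i) → M.str.dom.El)
      (y : Fin ((F j).n i') → M.str.dom.El), M.str.Sat (ε ⟨j, i⟩ ⟨j, i'⟩) (Fin.append x y) ↔
        M.str.Sat ((F j).ε i i') (Fin.append x y) := by
    intro M j i i' x y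
    simp only [ε, dite_true, Str.sat_subst]
    rfl
  have hε2 : ∀ (M : Model T) (j j' : J) (i : (F j).I) (i' : (F j').I)
      (x : Fin ((F j).n i) → M.str.dom.El) (y : Fin ((F j').n i') → M.str.dom.El),
      M.str.Sat (ε ⟨j, i⟩ ⟨j', i'⟩) (Fin.append x y) → j = j' := by
    intro M j j' i i' x y h
    by_contra hj
    simp only [ε, dif_neg hj] at h
    exact M.str.not_sat_bot _ h
  let D : SortData T (Σ j, (F j).I) :=
    { n := fun i => (F i.1).n i.2
      α := fun i => (F i.1).α i.2
      ε := ε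
      dom := by
        rintro M ⟨j, i⟩ ⟨j', i'⟩ x y h
        obtain rfl := hε2 M _ _ _ _ _ _ h
        exact eps_dom M ((hε1 ..).1 h)
      refl := by
        rintro M ⟨j, i⟩ x h
        exact (hε1 ..).2 (eps_refl M h)
      symm := by
        rintro M ⟨j, i⟩ ⟨j', i'⟩ x y h
        obtain rfl := hε2 M _ _ _ _ _ _ h
        exact (hε1 ..).2 (eps_symm M ((hε1 ..).1 h))
      trans := by
        rintro M ⟨j, i⟩ ⟨j', i'⟩ ⟨j'', i''⟩ x y z h h'
        obtain rfl := hε2 M _ _ _ _ _ _ h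
        obtain rfl := hε2 M _ _ _ _ _ _ h'
        exact (hε1 ..).2 (eps_trans M ((hε1 ..).1 h) ((hε1 ..).1 h')) }
  have hd : ∀ j, IsDef D.sort (F j) fun M u a => ∃ p : Pt M (F j),
      p.cls = a ∧ D.elt ⟨j, p.i⟩ p.x p.sat = u := fun j => by
    refine D.isDef (fun i k => ε i ⟨j, k⟩) ?_
    rintro M ⟨j', i⟩ x h q
    constructor
    · intro h'
      obtain rfl := hε2 M _ _ _ _ _ _ h'
      exact ⟨q, rfl, (D.elt_eq.2 h').symm⟩
    · rintro ⟨p, h1, h2⟩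
      have h3 := D.elt_eq.1 h2
      obtain rfl := hε2 M _ _ _ _ _ _ h3
      rw [hε1] at h3 ⊢
      exact eps_trans M (eps_symm M h3) (Pt.cls_eq.1 h1)
  have key : ∀ j, ∃ f : F j ⟶ D.sort, ∀ M a b, smap M f a = b ↔ ∃ p : Pt M (F j),
      p.cls = a ∧ D.elt ⟨j, p.i⟩ p.x p.sat = b := fun j =>
    (hd j).symm.exists_hom fun M a => by
      obtain ⟨p, rfl⟩ := Pt.cls_surj a
      refine ⟨_, ⟨p, rfl, rfl⟩, ?_⟩
      rintro _ ⟨q, h, rfl⟩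
      rw [D.elt_eq]
      exact (hε1 ..).2 (Pt.cls_eq.1 h)
  choose f hf using key
  refine ⟨D.sort, f, fun M a => ?_⟩
  obtain ⟨⟨j, i⟩, x, h, rfl⟩ := D.exists_elt a
  refine ⟨⟨j, Pt.cls ⟨i, x, h⟩⟩, (hf j M _ _).2 ⟨⟨i, x, h⟩, rfl, rfl⟩, ?_⟩
  rintro ⟨j', b⟩ hb
  obtain ⟨p, rfl, h2⟩ := (hf j' M _ _).1 hb
  have h3 := D.elt_eq.1 h2
  obtain rfl := hε2 M _ _ _ _ _ _ h3
  rw [hε1] at h3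
  exact congrArg (Sigma.mk j') (Pt.cls_eq.2 h3)

/-- Imaginary sorts absorb quotients: the formulas `α` are kept, and `ε` is replaced by the coarser
equivalence that defines `R`. -/
theorem exists_quotient {R : ∀ M : Model T, Sem M X → Sem M X → Prop} (hR : IsDef X X R)
    (h : ∀ M, Equivalence (R M)) : ∃ (Q : ImSort T) (f : X ⟶ Q), ∀ M,
      Function.Surjective (smap M f) ∧ ∀ a b, smap M f a = smap M f b ↔ R M a b := by
  obtain ⟨φ, hφ⟩ := hR
  let ε : (i j : X.I) → Formula T.L (X.n i + X.n j) := fun i j =>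
    (((X.α i).subst (Fin.castAdd _)).and ((X.α j).subst (Fin.natAdd _))).and (φ i j)
  have hε : ∀ (M : Model T) (i j : X.I) (x : Fin (X.n i) → M.str.dom.El)
      (y : Fin (X.n j) → M.str.dom.El), M.str.Sat (ε i j) (Fin.append x y) ↔
        ∃ (hx : M.str.Sat (X.α i) x) (hy : M.str.Sat (X.α j) y),
          R M (Pt.cls ⟨i, x, hx⟩) (Pt.cls ⟨j, y, hy⟩) := by
    intro M i j x y
    simp only [ε, Str.sat_and, Str.sat_subst, Str.append_castAdd, Str.append_natAdd]
    constructor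
    · rintro ⟨⟨hx, hy⟩, h⟩
      exact ⟨hx, hy, (hφ M ⟨i, x, hx⟩ ⟨j, y, hy⟩).1 h⟩
    · rintro ⟨hx, hy, h⟩
      exact ⟨⟨hx, hy⟩, (hφ M ⟨i, x, hx⟩ ⟨j, y, hy⟩).2 h⟩
  let D : SortData T X.I :=
    { n := X.n
      α := X.α
      ε := ε
      dom := fun M {i j x y} h => by
        obtain ⟨hx, hy, _⟩ := (hε ..).1 h
        exact ⟨hx, hy⟩
      refl := fun M {i x} hx => (hε ..).2 ⟨hx, hx, (h M).refl _⟩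
      symm := fun M {i j x y} h' => by
        obtain ⟨hx, hy, h'⟩ := (hε ..).1 h'
        exact (hε ..).2 ⟨hy, hx, (h M).symm h'⟩
      trans := fun M {i j k x y z} h1 h2 => by
        obtain ⟨hx, hy, h1⟩ := (hε ..).1 h1
        obtain ⟨_, hz, h2⟩ := (hε ..).1 h2
        exact (hε ..).2 ⟨hx, hz, (h M).trans h1 h2⟩ }
  have heq : ∀ (M : Model T) (p q : Pt M X),
      D.elt p.i p.x p.sat = D.elt q.i q.x q.sat ↔ R M p.cls q.cls := by
    intro M p q
    rw [D.elt_eq]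
    exact (hε ..).trans ⟨fun ⟨_, _, h⟩ => h, fun h => ⟨p.sat, q.sat, h⟩⟩
  have hd : IsDef D.sort X fun M u a => ∃ p : Pt M X, p.cls = a ∧ D.elt p.i p.x p.sat = u := by
    refine D.isDef φ fun M i x hx q => (hφ M ⟨i, x, hx⟩ q).trans ?_
    constructor
    · intro h'
      exact ⟨q, rfl, (heq M q ⟨i, x, hx⟩).2 ((h M).symm h')⟩
    · rintro ⟨p, h1, h2⟩
      have h3 := (heq M p ⟨i, x, hx⟩).1 h2
      rw [h1] at h3
      exact (h M).symm h3
  obtain ⟨f, hf⟩ := hd.symm.exists_hom fun M a => by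
    obtain ⟨p, rfl⟩ := Pt.cls_surj a
    refine ⟨_, ⟨p, rfl, rfl⟩, ?_⟩
    rintro _ ⟨q, h', rfl⟩
    rw [heq, h']
    exact (h M).refl _
  have hfe : ∀ (M : Model T) (p : Pt M X), smap M f p.cls = D.elt p.i p.x p.sat := fun M p =>
    (hf M _ _).2 ⟨p, rfl, rfl⟩
  refine ⟨D.sort, f, fun M => ⟨fun u => ?_, fun a b => ?_⟩⟩
  · obtain ⟨i, x, h, rfl⟩ := D.exists_elt u
    exact ⟨_, hfe M ⟨i, x, h⟩⟩
  · obtain ⟨p, rfl⟩ := Pt.cls_surj a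
    obtain ⟨q, rfl⟩ := Pt.cls_surj b
    rw [hfe, hfe, heq]

theorem unique_sem_top (M : Model T) :
    Nonempty (Unique (Sem M (ImSort.ofFormula (top : Formula T.L 0)))) :=
  ⟨⟨⟨ofVec Fin.elim0 (M.str.sat_top _)⟩, fun _ => vec_injective (Subsingleton.elim _ _)⟩⟩

instance : HasTerminal (ImSort T) :=
  (syn_isTerminal (A := ImSort.ofFormula (top : Formula T.L 0)) unique_sem_top).some.hasTerminal

instance : HasPullbacks (ImSort T) :=
  @hasPullbacks_of_hasLimit_cospan _ _ fun {_ _ _ f g} => by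
    obtain ⟨P, p, q, h, _⟩ := exists_pullback f g
    exact h.hasPullback

/-- The relation defined by an internal equivalence relation is an equivalence relation. -/
theorem IsEqRel.equivalence {p q : E ⟶ X} (h : IsEqRel p q) (M : Model T) :
    Equivalence fun a b => ∃ e, smap M p e = a ∧ smap M q e = b where
  refl a := by
    obtain ⟨r, h1, h2⟩ := h.refl
    exact ⟨smap M r a, by rw [← smap_comp, h1, smap_id], by rw [← smap_comp, h2, smap_id]⟩
  symm := by
    rintro a b ⟨e, rfl, rfl⟩
    obtain ⟨s, h1, h2⟩ := h.symm
    exact ⟨smap M s e, by rw [← smap_comp, h1], by rw [← smap_comp, h2]⟩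
  trans := by
    rintro a b c ⟨e, rfl, rfl⟩ ⟨e', h1, rfl⟩
    obtain ⟨W, u, v, hW, t, h2, h3⟩ := h.trans
    obtain ⟨w, ⟨rfl, rfl⟩, _⟩ := sem_pullback hW M h1.symm
    exact ⟨smap M t w, by rw [← smap_comp, h2, smap_comp], by rw [← smap_comp, h3, smap_comp]⟩

end SynLimits

/-! ### Limits and colimits in `Count` -/

section CountLimits

namespace Count

/-- The object of `Count` with one element. -/
def one : Count := ⟨1⟩

/-- The object of `Count` with two elements. -/
def two : Count := ⟨2⟩

/-- The two elements of `two`. -/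
def bit (P : Prop) [Decidable P] : two.El := if P then ⟨1, by simp [two]⟩ else ⟨0, by simp [two]⟩

theorem bit_eq_iff {P Q : Prop} [Decidable P] [Decidable Q] : bit P = bit Q ↔ (P ↔ Q) := by
  by_cases hP : P <;> by_cases hQ : Q <;> simp [bit, hP, hQ, Subtype.ext_iff]

variable {P A B C E X Q : Count}

theorem isPullback {p : P ⟶ A} {q : P ⟶ B} {f : A ⟶ C} {g : B ⟶ C}
    (w : ∀ u, f (p u) = g (q u)) (h : ∀ a b, f a = g b → ∃! u, p u = a ∧ q u = b) :
    IsPullback p q f g := by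
  refine ⟨⟨funext w⟩, ⟨PullbackCone.IsLimit.mk _
    (fun s a => (h (s.fst a) (s.snd a) (congrFun s.condition a)).choose)
    (fun s => funext fun a =>
      (h (s.fst a) (s.snd a) (congrFun s.condition a)).choose_spec.1.1)
    (fun s => funext fun a =>
      (h (s.fst a) (s.snd a) (congrFun s.condition a)).choose_spec.1.2)
    fun s m h1 h2 => funext fun a => ?_⟩⟩
  exact (h (s.fst a) (s.snd a) (congrFun s.condition a)).choose_spec.2 _
    ⟨congrFun h1 a, congrFun h2 a⟩

/-- Elements are maps from the one-element object, to which the universal property applies. -/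
theorem exists_of_isPullback {p : P ⟶ A} {q : P ⟶ B} {f : A ⟶ C} {g : B ⟶ C}
    (h : IsPullback p q f g) {a : A.El} {b : B.El} (hab : f a = g b) :
    ∃ u, p u = a ∧ q u = b := by
  let s : one ⟶ P := h.lift (W := one) (fun _ => a) (fun _ => b) (funext fun _ => hab)
  have h1 : s ≫ p = fun _ => a := h.lift_fst _ _ _
  have h2 : s ≫ q = fun _ => b := h.lift_snd _ _ _
  have z : one.El := ⟨0, by simp [one]⟩
  exact ⟨s z, congrFun h1 z, congrFun h2 z⟩

theorem injective_of_isPullback {p : P ⟶ A} {q : P ⟶ B} {f : A ⟶ C} {g : B ⟶ C}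
    (h : IsPullback p q f g) {u v : P.El} (h1 : p u = p v) (h2 : q u = q v) : u = v := by
  have h3 : (fun _ => u : one ⟶ P) = fun _ => v :=
    h.hom_ext (funext fun _ => h1) (funext fun _ => h2)
  exact congrFun h3 ⟨0, by simp [one]⟩

/-- A set with exactly one element is terminal. -/
def isTerminal (u : Unique X.El) : IsTerminal X :=
  IsTerminal.ofUniqueHom (fun _ _ => default) fun _ _ => funext fun _ => Subsingleton.elim _ _

theorem unique_of_isTerminal (h : IsTerminal X) : Nonempty (Unique X.El) := by
  refine ⟨⟨⟨h.from one ⟨0, by simp [one]⟩⟩, fun a => ?_⟩⟩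
  exact congrFun (h.hom_ext (fun _ => a : one ⟶ X) (h.from one)) ⟨0, by simp [one]⟩

theorem isColimit_cofan {J : Type} {F : J → Count} (i : ∀ j, F j ⟶ X)
    (h : ∀ a, ∃! s : Σ j, (F j).El, i s.1 s.2 = a) : Nonempty (IsColimit (Cofan.mk X i)) := by
  choose r hr hr' using h
  refine ⟨Cofan.IsColimit.mk _ (fun s a => s.inj (r a).1 (r a).2)
    (fun s j => funext fun a => ?_) fun s m hm => funext fun a => ?_⟩
  · change s.inj (r (i j a)).1 (r (i j a)).2 = s.inj j a
    rw [← hr' (i j a) ⟨j, a⟩ rfl]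
  · conv_lhs => rw [← hr a]
    exact congrFun (hm (r a).1) (r a).2

/-- The indicator of `a`, switched on only if `a` is missed by all summands, agrees with the
constant false map on each summand, so the two maps to `two` are equal. If `a` were missed, they
would differ at `a`. Surjectivity of coequalizers has the same proof. -/
theorem exists_of_isColimit_cofan {J : Type} {F : J → Count} {i : ∀ j, F j ⟶ X}
    (h : IsColimit (Cofan.mk X i)) (a : X.El) : ∃ j b, i j b = a := by
  classical
  have h1 : (fun b => bit (b = a ∧ ¬ ∃ j c, i j c = a) : X ⟶ two) = fun _ => bit False := by
    refine Cofan.IsColimit.hom_ext h _ _ fun j => funext fun c => ?_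
    refine bit_eq_iff.2 ⟨?_, False.elim⟩
    rintro ⟨h1, h2⟩
    exact h2 ⟨j, c, h1⟩
  by_contra h2
  exact (bit_eq_iff.1 (congrFun h1 a)).1 ⟨rfl, h2⟩

theorem isColimit_cofork {p q : E ⟶ X} {f : X ⟶ Q} (w : p ≫ f = q ≫ f)
    (hs : Function.Surjective f) (h : ∀ a b, f a = f b → ∃ e, p e = a ∧ q e = b) :
    Nonempty (IsColimit (Cofork.ofπ f w)) := by
  choose r hr using hs
  refine ⟨Cofork.IsColimit.mk _ (fun s a => s.π (r a)) (fun s => funext fun a => ?_)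
    fun s m hm => funext fun a => ?_⟩
  · change s.π (r (f a)) = s.π a
    obtain ⟨e, h1, h2⟩ := h _ _ (hr (f a))
    rw [← h1, ← h2]
    exact congrFun s.condition e
  · conv_lhs => rw [← hr a]
    exact congrFun hm (r a)

theorem surjective_of_isColimit_cofork {p q : E ⟶ X} {f : X ⟶ Q} {w : p ≫ f = q ≫ f}
    (h : IsColimit (Cofork.ofπ f w)) : Function.Surjective f := by
  classical
  intro a
  have h1 : (fun b => bit (b = a ∧ ¬ ∃ c, f c = a) : Q ⟶ two) = fun _ => bit False := by
    refine Cofork.IsColimit.hom_ext h (funext fun c => ?_)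
    refine bit_eq_iff.2 ⟨?_, False.elim⟩
    rintro ⟨h1, h2⟩
    exact h2 ⟨c, h1⟩
  by_contra h2
  exact (bit_eq_iff.1 (congrFun h1 a)).1 ⟨rfl, h2⟩

end Count

end CountLimits

/-! ### The functor to `Count` given by a model is coherent -/

/-- Preservation needs to be checked on only one limit or colimit cone for each diagram. The cones
constructed from formulas are described elementwise in every model, and the bijections `e` turn that
description for `M` into the elementwise criteria in `Count`. -/
theorem isCoherent_of_sem {T : Theory} (M : Model T) (F : ImSort T ⥤ Count)
    (e : ∀ A, Sem M A ≃ (F.obj A).El)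
    (he : ∀ {A B : ImSort T} (f : A ⟶ B) (a : Sem M A), F.map f (e A a) = e B (smap M f a)) :
    IsCoherent F := by
  have he' : ∀ {A B : ImSort T} (f : A ⟶ B) (a : (F.obj A).El),
      F.map f a = e B (smap M f ((e A).symm a)) := fun f a => by
    rw [← he, Equiv.apply_symm_apply]
  have hpt : PreservesLimit (Functor.empty.{0} (ImSort T)) F :=
    preservesLimit_of_preserves_limit_cone (syn_isTerminal unique_sem_top).some
      ((isLimitMapConeEmptyConeEquiv F _).symm (Count.isTerminal
        (@Equiv.unique _ _ (unique_sem_top M).some (e _).symm)))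
  have hpb : PreservesLimitsOfShape WalkingCospan F := by
    refine ⟨fun {K} => ?_⟩
    have : PreservesLimit (cospan (K.map WalkingCospan.Hom.inl) (K.map WalkingCospan.Hom.inr)) F := by
      obtain ⟨P, p, q, h, hM⟩ := exists_pullback (K.map WalkingCospan.Hom.inl)
        (K.map WalkingCospan.Hom.inr)
      refine preservesLimit_of_preserves_limit_cone h.isLimit
        ((isLimitMapConePullbackConeEquiv F h.w).symm ?_)
      have h' : IsPullback (F.map p) (F.map q) (F.map (K.map WalkingCospan.Hom.inl))
          (F.map (K.map WalkingCospan.Hom.inr)) := by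
        refine Count.isPullback (fun u => ?_) fun a b hab => ?_
        · obtain ⟨u, rfl⟩ := (e _).surjective u
          rw [he, he, he, he, (hM M).1]
        · obtain ⟨a, rfl⟩ := (e _).surjective a
          obtain ⟨b, rfl⟩ := (e _).surjective b
          rw [he, he] at hab
          obtain ⟨u, ⟨rfl, rfl⟩, h3⟩ := (hM M).2 a b ((e _).injective hab)
          refine ⟨e _ u, ⟨he _ _, he _ _⟩, fun v hv => ?_⟩
          obtain ⟨v, rfl⟩ := (e _).surjective v
          rw [he, he] at hv
          rw [h3 v ⟨(e _).injective hv.1, (e _).injective hv.2⟩]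
      exact h'.isLimit
    exact preservesLimit_of_iso_diagram F (diagramIsoCospan K).symm
  refine ⟨?_, fun J _ => ?_, fun {E X} p q h => ?_⟩
  · have := preservesLimitsOfShape_pempty_of_preservesTerminal F
    exact preservesFiniteLimits_of_preservesTerminal_and_pullbacks F
  · have : ∀ A : J → ImSort T, PreservesColimit (Discrete.functor A) F := fun A => by
      obtain ⟨X, i, h⟩ := exists_coprod A
      refine preservesColimit_of_preserves_colimit_cocone (syn_isColimit_cofan i h).some
        ((isColimitMapCoconeCofanMkEquiv F _ _).symm (Count.isColimit_cofan _ fun a => ?_).some)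
      obtain ⟨a, rfl⟩ := (e _).surjective a
      obtain ⟨⟨j, s⟩, rfl, h2⟩ := h M a
      refine ⟨⟨j, e _ s⟩, he _ _, ?_⟩
      rintro ⟨j', s'⟩ hs
      obtain ⟨s', rfl⟩ := (e _).surjective s'
      change F.map _ _ = _ at hs
      rw [he] at hs
      cases h2 ⟨j', s'⟩ ((e _).injective hs)
      rfl
    refine ⟨fun {K} => ?_⟩
    exact preservesColimit_of_iso_diagram F (Discrete.natIsoFunctor (F := K)).symm
  · obtain ⟨Q, f, hQ⟩ := exists_quotient ((IsDef.graph p).symm.comp (IsDef.graph q)) h.equivalence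
    have w : p ≫ f = q ≫ f := syn_hom_ext fun M a => by
      rw [smap_comp, smap_comp]
      exact ((hQ M).2 _ _).2 ⟨a, rfl, rfl⟩
    refine preservesColimit_of_preserves_colimit_cocone
      (syn_isColimit_cofork w (fun M => (hQ M).1) fun M a b => ((hQ M).2 a b).1).some
      ((isColimitMapCoconeCoforkEquiv F w).symm (Count.isColimit_cofork _ ?_ ?_).some)
    · intro b
      obtain ⟨b, rfl⟩ := (e _).surjective b
      obtain ⟨a, rfl⟩ := (hQ M).1 b
      exact ⟨e _ a, he _ _⟩
    · intro a b hab
      obtain ⟨a, rfl⟩ := (e _).surjective a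
      obtain ⟨b, rfl⟩ := (e _).surjective b
      rw [he, he] at hab
      obtain ⟨u, rfl, rfl⟩ := ((hQ M).2 _ _).1 ((e _).injective hab)
      exact ⟨e _ u, he _ _, he _ _⟩


/-! ### The Borel space of morphisms of `Count` -/

namespace Count

/-- `k` lies in the source of `f` and is mapped to `l`. -/
def Maps (f : Arrow Count) (k l : ℕ) : Prop :=
  ∃ h : (k : ℕ∞) < f.left.size, (f.hom ⟨k, h⟩ : ℕ) = l

/-- Source, target and graph of a function. -/
def arrowCode (f : Arrow Count) : ℕ∞ × ℕ∞ × (ℕ → ℕ → Prop) :=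
  (f.left.size, f.right.size, fun k l => Maps f k l)

theorem arrowCode_injective : Function.Injective arrowCode := by
  rintro ⟨⟨m⟩, ⟨n⟩, f⟩ ⟨⟨m'⟩, ⟨n'⟩, f'⟩ h
  simp only [arrowCode, Prod.mk.injEq] at h
  obtain ⟨h1, h2, h⟩ := h
  change m = m' at h1
  change n = n' at h2
  subst h1 h2
  have hf : f = f' := funext fun a => Subtype.ext (by
    obtain ⟨_, h⟩ := (congrFun (congrFun h a.1) (f a)).mp ⟨a.2, rfl⟩
    exact h.symm)
  rw [hf]

theorem measurable_sigma {ι : Type} {X : ι → Type} [∀ i, MeasurableSpace (X i)] {β : Type}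
    [MeasurableSpace β] {g : (Σ i, X i) → β} (h : ∀ i, Measurable fun x : X i => g ⟨i, x⟩) :
    Measurable g := fun _ hs => MeasurableSpace.measurableSet_iInf.2 fun i => h i hs

theorem measurable_of_sigma {β : Type} [MeasurableSpace β] {g : Arrow Count → β}
    (h : ∀ M N : Count, Measurable fun f : M.El → N.El => g (Arrow.mk (X := M) (Y := N) f)) :
    Measurable g := by
  have h1 : Measurable fun s : Σ M : Count, Σ N : Count, (M.El → N.El) =>
      g (Arrow.mk (X := s.1) (Y := s.2.1) s.2.2) :=
    measurable_sigma fun M => measurable_sigma fun N => h M N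
  exact h1.comp (comap_measurable
    fun f : Arrow Count => (⟨f.left, f.right, f.hom⟩ : Σ M : Count, Σ N : Count, (M.El → N.El)))

theorem measurable_left : Measurable fun f : Arrow Count => f.left.size :=
  measurable_of_sigma fun M _ => measurable_const (a := M.size)

theorem measurable_right : Measurable fun f : Arrow Count => f.right.size :=
  measurable_of_sigma fun _ N => measurable_const (a := N.size)

theorem measurable_maps (k l : ℕ) : Measurable fun f : Arrow Count => Maps f k l := by
  refine measurable_of_sigma fun M N => ?_
  by_cases hk : (k : ℕ∞) < M.size
  · have h : Measurable fun f : M.El → N.El => (f ⟨k, hk⟩ : ℕ) = l :=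
      (measurable_from_top (f := fun n : ℕ => n = l)).comp
        (measurable_subtype_coe.comp (measurable_pi_apply _))
    exact h.congr_prop fun f => ⟨fun h => ⟨hk, h⟩, fun ⟨_, h⟩ => h⟩
  · exact (measurable_const (a := False)).congr_prop fun f => ⟨False.elim, fun ⟨h, _⟩ => hk h⟩

/-- Source and target take countably many values, so the space splits into countably many measurable
pieces. On each of them `f` takes values in a fixed countable product, where measurability is tested
coordinate by coordinate. -/
theorem measurable_to_arrow {α : Type} [MeasurableSpace α] {f : α → Arrow Count}
    (h1 : Measurable fun a => (f a).left.size) (h2 : Measurable fun a => (f a).right.size)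
    (h3 : ∀ k l, Measurable fun a => Maps (f a) k l) : Measurable f := by
  refine measurable_comap_iff.2 fun s hs => ?_
  have hs' : ∀ M N : Count, MeasurableSet {g : M.El → N.El |
      (⟨M, N, g⟩ : Σ M : Count, Σ N : Count, (M.El → N.El)) ∈ s} := fun M N =>
    MeasurableSpace.measurableSet_iInf.1 (MeasurableSpace.measurableSet_iInf.1 hs M) N
  let U : ℕ∞ × ℕ∞ → Set α := fun p => {a | (f a).left.size = p.1 ∧ (f a).right.size = p.2}
  have hU : ∀ p, MeasurableSet (U p) := fun p =>
    (h1 (measurableSet_singleton p.1)).inter (h2 (measurableSet_singleton p.2))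
  have key : ∀ p, MeasurableSet {a : U p | (⟨(f a).left, (f a).right, (f a).hom⟩ :
      Σ M : Count, Σ N : Count, (M.El → N.El)) ∈ s} := by
    intro p
    have hle : ∀ a : U p, (⟨p.1⟩ : Count) = (f a).left := fun a => Count.ext a.2.1.symm
    have hre : ∀ a : U p, (f a).right = (⟨p.2⟩ : Count) := fun a => Count.ext a.2.2
    let g : U p → ((⟨p.1⟩ : Count).El → (⟨p.2⟩ : Count).El) := fun a =>
      (eqToHom (hle a) ≫ (f a).hom ≫ eqToHom (hre a) : (⟨p.1⟩ : Count) ⟶ ⟨p.2⟩)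
    have hsig : ∀ a : U p, (⟨(f a).left, (f a).right, (f a).hom⟩ :
        Σ M : Count, Σ N : Count, (M.El → N.El)) = ⟨⟨p.1⟩, ⟨p.2⟩, g a⟩ := by
      intro a
      have : ∀ {M N M' N' : Count} (h : M' = M) (h' : N = N') (u : M ⟶ N),
          (⟨M, N, u⟩ : Σ M : Count, Σ N : Count, (M.El → N.El)) =
            ⟨M', N', (eqToHom h ≫ u ≫ eqToHom h' : M' ⟶ N')⟩ := by
        rintro M N _ _ rfl rfl u
        rfl
      exact this _ _ _
    have hval : ∀ (a : U p) (k : (⟨p.1⟩ : Count).El) (l : ℕ),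
        (g a k : ℕ) = l ↔ Maps (f a) k.1 l := by
      intro a k l
      have : ∀ {M N M' N' : Count} (h : M' = M) (h' : N = N') (u : M ⟶ N) (k : M'.El) (l : ℕ),
          (((eqToHom h ≫ u ≫ eqToHom h' : M' ⟶ N') k : N'.El) : ℕ) = l ↔
            Maps (Arrow.mk u) k.1 l := by
        rintro M N _ _ rfl rfl u k l
        exact ⟨fun h => ⟨k.2, h⟩, fun ⟨_, h⟩ => h⟩
      exact this _ _ _ k l
    have hg : Measurable g := by
      refine measurable_pi_lambda _ fun k => measurable_to_countable' fun l => ?_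
      have h4 : Measurable fun a : U p => Maps (f a) k.1 l.1 :=
        (h3 k.1 l.1).comp measurable_subtype_coe
      refine (measurableSet_setOfPred.2 h4).congr ?_
      ext a
      exact (hval a k l.1).symm.trans Subtype.ext_iff.symm
    refine (hg (hs' ⟨p.1⟩ ⟨p.2⟩)).congr ?_
    ext a
    exact iff_of_eq (congrArg (· ∈ s) (hsig a).symm)
  have h4 : MeasurableSet (⋃ p, Subtype.val '' {a : U p | (⟨(f a).left, (f a).right, (f a).hom⟩ :
      Σ M : Count, Σ N : Count, (M.El → N.El)) ∈ s}) :=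
    MeasurableSet.iUnion fun p => MeasurableSet.subtype_image (hU p) (key p)
  refine h4.congr ?_
  ext a
  simp only [Set.mem_iUnion]
  constructor
  · rintro ⟨p, a, h, rfl⟩
    exact h
  · intro h
    exact ⟨((f a).left.size, (f a).right.size), ⟨a, rfl, rfl⟩, h, rfl⟩

theorem measurable_arrowCode : Measurable arrowCode :=
  measurable_left.prodMk (measurable_right.prodMk
    (measurable_pi_lambda _ fun k => measurable_pi_lambda _ fun l => measurable_maps k l))

theorem range_arrowCode : Set.range arrowCode =
    {p | (∀ k l : ℕ, p.2.2 k l → (k : ℕ∞) < p.1 ∧ (l : ℕ∞) < p.2.1) ∧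
      (∀ k : ℕ, (k : ℕ∞) < p.1 → ∃ l : ℕ, p.2.2 k l) ∧
      ∀ k l l' : ℕ, p.2.2 k l → p.2.2 k l' → l = l'} := by
  ext ⟨m, n, r⟩
  constructor
  · rintro ⟨⟨M, N, f⟩, h⟩
    simp only [arrowCode, Prod.mk.injEq] at h
    obtain ⟨rfl, rfl, rfl⟩ := h
    refine ⟨?_, fun k h => ⟨_, h, rfl⟩, ?_⟩
    · rintro k l ⟨h, rfl⟩
      exact ⟨h, (f ⟨k, h⟩).2⟩
    · rintro k l l' ⟨h, rfl⟩ ⟨_, rfl⟩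
      rfl
  · rintro ⟨h1, h2, h3⟩
    choose u hu using h2
    let f : (⟨m⟩ : Count) ⟶ ⟨n⟩ := fun a => ⟨u a.1 a.2, (h1 _ _ (hu a.1 a.2)).2⟩
    refine ⟨Arrow.mk f, Prod.ext rfl (Prod.ext rfl ?_)⟩
    funext k l
    refine propext ⟨?_, fun h => ⟨(h1 k l h).1, h3 _ _ _ (hu k (h1 k l h).1) h⟩⟩
    rintro ⟨h, rfl⟩
    exact hu k h

/-- The given Borel structure coincides with the one pulled back along the injection `arrowCode`,
whose range is Borel. The result is needed to factor `ζ` through a Borel map. -/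
instance : StandardBorelSpace (Arrow Count) := by
  have h : (inferInstance : MeasurableSpace (Arrow Count)) =
      MeasurableSpace.comap arrowCode inferInstance := by
    refine le_antisymm ?_ measurable_arrowCode.comap_le
    have hc : @Measurable _ _ (MeasurableSpace.comap arrowCode inferInstance) _ arrowCode :=
      comap_measurable _
    have : @Measurable _ _ (MeasurableSpace.comap arrowCode inferInstance) _
        (id : Arrow Count → Arrow Count) := by
      let _ : MeasurableSpace (Arrow Count) := MeasurableSpace.comap arrowCode inferInstance
      exact measurable_to_arrow (measurable_fst.comp hc)
        (measurable_fst.comp (measurable_snd.comp hc)) fun k l =>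
          (measurable_pi_apply l).comp ((measurable_pi_apply k).comp
            (measurable_snd.comp (measurable_snd.comp hc)))
    exact fun s hs => this hs
  have h2 : @StandardBorelSpace (Arrow Count) (MeasurableSpace.comap arrowCode inferInstance) := by
    refine standardBorel_comap arrowCode arrowCode_injective ?_
    rw [range_arrowCode, measurableSet_setOfPred]
    have hr : ∀ k l, Measurable fun p : ℕ∞ × ℕ∞ × (ℕ → ℕ → Prop) => p.2.2 k l := fun k l =>
      (measurable_pi_apply l).comp ((measurable_pi_apply k).comp
        (measurable_snd.comp measurable_snd))
    have hlt : ∀ k : ℕ, Measurable fun s : ℕ∞ => (k : ℕ∞) < s := fun k => measurable_from_top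
    have hl1 : ∀ k : ℕ, Measurable fun p : ℕ∞ × ℕ∞ × (ℕ → ℕ → Prop) => (k : ℕ∞) < p.1 :=
      fun k => (hlt k).comp measurable_fst
    have hl2 : ∀ k : ℕ, Measurable fun p : ℕ∞ × ℕ∞ × (ℕ → ℕ → Prop) => (k : ℕ∞) < p.2.1 :=
      fun k => (hlt k).comp (measurable_fst.comp measurable_snd)
    refine Measurable.and ?_ (Measurable.and ?_ ?_)
    · exact Measurable.forall fun k => Measurable.forall fun l =>
        (hr k l).imp ((hl1 k).and (hl2 l))
    · exact Measurable.forall fun k => (hl1 k).imp (Measurable.exists fun l => hr k l)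
    · exact Measurable.forall fun k => Measurable.forall fun l => Measurable.forall fun l' =>
        (hr k l).imp ((hr k l').imp measurable_const)
  rw [← h] at h2
  exact h2

theorem enat_eq_of_forall_lt {a b : ℕ∞} (h : ∀ k : ℕ, (k : ℕ∞) < a ↔ (k : ℕ∞) < b) : a = b := by
  refine le_antisymm (not_lt.1 fun hl => ?_) (not_lt.1 fun hl => ?_)
  · lift b to ℕ using ne_top_of_lt hl
    exact lt_irrefl _ ((h b).1 hl)
  · lift a to ℕ using ne_top_of_lt hl
    exact lt_irrefl _ ((h a).2 hl)

/-- `ℕ∞` is countable, and an element of it is determined by the naturals strictly below it. -/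
theorem measurable_size {α : Type} [MeasurableSpace α] {f : α → ℕ∞}
    (h : ∀ k : ℕ, Measurable fun a => (k : ℕ∞) < f a) : Measurable f := by
  refine measurable_to_countable' fun s => ?_
  have h1 : Measurable fun a => ∀ k : ℕ, (k : ℕ∞) < f a ↔ (k : ℕ∞) < s :=
    Measurable.forall fun k => (h k).iff measurable_const
  refine (measurableSet_setOfPred.2 h1).congr ?_
  ext a
  refine ⟨fun h => ?_, ?_⟩
  · exact enat_eq_of_forall_lt h
  · rintro rfl k
    rfl

theorem measurable_lt {α : Type} [MeasurableSpace α] {f : α → ℕ∞} (h : Measurable f) (k : ℕ) :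
    Measurable fun a => (k : ℕ∞) < f a :=
  (measurable_from_top (f := fun s : ℕ∞ => (k : ℕ∞) < s)).comp h

end Count

/-! ### Numbering of a set of natural numbers -/

section Rank

open Classical in
-- Numbering each element of a set of naturals by how many elements precede it runs exactly through
-- the initial segment of length the cardinality of the set, finite or not.
theorem lt_encard_iff {P : ℕ → Prop} {k : ℕ} :
    (k : ℕ∞) < Set.encard {n | P n} ↔ ∃ n, P n ∧ Nat.count P n = k := by
  constructor
  · intro h
    have h' : ∀ hf : {n | P n}.Finite, k < hf.toFinset.card := fun hf => by
      rw [hf.encard_eq_coe_toFinset_card] at h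
      exact_mod_cast h
    exact ⟨Nat.nth P k, Nat.nth_mem k h', Nat.count_nth h'⟩
  · rintro ⟨n, hn, rfl⟩
    by_cases hf : {n | P n}.Finite
    · rw [hf.encard_eq_coe_toFinset_card]
      exact_mod_cast Nat.count_lt_card hf hn
    · rw [Set.encard_eq_top hf]
      exact ENat.natCast_lt_top _

variable {Q : Type} (m : Q → ℕ)

/-- The object of `Count` in bijection with the range of `m`. -/
noncomputable def rankCount : Count := ⟨Set.encard {k | ∃ a, m a = k}⟩

open Classical in
/-- An injective function to `ℕ` induces a bijection with an object of `Count`. -/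
noncomputable def rankEquiv (hm : Function.Injective m) : Q ≃ (rankCount m).El :=
  Equiv.ofBijective (fun a => ⟨Nat.count (fun k => ∃ a, m a = k) (m a),
      lt_encard_iff.2 ⟨m a, ⟨a, rfl⟩, rfl⟩⟩) (by
    constructor
    · intro a b h
      exact hm (Nat.count_injective ⟨a, rfl⟩ ⟨b, rfl⟩ (congrArg Subtype.val h))
    · rintro ⟨k, hk⟩
      obtain ⟨_, ⟨a, rfl⟩, h⟩ := lt_encard_iff.1 hk
      exact ⟨a, Subtype.ext h⟩)

open Classical in
theorem rankEquiv_val (hm : Function.Injective m) (a : Q) :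
    (rankEquiv m hm a : ℕ) = Nat.count (fun k => ∃ a, m a = k) (m a) := rfl

/-- If the range of `m` is an initial segment, the bijection is `m` itself. -/
theorem rankEquiv_val_of_initial (hm : Function.Injective m) {s : ℕ∞}
    (h : ∀ k : ℕ, (∃ a, m a = k) ↔ (k : ℕ∞) < s) (a : Q) : (rankEquiv m hm a : ℕ) = m a := by
  classical
  rw [rankEquiv_val]
  refine Nat.count_iff_forall.2 fun k hk => (h k).2 ?_
  exact (Nat.cast_lt.2 hk).trans ((h _).1 ⟨a, rfl⟩)

theorem rankCount_of_initial {s : ℕ∞} (h : ∀ k : ℕ, (∃ a, m a = k) ↔ (k : ℕ∞) < s) :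
    rankCount m = ⟨s⟩ := by
  classical
  refine Count.ext (Count.enat_eq_of_forall_lt fun k => ?_)
  change (k : ℕ∞) < Set.encard {k | ∃ a, m a = k} ↔ _
  have hc : ∀ n : ℕ, (n : ℕ∞) < s → Nat.count (fun k => ∃ a, m a = k) n = n := fun n hn =>
    Nat.count_iff_forall.2 fun k hk => (h k).2 ((Nat.cast_lt.2 hk).trans hn)
  rw [lt_encard_iff (P := fun k => ∃ a, m a = k)]
  constructor
  · rintro ⟨n, hn, rfl⟩
    rw [h] at hn
    rwa [hc n hn]
  · intro hk
    exact ⟨k, (h k).2 hk, hc k hk⟩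

end Rank


/-! ### Isomorphisms of structures and imaginary sorts -/

theorem Str.sat_iso {L : RelLang} {M N : Str L} (g : Str.Iso M N) {n : ℕ} (φ : Formula L n) :
    ∀ v : Fin n → M.dom.El, N.Sat φ (g.equiv ∘ v) ↔ M.Sat φ v := by
  have hsnoc : ∀ {n : ℕ} (v : Fin n → M.dom.El) (a : M.dom.El),
      Fin.snoc (α := fun _ => N.dom.El) (g.equiv ∘ v) (g.equiv a) =
        g.equiv ∘ Fin.snoc (α := fun _ => M.dom.El) v a := fun v a => by
    funext i
    refine Fin.lastCases ?_ (fun i => ?_) i <;> simp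
  induction φ with
  | rel R x => exact fun v => g.map_rel R (v ∘ x)
  | eq i j => exact fun v => g.equiv.injective.eq_iff
  | neg φ ih => exact fun v => not_congr (ih v)
  | conj I φ ih => exact fun v => forall_congr' fun i => ih i v
  | disj I φ ih => exact fun v => exists_congr fun i => ih i v
  | all φ ih =>
    intro v
    refine Iff.trans ?_ (forall_congr' fun a => ih (Fin.snoc (α := fun _ => M.dom.El) v a))
    refine g.equiv.symm.forall_congr_left.trans (forall_congr' fun a => ?_)
    rw [← hsnoc]
    rfl
  | ex φ ih =>
    intro v
    refine Iff.trans ?_ (exists_congr fun a => ih (Fin.snoc (α := fun _ => M.dom.El) v a))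
    refine g.equiv.symm.exists_congr_left.trans (exists_congr fun a => ?_)
    rw [← hsnoc]
    rfl

section Num

variable {T : Theory} {A B : ImSort T} {M N P : Model T}

/-- The bijection underlying an isomorphism of models. -/
def Model.homEquiv (g : M ⟶ N) : M.str.dom.El ≃ N.str.dom.El := Str.Iso.equiv g

theorem Model.sat_hom (g : M ⟶ N) {n : ℕ} (φ : Formula T.L n) (v : Fin n → M.str.dom.El) :
    N.str.Sat φ (Model.homEquiv g ∘ v) ↔ M.str.Sat φ v := Str.sat_iso g φ v

theorem append_comp {D E : Type} (g : D → E) {n k : ℕ} (a : Fin n → D) (b : Fin k → D) :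
    Fin.append (g ∘ a) (g ∘ b) = g ∘ Fin.append a b := by
  funext i
  refine Fin.addCases (fun i => ?_) (fun i => ?_) i <;> simp

/-- The action of isomorphisms of models on points. -/
def Pt.map (g : M ⟶ N) (p : Pt M A) : Pt N A :=
  ⟨p.i, Model.homEquiv g ∘ p.x, (Model.sat_hom g _ _).2 p.sat⟩

/-- The action of isomorphisms of models on the interpretation of imaginary sorts. -/
def gmap (g : M ⟶ N) : Sem M A → Sem N A :=
  Quotient.map (Pt.map g) fun p q h => by
    change N.str.Sat _ (Fin.append (Model.homEquiv g ∘ p.x) (Model.homEquiv g ∘ q.x))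
    rw [append_comp]
    exact (Model.sat_hom g _ _).2 h

theorem gmap_cls (g : M ⟶ N) (p : Pt M A) : gmap g p.cls = (p.map g).cls := rfl

theorem gmap_id (a : Sem M A) : gmap (𝟙 M) a = a := by
  obtain ⟨p, rfl⟩ := Pt.cls_surj a
  rfl

theorem gmap_comp (g : M ⟶ N) (h : N ⟶ P) (a : Sem M A) : gmap (g ≫ h) a = gmap h (gmap g a) := by
  obtain ⟨p, rfl⟩ := Pt.cls_surj a
  rfl

theorem gmap_smap (g : M ⟶ N) (f : A ⟶ B) (a : Sem M A) :
    gmap g (smap M f a) = smap N f (gmap g a) := by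
  obtain ⟨p, rfl⟩ := Pt.cls_surj a
  obtain ⟨q, hq⟩ := Pt.cls_surj (smap M f p.cls)
  rw [← hq]
  induction f using Quotient.ind with | _ F
  refine ((smap_mk N (F := F) (p := p.map g) (q := q.map g)).2 ?_).symm
  change N.str.Sat _ (Fin.append (Model.homEquiv g ∘ p.x) (Model.homEquiv g ∘ q.x))
  rw [append_comp]
  exact (Model.sat_hom g _ _).2 ((smap_mk M).1 hq.symm)

theorem hval_gmap (g : M ⟶ N) (a : Sem M (homeSort T)) :
    hval (gmap g a) = Model.homEquiv g (hval a) := by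
  obtain ⟨p, rfl⟩ := Pt.cls_surj a
  rfl

/-! ### Numbering the elements of imaginary sorts -/

/-- A name of a possible point of `⨆ᵢ αᵢ`, in a model on an initial segment of `ℕ`. -/
abbrev Key (A : ImSort T) : Type := Σ i : A.I, Fin (A.n i) → ℕ

/-- The name of a point. -/
def Pt.key (p : Pt M A) : Key A := ⟨p.i, fun j => p.x j⟩

theorem Pt.key_injective : Function.Injective (Pt.key (M := M) (A := A)) := by
  rintro ⟨i, x, h⟩ ⟨j, y, h'⟩ hk
  obtain ⟨rfl, hk⟩ := Sigma.mk.inj_iff.1 hk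
  obtain rfl : x = y := funext fun k => Subtype.ext (congrFun (eq_of_heq hk) k)
  rfl

open Classical in
/-- A numbering of names; the elements of the home sort are their own numbers. -/
noncomputable def code (A : ImSort T) : Key A → ℕ :=
  -- The test is for equality of imaginary sorts. This special case is what makes `L ∘ K` equal to
  -- the identity, and not merely isomorphic to it.
  if h : A = homeSort T then fun s => cast (congrArg Key h) s |>.2 (0 : Fin 1)
  else (Countable.exists_injective_nat (Key A)).choose

theorem code_homeSort (s : Key (homeSort T)) : code (homeSort T) s = s.2 (0 : Fin 1) := by
  simp only [code, dif_pos]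
  rfl

theorem code_injective (A : ImSort T) : Function.Injective (code A) := by
  by_cases h : A = homeSort T
  · subst h
    rintro ⟨⟨i, hi⟩, x⟩ ⟨⟨j, hj⟩, y⟩ h
    rw [code_homeSort, code_homeSort] at h
    obtain rfl : i = 0 := hi
    obtain rfl : j = 0 := hj
    obtain rfl : x = y := funext fun k => by
      have := Subsingleton.elim (α := Fin 1) k 0
      subst this
      exact h
    rfl
  · simp only [code, dif_neg h]
    exact (Countable.exists_injective_nat (Key A)).choose_spec

/-- The least number of a name of an element. -/
noncomputable def minCode (M : Model T) (A : ImSort T) (a : Sem M A) : ℕ :=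
  sInf {k | ∃ p : Pt M A, p.cls = a ∧ code A p.key = k}

theorem exists_minCode (a : Sem M A) : ∃ p : Pt M A, p.cls = a ∧ code A p.key = minCode M A a := by
  obtain ⟨p, hp⟩ := Pt.cls_surj a
  exact Nat.sInf_mem (s := {k | ∃ p : Pt M A, p.cls = a ∧ code A p.key = k}) ⟨_, p, hp, rfl⟩

theorem minCode_le (p : Pt M A) : minCode M A p.cls ≤ code A p.key :=
  Nat.sInf_le ⟨p, rfl, rfl⟩

theorem minCode_injective : Function.Injective (minCode M A) := by
  intro a b h
  obtain ⟨p, rfl, hp⟩ := exists_minCode a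
  obtain ⟨q, rfl, hq⟩ := exists_minCode b
  rw [Pt.key_injective (code_injective A (hp.trans (h.trans hq.symm)))]

theorem minCode_homeSort (a : Sem M (homeSort T)) : minCode M (homeSort T) a = hval a := by
  obtain ⟨p, rfl, hp⟩ := exists_minCode a
  rw [← hp, code_homeSort]
  rfl

/-- The bijection between the interpretation of an imaginary sort and an object of `Count`. -/
noncomputable def num (M : Model T) (A : ImSort T) : Sem M A ≃ (rankCount (minCode M A)).El :=
  rankEquiv _ minCode_injective

theorem minCode_homeSort_iff (k : ℕ) :
    (∃ a, minCode M (homeSort T) a = k) ↔ (k : ℕ∞) < M.str.dom.size := by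
  constructor
  · rintro ⟨a, rfl⟩
    rw [minCode_homeSort]
    exact (hval a).2
  · intro h
    obtain ⟨a, ha⟩ := hval_surjective (M := M) ⟨k, h⟩
    exact ⟨a, by rw [minCode_homeSort, ha]⟩

/-- The least numbers of elements of the home sort are the elements of the model, which already form
an initial segment, so ranking changes nothing. This is an equality of objects of `Count`. -/
theorem rankCount_homeSort : rankCount (minCode M (homeSort T)) = M.str.dom :=
  rankCount_of_initial _ minCode_homeSort_iff

theorem num_homeSort (a : Sem M (homeSort T)) : (num M (homeSort T) a : ℕ) = hval a :=
  (rankEquiv_val_of_initial _ minCode_injective minCode_homeSort_iff a).trans (minCode_homeSort a)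

/-! ### The coherent functor given by a model -/

namespace Model

/-- Interpretation of imaginary sorts in a model, with values in `Count`. -/
noncomputable def functor (M : Model T) : ImSort T ⥤ Count where
  obj A := rankCount (minCode M A)
  map {A B} f := fun k => num M B (smap M f ((num M A).symm k))
  map_id A := funext fun k => by
    simp only [smap_id, Equiv.apply_symm_apply]
    rfl
  map_comp f g := funext fun k => by
    simp only [smap_comp]
    exact congrArg _ (congrArg _ (Equiv.symm_apply_apply _ _).symm)

theorem functor_map_num (M : Model T) (f : A ⟶ B) (a : Sem M A) :
    M.functor.map f (num M A a) = num M B (smap M f a) :=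
  congrArg (fun a => num M B (smap M f a)) ((num M A).symm_apply_apply a)

/-- The natural transformation given by an isomorphism of models. -/
noncomputable def trans (g : M ⟶ N) : M.functor ⟶ N.functor where
  app A := fun k => num N A (gmap g ((num M A).symm k))
  naturality A B f := funext fun k => by
    obtain ⟨a, rfl⟩ := (num M A).surjective k
    change num N B (gmap g ((num M B).symm (M.functor.map f (num M A a)))) =
      N.functor.map f (num N A (gmap g ((num M A).symm (num M A a))))
    rw [functor_map_num, functor_map_num, Equiv.symm_apply_apply, Equiv.symm_apply_apply, gmap_smap]

theorem trans_num (g : M ⟶ N) (a : Sem M A) :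
    (trans g).app A (num M A a) = num N A (gmap g a) :=
  congrArg (fun a => num N A (gmap g a)) ((num M A).symm_apply_apply a)

theorem trans_id (M : Model T) : trans (𝟙 M) = 𝟙 M.functor :=
  NatTrans.ext (funext fun A => funext fun k => by
    obtain ⟨a, rfl⟩ := (num M A).surjective k
    rw [trans_num, gmap_id]
    rfl)

theorem trans_comp (g : M ⟶ N) (h : N ⟶ P) : trans (g ≫ h) = trans g ≫ trans h :=
  NatTrans.ext (funext fun A => funext fun k => by
    obtain ⟨a, rfl⟩ := (num M A).surjective k
    refine (trans_num _ _).trans ?_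
    change _ = (trans h).app A ((trans g).app A (num M A a))
    rw [trans_num, trans_num, gmap_comp])

/-- The functor from models to coherent functors. -/
noncomputable def toCoh (T : Theory) : Model T ⥤ CohFun (ImSort T) Count where
  obj M := ⟨M.functor, isCoherent_of_sem M M.functor (num M) M.functor_map_num⟩
  map g := ⟨⟨trans g, trans (Groupoid.inv g),
    by rw [← trans_comp, Groupoid.comp_inv, trans_id],
    by rw [← trans_comp, Groupoid.inv_comp, trans_id]⟩⟩
  map_id M := CohFun.hom_ext fun A => congrFun (congrArg NatTrans.app (trans_id M)) A
  map_comp g h := CohFun.hom_ext fun A => congrFun (congrArg NatTrans.app (trans_comp g h)) A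

end Model

/-! ### Borelness of the interpretation of imaginary sorts -/

/-- `v` is a tuple of elements of `M` satisfying `φ`. -/
def Model.SatN (M : Model T) {n : ℕ} (φ : Formula T.L n) (v : Fin n → ℕ) : Prop :=
  ∃ h : ∀ i, (v i : ℕ∞) < M.str.dom.size, M.str.Sat φ fun i => ⟨v i, h i⟩

theorem Model.measurable_satN {n : ℕ} (φ : Formula T.L n) (v : Fin n → ℕ) :
    Measurable fun M : Model T => M.SatN φ v :=
  (Str.measurable_sat φ v).comp Model.measurable_str

theorem Model.satN_append {n k : ℕ} {φ : Formula T.L (n + k)} {v : Fin n → ℕ} {w : Fin k → ℕ} :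
    M.SatN φ (Fin.append v w) ↔ ∃ (x : Fin n → M.str.dom.El) (y : Fin k → M.str.dom.El),
      (fun i => (x i : ℕ)) = v ∧ (fun i => (y i : ℕ)) = w ∧ M.str.Sat φ (Fin.append x y) := by
  constructor
  · rintro ⟨h, h'⟩
    refine ⟨fun i => ⟨v i, ?_⟩, fun i => ⟨w i, ?_⟩, rfl, rfl, ?_⟩
    · simpa using h (Fin.castAdd k i)
    · simpa using h (Fin.natAdd n i)
    · convert h'
      rename_i i
      refine Fin.addCases (fun i => ?_) (fun i => ?_) i <;> simp
  · rintro ⟨x, y, rfl, rfl, h⟩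
    have : ∀ i, Fin.append (fun i => (x i : ℕ)) (fun i => (y i : ℕ)) i =
        ((Fin.append x y i : M.str.dom.El) : ℕ) :=
      fun i => congrFun (append_comp (Subtype.val : M.str.dom.El → ℕ) x y) i
    refine ⟨fun i => (this i).symm ▸ (Fin.append x y i).2, ?_⟩
    convert h
    exact this _

/-- `s` and `t` name equivalent points in `M`. -/
def EqvN (M : Model T) (s t : Key A) : Prop :=
  M.SatN (A.ε s.1 t.1) (Fin.append s.2 t.2)

/-- For fixed names this is satisfaction of a fixed formula at a fixed tuple of naturals, which is
Borel in `M`. The conditions below arise from it by quantifying over names, a countable set that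
does not depend on `M`. -/
theorem measurable_eqvN (s t : Key A) : Measurable fun M : Model T => EqvN M s t :=
  Model.measurable_satN _ _

theorem eqvN_iff {s t : Key A} :
    EqvN M s t ↔ ∃ p q : Pt M A, p.key = s ∧ q.key = t ∧ p.cls = q.cls := by
  constructor
  · intro h
    obtain ⟨i, v⟩ := s
    obtain ⟨j, w⟩ := t
    obtain ⟨x, y, hx, hy, h'⟩ := Model.satN_append.1 h
    dsimp only at x y hx hy h'
    subst hx hy
    exact ⟨⟨i, x, (eps_dom M h').1⟩, ⟨j, y, (eps_dom M h').2⟩, rfl, rfl, Pt.cls_eq.2 h'⟩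
  · rintro ⟨p, q, rfl, rfl, h⟩
    exact Model.satN_append.2 ⟨p.x, q.x, rfl, rfl, Pt.cls_eq.1 h⟩

/-- `s` names a point of `M` whose class has least number `c`. -/
def MinN (M : Model T) (s : Key A) (c : ℕ) : Prop :=
  (∃ t, EqvN M s t ∧ code A t = c) ∧ ∀ t, EqvN M s t → c ≤ code A t

theorem measurable_minN (s : Key A) (c : ℕ) : Measurable fun M : Model T => MinN M s c :=
  (Measurable.exists fun t => (measurable_eqvN s t).and measurable_const).and
    (Measurable.forall fun t => (measurable_eqvN s t).imp measurable_const)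

theorem minN_iff {s : Key A} {c : ℕ} :
    MinN M s c ↔ ∃ p : Pt M A, p.key = s ∧ minCode M A p.cls = c := by
  constructor
  · rintro ⟨⟨t, h, rfl⟩, h'⟩
    obtain ⟨p, q, rfl, rfl, hpq⟩ := eqvN_iff.1 h
    refine ⟨p, rfl, le_antisymm (hpq ▸ minCode_le q) ?_⟩
    obtain ⟨r, hr, hr'⟩ := exists_minCode p.cls
    rw [← hr']
    exact h' _ (eqvN_iff.2 ⟨p, r, rfl, rfl, hr.symm⟩)
  · rintro ⟨p, rfl, rfl⟩
    obtain ⟨r, hr, hr'⟩ := exists_minCode p.cls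
    refine ⟨⟨r.key, eqvN_iff.2 ⟨p, r, rfl, rfl, hr.symm⟩, hr'⟩, fun t ht => ?_⟩
    obtain ⟨p', q, hp, rfl, hq⟩ := eqvN_iff.1 ht
    obtain rfl := Pt.key_injective hp
    rw [hq]
    exact minCode_le q

theorem measurable_minCode (k : ℕ) : Measurable fun M : Model T => ∃ a, minCode M A a = k := by
  refine (Measurable.exists fun s : Key A => measurable_minN s k).congr_prop fun M => ?_
  simp only [minN_iff]
  constructor
  · rintro ⟨_, p, -, h⟩
    exact ⟨_, h⟩
  · rintro ⟨a, h⟩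
    obtain ⟨p, rfl⟩ := Pt.cls_surj a
    exact ⟨_, p, rfl, h⟩

open Classical in
theorem measurable_count {α : Type} [MeasurableSpace α] {P : α → ℕ → Prop}
    (hP : ∀ k, Measurable fun a => P a k) (c : ℕ) : Measurable fun a => Nat.count (P a) c := by
  induction c with
  | zero => simpa only [Nat.count_zero] using measurable_const
  | succ c ih =>
    simp only [Nat.count_succ]
    exact ih.add (Measurable.ite (measurableSet_setOfPred.2 (hP c)) measurable_const
      measurable_const)

/-- `s` names a point of `M` whose class has number `k`. -/
def RankN (M : Model T) (s : Key A) (k : ℕ) : Prop :=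
  ∃ p : Pt M A, p.key = s ∧ (num M A p.cls : ℕ) = k

/-- The number of a class is the count of least numbers below its own least number `c`. That count
is Borel for each fixed `c`, and there are countably many values of `c` to try. -/
theorem measurable_rankN (s : Key A) (k : ℕ) : Measurable fun M : Model T => RankN M s k := by
  classical
  refine (Measurable.exists fun c => (measurable_minN s c).and
    ((measurable_from_top (f := fun j => j = k)).comp
      (measurable_count (measurable_minCode (A := A)) c))).congr_prop fun M => ?_
  simp only [minN_iff]
  constructor
  · rintro ⟨_, ⟨p, hp, rfl⟩, h⟩
    exact ⟨p, hp, (rankEquiv_val _ minCode_injective _).trans h⟩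
  · rintro ⟨p, hp, h⟩
    exact ⟨_, ⟨p, hp, rfl⟩, (rankEquiv_val _ minCode_injective _).symm.trans h⟩

theorem exists_rankN_iff {k : ℕ} :
    (∃ s : Key A, RankN M s k) ↔ (k : ℕ∞) < (M.functor.obj A).size := by
  constructor
  · rintro ⟨_, p, -, rfl⟩
    exact (num M A p.cls).2
  · intro h
    obtain ⟨a, ha⟩ := (num M A).surjective ⟨k, h⟩
    obtain ⟨p, rfl⟩ := Pt.cls_surj a
    exact ⟨p.key, p, rfl, congrArg Subtype.val ha⟩

theorem measurable_functor_obj (A : ImSort T) :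
    Measurable fun M : Model T => (M.functor.obj A).size :=
  Count.measurable_size fun _ => (Measurable.exists fun s : Key A =>
    measurable_rankN s _).congr_prop fun _ => exists_rankN_iff

/-- The map sends `k` to `l` when some names of `k` and `l` satisfy the corresponding formula of a
representative of `f`, a condition quantified over countably many names. -/
theorem measurable_functor_map (f : A ⟶ B) :
    Measurable fun M : Model T => Arrow.mk (M.functor.map f) := by
  refine Count.measurable_to_arrow (measurable_functor_obj A) (measurable_functor_obj B)
    fun k l => ?_
  induction f using Quotient.ind with | _ F
  refine (Measurable.exists fun s : Key A => Measurable.exists fun t : Key B =>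
    (measurable_rankN s k).and ((measurable_rankN t l).and
      (Model.measurable_satN (F.φ s.1 t.1) (Fin.append s.2 t.2)))).congr_prop fun M => ?_
  constructor
  · rintro ⟨_, _, ⟨p, rfl, rfl⟩, ⟨q, rfl, rfl⟩, h⟩
    refine ⟨(num M A p.cls).2, congrArg Subtype.val ((M.functor_map_num _ p.cls).trans ?_)⟩
    refine congrArg _ ((smap_mk M).2 ?_)
    obtain ⟨x, y, hx, hy, h⟩ := Model.satN_append.1 h
    obtain rfl : x = p.x := funext fun k => Subtype.ext (congrFun hx k)
    obtain rfl : y = q.x := funext fun k => Subtype.ext (congrFun hy k)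
    exact h
  · rintro ⟨h, rfl⟩
    obtain ⟨a, ha⟩ := (num M A).surjective ⟨k, h⟩
    obtain ⟨p, rfl⟩ := Pt.cls_surj a
    obtain ⟨q, hq⟩ := Pt.cls_surj (smap M (Quotient.mk _ F : A ⟶ B) p.cls)
    refine ⟨p.key, q.key, ⟨p, rfl, congrArg Subtype.val ha⟩, ⟨q, rfl, ?_⟩,
      Model.satN_append.2 ⟨_, _, rfl, rfl, (smap_mk M).1 hq.symm⟩⟩
    refine congrArg Subtype.val ?_
    rw [hq]
    exact (M.functor_map_num _ _).symm.trans (congrArg _ ha)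

/-- An isomorphism keeps the index of a point and moves its entries, so its graph is described by
two names with the same index whose entries correspond. -/
theorem measurable_trans (A : ImSort T) :
    Measurable fun g : Arrow (Model T) => Arrow.mk ((Model.trans g.hom).app A) := by
  refine Count.measurable_to_arrow ((measurable_functor_obj A).comp Model.measurable_src)
    ((measurable_functor_obj A).comp Model.measurable_tgt) fun k l => ?_
  refine (Measurable.exists fun i : A.I => Measurable.exists fun x : Fin (A.n i) → ℕ =>
    Measurable.exists fun y : Fin (A.n i) → ℕ =>
      ((measurable_rankN (A := A) ⟨i, x⟩ k).comp Model.measurable_src).and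
      (((measurable_rankN (A := A) ⟨i, y⟩ l).comp Model.measurable_tgt).and
        (Measurable.forall fun j => Model.measurable_maps (x j) (y j)))).congr_prop fun g => ?_
  obtain ⟨M, N, g⟩ := g
  change M ⟶ N at g
  constructor
  · rintro ⟨i, x, y, ⟨p, hp, rfl⟩, ⟨q, hq, rfl⟩, h⟩
    refine ⟨(num M A p.cls).2, congrArg Subtype.val ((Model.trans_num g p.cls).trans ?_)⟩
    refine congrArg _ ?_
    rw [gmap_cls]
    refine congrArg _ (Pt.key_injective ?_)
    obtain ⟨i, x, hx⟩ := p
    obtain ⟨rfl, hp⟩ := Sigma.mk.inj_iff.1 hp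
    obtain rfl := eq_of_heq hp
    rw [hq]
    refine Sigma.ext rfl (heq_of_eq (funext fun j => ?_))
    obtain ⟨_, h⟩ := h j
    exact h
  · rintro ⟨h, rfl⟩
    obtain ⟨a, ha⟩ := (num M A).surjective ⟨k, h⟩
    obtain ⟨p, rfl⟩ := Pt.cls_surj a
    refine ⟨p.i, fun j => p.x j, fun j => (p.map g).x j, ⟨p, rfl, congrArg Subtype.val ha⟩,
      ⟨p.map g, rfl, ?_⟩, fun j => ⟨(p.x j).2, rfl⟩⟩
    refine congrArg Subtype.val ?_
    rw [← gmap_cls, ← Model.trans_num, ha]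
    rfl

end Num

end Lw1w

namespace Lw1w

open Formula Limits

section Coh

variable {T : Theory}

/-! ### Covers and images under coherent functors -/

/-- Coherence speaks only of quotients by equivalence relations. This lets it be applied to a
surjection, viewed as the quotient by its kernel pair. -/
theorem isEqRel_kernelPair {E X Y : ImSort T} {p q : E ⟶ X} {f : X ⟶ Y}
    (h : IsPullback p q f f) : IsEqRel p q where
  mono := by
    have : HasBinaryProducts (ImSort T) := hasBinaryProducts_of_hasTerminal_and_pullbacks _
    refine ⟨_, prodIsProd X X, prod.lift p q, ⟨fun u v huv => h.hom_ext ?_ ?_⟩,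
      prod.lift_fst p q, prod.lift_snd p q⟩
    · simpa only [Category.assoc, prod.lift_fst] using congrArg (· ≫ prod.fst) huv
    · simpa only [Category.assoc, prod.lift_snd] using congrArg (· ≫ prod.snd) huv
  refl := ⟨h.lift (𝟙 X) (𝟙 X) rfl, h.lift_fst _ _ _, h.lift_snd _ _ _⟩
  symm := ⟨h.lift q p h.w.symm, h.lift_fst _ _ _, h.lift_snd _ _ _⟩
  trans := by
    have hW := IsPullback.of_hasPullback q p
    refine ⟨_, _, _, hW, h.lift (pullback.fst q p ≫ p) (pullback.snd q p ≫ q) ?_,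
      h.lift_fst _ _ _, h.lift_snd _ _ _⟩
    rw [Category.assoc, Category.assoc, h.w, ← Category.assoc, hW.w, Category.assoc, h.w]

namespace CohFun

variable (F : CohFun (ImSort T) Count) {A B C : ImSort T}

theorem map_comp_apply (f : A ⟶ B) (g : B ⟶ C) (a : (F.functor.obj A).El) :
    F.functor.map (f ≫ g) a = F.functor.map g (F.functor.map f a) :=
  congrFun (F.functor.map_comp f g) a

/-- A map that is surjective in all models is the coequalizer of its kernel pair. `F` preserves this
coequalizer, and coequalizers in `Count` are surjective. -/
theorem surjective_of_sem {f : A ⟶ B} (h : ∀ M : Model T, Function.Surjective (smap M f)) :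
    Function.Surjective (F.functor.map f) := by
  obtain ⟨E, p, q, hE, hM⟩ := exists_pullback f f
  have := F.coh.quot p q (isEqRel_kernelPair hE)
  obtain ⟨hc⟩ := syn_isColimit_cofork hE.w h fun M a b hab => ((hM M).2 a b hab).exists
  exact Count.surjective_of_isColimit_cofork
    (isColimitCoforkMapOfIsColimit F.functor hE.w hc)

/-- A countable cover is a surjection from a coproduct, and `F` preserves both. This is how
existential statements true in all models pass to `F`. -/
theorem exists_of_sem_cover {J : Type} [Countable J] {B : J → ImSort T} (u : ∀ j, B j ⟶ A)
    (h : ∀ (M : Model T) a, ∃ j b, smap M (u j) b = a) (a : (F.functor.obj A).El) :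
    ∃ j b, F.functor.map (u j) b = a := by
  obtain ⟨X, i, hX⟩ := exists_coprod B
  obtain ⟨hc⟩ := syn_isColimit_cofan i hX
  have hi : ∀ j, i j ≫ Cofan.IsColimit.desc hc u = u j := fun j => Cofan.IsColimit.fac hc u j
  have hs : ∀ M : Model T, Function.Surjective (smap M (Cofan.IsColimit.desc hc u)) :=
    fun M a => by
      obtain ⟨j, b, rfl⟩ := h M a
      exact ⟨smap M (i j) b, by rw [← smap_comp, hi]⟩
  obtain ⟨x, rfl⟩ := F.surjective_of_sem hs a
  have := F.coh.coprod J
  obtain ⟨j, b, rfl⟩ := Count.exists_of_isColimit_cofan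
    (isColimitCofanMkObjOfIsColimit F.functor _ _ hc) x
  exact ⟨j, b, by rw [← F.map_comp_apply, hi]⟩

theorem isPullback_map {P : ImSort T} {p : P ⟶ A} {q : P ⟶ B} {f : A ⟶ C} {g : B ⟶ C}
    (h : IsPullback p q f g) :
    IsPullback (F.functor.map p) (F.functor.map q) (F.functor.map f) (F.functor.map g) := by
  have := F.coh.finLim
  exact h.map F.functor

/-- Pulling the family back along `v` gives a cover of `W`, to which the previous result applies. -/
theorem exists_of_sem_cover_image {W : ImSort T} {J : Type} [Countable J] {B : J → ImSort T}
    (u : ∀ j, B j ⟶ A) (v : W ⟶ A) (h : ∀ (M : Model T) w, ∃ j b, smap M (u j) b = smap M v w)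
    (w : (F.functor.obj W).El) : ∃ j b, F.functor.map (u j) b = F.functor.map v w := by
  choose P p q hP hM using fun j => exists_pullback (u j) v
  obtain ⟨j, x, rfl⟩ := F.exists_of_sem_cover q (fun M w => by
    obtain ⟨j, b, hb⟩ := h M w
    obtain ⟨x, ⟨-, hx⟩, -⟩ := (hM j M).2 b w hb
    exact ⟨j, x, hx⟩) w
  exact ⟨j, F.functor.map (p j) x, congrFun (F.isPullback_map (hP j)).w x⟩

/-- The pullback of `f` and `g` is empty in every model, so it is covered by the empty family. Its
image under `F`, again a pullback, is therefore empty. -/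
theorem ne_of_sem_ne {f : A ⟶ C} {g : B ⟶ C}
    (h : ∀ (M : Model T) a b, smap M f a ≠ smap M g b) (a : (F.functor.obj A).El)
    (b : (F.functor.obj B).El) : F.functor.map f a ≠ F.functor.map g b := by
  intro hab
  obtain ⟨P, p, q, hP, hM⟩ := exists_pullback f g
  obtain ⟨x, -⟩ := Count.exists_of_isPullback (F.isPullback_map hP) hab
  obtain ⟨j, -⟩ := F.exists_of_sem_cover (J := Empty) (B := Empty.elim) (fun j => j.elim)
    (fun M x => (h M _ _ ((hM M).1 x)).elim) x
  exact j.elim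

end CohFun

/-! ### Maps between sorts given by formulas -/

section reindex

variable {n m k : ℕ} {α : Formula T.L n} {β : Formula T.L m}

theorem exists_reindex (σ : Fin n → Fin m)
    (h : ∀ (M : Model T) v, M.str.Sat β v → M.str.Sat α (v ∘ σ)) :
    ∃ f : ImSort.ofFormula β ⟶ ImSort.ofFormula α, ∀ (M : Model T) a,
      vec (smap M f a) = vec a ∘ σ := by
  obtain ⟨f, hf⟩ := ((isDef_vec (α := β) (β := α)
    (eqs (Fin.castAdd n ∘ σ) (Fin.natAdd m))).congr (S := fun M a b => vec b = vec a ∘ σ)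
    fun M a b => by
      rw [Str.sat_eqs, ← Function.comp_assoc, Str.append_castAdd, Str.append_natAdd,
        eq_comm]).exists_hom fun M a =>
      ⟨ofVec (vec a ∘ σ) (h M _ (vec_sat a)), vec_ofVec _ _, fun b hb => vec_injective hb⟩
  exact ⟨f, fun M a => (hf M a _).1 rfl⟩

/-- The map `β → α`, `x ↦ (x_{σ 0}, …, x_{σ (n-1)})`. -/
noncomputable def reindex (σ : Fin n → Fin m)
    (h : ∀ (M : Model T) v, M.str.Sat β v → M.str.Sat α (v ∘ σ)) :
    ImSort.ofFormula β ⟶ ImSort.ofFormula α :=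
  (exists_reindex σ h).choose

theorem vec_reindex (σ : Fin n → Fin m)
    (h : ∀ (M : Model T) v, M.str.Sat β v → M.str.Sat α (v ∘ σ)) (M : Model T)
    (a : Sem M (ImSort.ofFormula β)) : vec (smap M (reindex σ h) a) = vec a ∘ σ :=
  (exists_reindex σ h).choose_spec M a

theorem reindex_coord (σ : Fin n → Fin m)
    (h : ∀ (M : Model T) v, M.str.Sat β v → M.str.Sat α (v ∘ σ)) (i : Fin n) :
    reindex σ h ≫ coord α i = coord β (σ i) :=
  syn_hom_ext fun M a => hval_injective (by
    rw [smap_comp, hval_coord, hval_coord, vec_reindex]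
    rfl)

end reindex

/-! ### Tuples -/

theorem snoc_comp_castSucc {D : Type} {n : ℕ} (v : Fin n → D) (a : D) :
    Fin.snoc (α := fun _ => D) v a ∘ Fin.castSucc = v :=
  funext fun _ => Fin.snoc_castSucc (α := fun _ => D) _ _ _

theorem snoc_comp_last {D : Type} {n : ℕ} (v : Fin (n + 1) → D) :
    Fin.snoc (α := fun _ => D) (v ∘ Fin.castSucc) (v (Fin.last n)) = v :=
  Fin.snoc_init_self (α := fun _ => D) v

/-! ### Tuples in `F(X)` and the truth of formulas in `F_*(X)`. -/

namespace CohFun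

variable (F : CohFun (ImSort T) Count)

/-- The tuple in `F(X)` given by an element of `F(α)`. -/
def coords {n : ℕ} (α : Formula T.L n) (r : (F.functor.obj (ImSort.ofFormula α)).El) :
    Fin n → (F.functor.obj (homeSort T)).El :=
  fun i => F.functor.map (coord α i) r

theorem coords_reindex {n m : ℕ} {α : Formula T.L n} {β : Formula T.L m} (σ : Fin n → Fin m)
    (h : ∀ (M : Model T) v, M.str.Sat β v → M.str.Sat α (v ∘ σ))
    (r : (F.functor.obj (ImSort.ofFormula β)).El) :
    F.coords α (F.functor.map (reindex σ h) r) = F.coords β r ∘ σ := funext fun i => by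
  refine (F.map_comp_apply _ _ _).symm.trans ?_
  rw [reindex_coord]
  rfl

/-- Induction on `n`: `X^(n+1)` is the pullback of `X^n` and `X` over the terminal sort `X^0`, and
`F` preserves both the pullback and the terminal object. -/
theorem coords_top_bijective (n : ℕ) :
    Function.Bijective (F.coords (top : Formula T.L n)) := by
  induction n with
  | zero =>
    obtain ⟨ht⟩ := syn_isTerminal (A := ImSort.ofFormula (top : Formula T.L 0)) unique_sem_top
    have := F.coh.finLim
    obtain ⟨hu⟩ := Count.unique_of_isTerminal (ht.isTerminalObj F.functor _)
    exact ⟨fun a b _ => Subsingleton.elim _ _, fun a => ⟨default, Subsingleton.elim _ _⟩⟩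
  | succ n ih =>
    have hv : ∀ {k m : ℕ} (σ : Fin k → Fin m) (M : Model T) (v : Fin m → M.str.dom.El),
        M.str.Sat top v → M.str.Sat top (v ∘ σ) := fun σ M v _ => M.str.sat_top _
    have hP : IsPullback (reindex Fin.castSucc (hv _)) (coord (top : Formula T.L (n + 1))
        (Fin.last n)) (reindex (α := top) (Fin.elim0 : Fin 0 → Fin n) (hv _))
        (reindex (α := top) (Fin.elim0 : Fin 0 → Fin 1) (hv _)) := by
      refine syn_isPullback (fun M u => ?_) fun M a b _ => ?_
      · exact vec_injective (Subsingleton.elim _ _)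
      · refine ⟨ofVec (Fin.snoc (α := fun _ => M.str.dom.El) (vec a) (hval b)) (M.str.sat_top _),
          ⟨vec_injective ?_, hval_injective ?_⟩, ?_⟩
        · rw [vec_reindex, vec_ofVec, snoc_comp_castSucc]
        · rw [hval_coord, vec_ofVec]
          exact Fin.snoc_last (α := fun _ => M.str.dom.El) _ _
        · rintro u ⟨rfl, rfl⟩
          refine vec_injective ?_
          rw [vec_ofVec, vec_reindex, hval_coord, snoc_comp_last]
    have hF := F.isPullback_map hP
    constructor
    · intro r s h
      refine Count.injective_of_isPullback hF (ih.1 ?_) (congrFun h (Fin.last n))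
      rw [coords_reindex, coords_reindex, h]
    · intro x
      obtain ⟨r, hr⟩ := ih.2 (x ∘ Fin.castSucc)
      have ht : ∀ a b : (F.functor.obj (ImSort.ofFormula (top : Formula T.L 0))).El, a = b := by
        obtain ⟨ht⟩ := syn_isTerminal (A := ImSort.ofFormula (top : Formula T.L 0)) unique_sem_top
        have := F.coh.finLim
        obtain ⟨hu⟩ := Count.unique_of_isTerminal (ht.isTerminalObj F.functor _)
        exact fun a b => Subsingleton.elim _ _
      obtain ⟨u, hu, hu'⟩ := Count.exists_of_isPullback hF (a := r) (b := x (Fin.last n)) (ht _ _)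
      refine ⟨u, funext fun i => ?_⟩
      refine Fin.lastCases hu' (fun i => ?_) i
      have := congrFun (F.coords_reindex (α := top) Fin.castSucc (hv _) u) i
      rw [hu, hr] at this
      exact this.symm

/-- That the inclusion of `α` in `X^n` is a monomorphism says that its pullback along itself is
trivial, and `F` preserves this pullback. -/
theorem coords_injective {n : ℕ} (α : Formula T.L n) : Function.Injective (F.coords α) := by
  intro r s h
  let ι : ImSort.ofFormula α ⟶ ImSort.ofFormula (top : Formula T.L n) :=
    reindex id fun M v _ => M.str.sat_top _
  have hP : IsPullback (𝟙 _) (𝟙 _) ι ι := syn_isPullback (fun _ _ => rfl) fun M a b hab => by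
    have : a = b := vec_injective (by
      have := congrArg vec hab
      rwa [vec_reindex, vec_reindex] at this)
    subst this
    exact ⟨a, ⟨smap_id M a, smap_id M a⟩, fun b hb => (smap_id M b).symm.trans hb.1⟩
  have h1 : F.functor.map ι r = F.functor.map ι s := (F.coords_top_bijective n).1 (by
    rw [coords_reindex, coords_reindex, h])
  obtain ⟨u, hu, hu'⟩ := Count.exists_of_isPullback (F.isPullback_map hP) h1
  exact hu.symm.trans hu'

/-- `x` is the tuple of an element of `F(α)`. -/
def Hits {n : ℕ} (α : Formula T.L n) (x : Fin n → (F.functor.obj (homeSort T)).El) : Prop :=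
  ∃ r, F.coords α r = x

variable {F} {n m k : ℕ} {α : Formula T.L m} {β : Formula T.L k}
  {x : Fin m → (F.functor.obj (homeSort T)).El} {y : Fin k → (F.functor.obj (homeSort T)).El}

/-- The transfer principle behind `hits_iff`: a disjunctive existential consequence of `α`, valid in
all countable models, holds for the tuples of `F(α)`. The renamings `τ` and `σ j` map all the sorts
concerned to one power `X^n`, where the cover is compared. -/
theorem Hits.cover (h : F.Hits α x) {J : Type} [Countable J] {l : J → ℕ}
    (γ : ∀ j, Formula T.L (l j)) (τ : Fin n → Fin m) (σ : ∀ j, Fin n → Fin (l j))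
    (H : ∀ (M : Model T) v, M.str.Sat α v → ∃ j w, M.str.Sat (γ j) w ∧ w ∘ σ j = v ∘ τ) :
    ∃ j y, F.Hits (γ j) y ∧ y ∘ σ j = x ∘ τ := by
  obtain ⟨r, rfl⟩ := h
  obtain ⟨j, b, hb⟩ := F.exists_of_sem_cover_image (A := ImSort.ofFormula (top : Formula T.L n))
    (fun j => reindex (β := γ j) (σ j) fun M v _ => M.str.sat_top _)
    (reindex τ fun M v _ => M.str.sat_top _) (fun M a => by
      obtain ⟨j, w, hw, hw'⟩ := H M (vec a) (vec_sat a)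
      refine ⟨j, ofVec w hw, vec_injective ?_⟩
      rw [vec_reindex, vec_reindex, vec_ofVec, hw']) r
  refine ⟨j, _, ⟨b, rfl⟩, ?_⟩
  have := congrArg (F.coords top) hb
  rwa [coords_reindex, coords_reindex] at this

theorem Hits.imp (h : F.Hits α x) (τ : Fin k → Fin m)
    (H : ∀ (M : Model T) v, M.str.Sat α v → M.str.Sat β (v ∘ τ)) : F.Hits β (x ∘ τ) := by
  obtain ⟨_, y, hy, h⟩ := h.cover (fun _ : Unit => β) τ (fun _ => id) fun M v hv =>
    ⟨(), v ∘ τ, H M v hv, rfl⟩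
  rw [← h]
  exact hy

/-- The transfer principle for disjointness: subobjects whose projections to `X^n` are disjoint in
every model remain so under `F`. -/
theorem Hits.ne (h : F.Hits α x) (h' : F.Hits β y) {τ : Fin n → Fin m} {σ : Fin n → Fin k}
    (H : ∀ (M : Model T) v w, M.str.Sat α v → M.str.Sat β w → v ∘ τ ≠ w ∘ σ) :
    x ∘ τ ≠ y ∘ σ := by
  obtain ⟨r, rfl⟩ := h
  obtain ⟨s, rfl⟩ := h'
  intro h
  refine F.ne_of_sem_ne (C := ImSort.ofFormula (top : Formula T.L n))
    (f := reindex τ fun M v _ => M.str.sat_top _) (g := reindex σ fun M v _ => M.str.sat_top _)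
    (fun M a b hab => H M (vec a) (vec b) (vec_sat a) (vec_sat b) ?_) r s
    ((F.coords_top_bijective n).1 ?_)
  · have := congrArg vec hab
    rwa [vec_reindex, vec_reindex] at this
  · rw [coords_reindex, coords_reindex, h]

theorem exists_hits {J : Type} [Countable J] (γ : J → Formula T.L m)
    (H : ∀ (M : Model T) v, ∃ j, M.str.Sat (γ j) v)
    (x : Fin m → (F.functor.obj (homeSort T)).El) : ∃ j, F.Hits (γ j) x := by
  have hx : F.Hits top x := (F.coords_top_bijective m).2 x
  obtain ⟨j, y, hy, h⟩ := hx.cover γ id (fun _ => id) fun M v _ =>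
    (H M v).imp fun j hj => ⟨v, hj, rfl⟩
  obtain rfl : y = x := h
  exact ⟨j, hy⟩

/-- `α` and its negation are disjoint and together cover `X^m` in every model; classical logic thus
survives under `F`. -/
theorem hits_neg : F.Hits (neg α) x ↔ ¬ F.Hits α x := by
  constructor
  · intro h h'
    refine h.ne h' (τ := id) (σ := id) (fun M v w hv hw hvw => ?_) rfl
    obtain rfl : v = w := hvw
    exact hv hw
  · intro h
    obtain ⟨_ | _, h'⟩ := exists_hits (fun b : Bool => cond b α (neg α)) (fun M v => by
      by_cases h : M.str.Sat α v
      · exact ⟨true, h⟩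
      · exact ⟨false, h⟩) x
    · exact h'
    · exact (h h').elim

/-- The elements of `F(α)` are the tuples which satisfy `α` in the structure `F_*(X)`. -/
theorem hits_iff (α : Formula T.L n) : ∀ x : Fin n → (F.functor.obj (homeSort T)).El,
    F.Hits α x ↔ ((push T).obj F).Sat α x := by
  induction α with
  | @rel n R x =>
    intro v
    have h1 : ((push T).obj F).Sat (rel R x) v ↔ F.Hits (relFormula R) (v ∘ x) :=
      ⟨fun ⟨r, hr⟩ => ⟨r, (funext hr).symm⟩, fun ⟨r, hr⟩ => ⟨r, fun i => (congrFun hr i).symm⟩⟩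
    rw [h1]
    constructor
    · exact fun h => h.imp x fun M v hv => hv
    · intro h
      by_contra h'
      -- The projection of `¬ R(x)` along the variables `x` is disjoint from `R`.
      refine (hits_neg.2 h').ne h (τ := x) (σ := id) (fun M v w hv hw hvw => hv ?_) rfl
      obtain rfl : v ∘ x = w := hvw
      exact hw
  | @eq n i j =>
    intro v
    constructor
    · rintro ⟨r, rfl⟩
      have : coord (eq i j : Formula T.L n) i = coord (eq i j) j :=
        syn_hom_ext fun M a => hval_injective (by
          rw [hval_coord, hval_coord]
          exact vec_sat a)
      exact congrArg (fun f => F.functor.map f r) this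
    · intro h
      by_contra h'
      -- The single element `v i`, repeated twice, represents the diagonal of `X²`, which is
      -- disjoint from the projection of `neg (eq i j)`.
      have hw : F.Hits (top : Formula T.L 1) (fun _ => v i) := (F.coords_top_bijective 1).2 _
      refine (hits_neg.2 h').ne hw (n := 2) (τ := ![i, j]) (σ := fun _ => 0)
        (fun M v w hv _ hvw => hv ?_) (funext fun l => ?_)
      · exact (congrFun hvw 0).trans (congrFun hvw 1).symm
      · change v i = v j at h
        fin_cases l
        · rfl
        · exact h.symm
  | neg φ ih => exact fun v => hits_neg.trans (not_congr (ih v))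
  | conj I φ ih =>
    intro v
    refine Iff.trans ?_ (forall_congr' fun i => ih i v)
    constructor
    · exact fun h i => h.imp id fun M v hv => hv i
    · intro h
      obtain ⟨_ | i, h'⟩ := exists_hits (fun i : Option I => i.elim (conj I φ) fun i => neg (φ i))
        (fun M v => by
          by_cases h : M.str.Sat (conj I φ) v
          · exact ⟨none, h⟩
          · obtain ⟨i, hi⟩ := not_forall.1 h
            exact ⟨some i, hi⟩) v
      · exact h'
      · exact (hits_neg.1 h' (h i)).elim
  | disj I φ ih =>
    intro v
    refine Iff.trans ?_ (exists_congr fun i => ih i v)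
    constructor
    · intro h
      obtain ⟨i, y, hy, hyv⟩ := h.cover φ id (fun _ => id) fun M v ⟨i, hi⟩ => ⟨i, v, hi, rfl⟩
      obtain rfl : y = v := hyv
      exact ⟨i, hy⟩
    · rintro ⟨i, h⟩
      exact h.imp id fun M v hv => ⟨i, hv⟩
  | @all n φ ih =>
    intro v
    refine Iff.trans ?_ (forall_congr' fun a => ih _)
    constructor
    · intro h a
      by_contra h'
      refine h.ne (hits_neg.2 h') (τ := id) (σ := Fin.castSucc) (fun M v w hv hw hvw => hw ?_)
        (snoc_comp_castSucc _ _).symm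
      obtain rfl : v = w ∘ Fin.castSucc := hvw
      exact (congrArg (M.str.Sat φ) (snoc_comp_last w)).mp (hv (w (Fin.last n)))
    · intro h
      by_contra h'
      -- Where `all φ` fails, the tuple extends by a counterexample: `neg φ` covers the negation of
      -- `all φ` by forgetting the last variable.
      obtain ⟨_, y, hy, hyv⟩ := (hits_neg.2 h').cover (fun _ : Unit => neg φ) id
        (fun _ => Fin.castSucc) fun M v hv => by
          obtain ⟨a, ha⟩ := not_forall.1 hv
          exact ⟨(), _, ha, snoc_comp_castSucc _ _⟩
      obtain rfl : y ∘ Fin.castSucc = v := hyv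
      exact hits_neg.1 hy ((congrArg (F.Hits φ) (snoc_comp_last y)).mp (h (y (Fin.last n))))
  | @ex n φ ih =>
    intro v
    refine Iff.trans ?_ (exists_congr fun a => ih _)
    constructor
    · intro h
      obtain ⟨_, y, hy, hyv⟩ := h.cover (fun _ : Unit => φ) id (fun _ => Fin.castSucc)
        fun M v ⟨a, ha⟩ => ⟨(), _, ha, snoc_comp_castSucc _ _⟩
      obtain rfl : y ∘ Fin.castSucc = v := hyv
      exact ⟨y (Fin.last n), (congrArg (F.Hits φ) (snoc_comp_last y)).mpr hy⟩
    · rintro ⟨a, h⟩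
      have := h.imp (β := ex φ) Fin.castSucc fun M v hv => ⟨v (Fin.last n),
        (congrArg (M.str.Sat φ) (snoc_comp_last v)).mpr hv⟩
      exact (congrArg (F.Hits (ex φ)) (snoc_comp_castSucc v a)).mp this

end CohFun

end Coh


/-! ### The model of a coherent functor and the counit `ζ`. -/

section Zeta

variable {T : Theory} {A B : ImSort T}

/-- The model `F_*(X)`. -/
def CohFun.pushModel (F : CohFun (ImSort T) Count) : Model T where
  str := (push T).obj F
  models χ hχ := by
    obtain ⟨_, h⟩ := CohFun.exists_hits (F := F) (fun _ : Unit => χ) (fun M v => ⟨(), by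
      have := M.models χ hχ
      rwa [Subsingleton.elim v Fin.elim0]⟩) Fin.elim0
    have := (CohFun.hits_iff χ _).1 h
    exact this

/-- The functor `F ↦ F_*(X)`. -/
def toModel (T : Theory) : CohFun (ImSort T) Count ⥤ Model T where
  obj F := F.pushModel
  map τ := (push T).map τ
  map_id F := (push T).map_id F
  map_comp τ τ' := (push T).map_comp τ τ'

/-! ### The inclusion of a formula in an imaginary sort -/

theorem exists_inc (A : ImSort T) (i : A.I) : ∃ f : ImSort.ofFormula (A.α i) ⟶ A,
    ∀ (M : Model T) a, smap M f a = Pt.cls ⟨i, vec a, vec_sat a⟩ := by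
  have h : IsDef (ImSort.ofFormula (A.α i)) A fun M a b => Pt.cls ⟨i, vec a, vec_sat a⟩ = b :=
    ⟨fun _ k => A.ε i k, fun M p q => (Pt.cls_eq (p := ⟨i, p.x, p.sat⟩) (q := q)).symm⟩
  obtain ⟨f, hf⟩ := h.exists_hom fun M a => ⟨_, rfl, fun _ h => h.symm⟩
  exact ⟨f, fun M a => (hf M a _).2 rfl⟩

/-- The map from `αᵢ` to `(⨆ᵢ αᵢ)/(⨆ᵢⱼ εᵢⱼ)`. -/
noncomputable def inc (A : ImSort T) (i : A.I) : ImSort.ofFormula (A.α i) ⟶ A :=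
  (exists_inc A i).choose

theorem smap_inc (i : A.I) (M : Model T) (a : Sem M (ImSort.ofFormula (A.α i))) :
    smap M (inc A i) a = Pt.cls ⟨i, vec a, vec_sat a⟩ :=
  (exists_inc A i).choose_spec M a

/-- Needed to see that `ζ` at the home sort returns the element itself. -/
theorem inc_homeSort (i : (homeSort T).I) : inc (homeSort T) i = coord (top : Formula T.L 1) 0 :=
  syn_hom_ext fun M a => hval_injective ((congrArg hval (smap_inc i M a)).trans
    (hval_coord (α := (top : Formula T.L 1)) a 0).symm)

theorem smap_rep (M : Model T) {f : A ⟶ B} {Φ : FunFamily A B} (h : Quotient.mk _ Φ = f)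
    {p : Pt M A} {q : Pt M B} :
    smap M f p.cls = q.cls ↔ M.str.Sat (Φ.φ p.i q.i) (Fin.append p.x q.x) := by
  subst h
  exact smap_mk M

namespace CohFun

variable (F : CohFun (ImSort T) Count)

theorem exists_inc (a : (F.functor.obj A).El) : ∃ i r, F.functor.map (inc A i) r = a :=
  F.exists_of_sem_cover (inc A) (fun M a => by
    obtain ⟨p, rfl⟩ := Pt.cls_surj a
    exact ⟨p.i, ofVec p.x p.sat, smap_inc _ _ _⟩) a

/-- The formula `εᵢⱼ`, taken as a sort, is the pullback of the two inclusions into `A`, and `F`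
preserves this pullback. -/
theorem inc_eq_inc {i j : A.I} {r : (F.functor.obj (ImSort.ofFormula (A.α i))).El}
    {s : (F.functor.obj (ImSort.ofFormula (A.α j))).El} :
    F.functor.map (inc A i) r = F.functor.map (inc A j) s ↔
      F.Hits (A.ε i j) (Fin.append (F.coords _ r) (F.coords _ s)) := by
  have h1 : ∀ (M : Model T) v, M.str.Sat (A.ε i j) v → M.str.Sat (A.α i) (v ∘ Fin.castAdd _) :=
    fun M v hv => by
      obtain ⟨x, y, rfl⟩ := Str.exists_append v
      rw [Str.append_castAdd]
      exact (eps_dom M hv).1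
  have h2 : ∀ (M : Model T) v, M.str.Sat (A.ε i j) v → M.str.Sat (A.α j) (v ∘ Fin.natAdd _) :=
    fun M v hv => by
      obtain ⟨x, y, rfl⟩ := Str.exists_append v
      rw [Str.append_natAdd]
      exact (eps_dom M hv).2
  have hP : IsPullback (reindex (Fin.castAdd _) h1) (reindex (Fin.natAdd _) h2)
      (inc A i) (inc A j) := by
    have hu : ∀ (M : Model T) (u : Sem M (ImSort.ofFormula (A.ε i j))), vec u =
        Fin.append (vec (smap M (reindex (Fin.castAdd _) h1) u))
          (vec (smap M (reindex (Fin.natAdd _) h2) u)) := fun M u => by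
      rw [vec_reindex, vec_reindex]
      obtain ⟨x, y, h⟩ := Str.exists_append (vec u)
      rw [h, Str.append_castAdd, Str.append_natAdd]
    refine syn_isPullback (fun M u => ?_) fun M a b hab => ?_
    · rw [smap_inc, smap_inc]
      refine Pt.cls_eq.2 ?_
      have := vec_sat u
      rw [hu] at this
      exact this
    · rw [smap_inc, smap_inc] at hab
      refine ⟨ofVec _ (Pt.cls_eq.1 hab), ⟨vec_injective ?_, vec_injective ?_⟩, ?_⟩
      · rw [vec_reindex, vec_ofVec, Str.append_castAdd]
      · rw [vec_reindex, vec_ofVec, Str.append_natAdd]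
      · rintro u ⟨rfl, rfl⟩
        exact vec_injective (hu M u)
  have hF := F.isPullback_map hP
  constructor
  · intro h
    obtain ⟨u, rfl, rfl⟩ := Count.exists_of_isPullback hF h
    refine ⟨u, ?_⟩
    rw [coords_reindex, coords_reindex]
    obtain ⟨x, y, h⟩ := Str.exists_append (F.coords (A.ε i j) u)
    rw [h, Str.append_castAdd, Str.append_natAdd]
  · rintro ⟨u, hu⟩
    have h3 := F.coords_reindex (Fin.castAdd _) h1 u
    have h4 := F.coords_reindex (Fin.natAdd _) h2 u
    rw [hu, Str.append_castAdd] at h3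
    rw [hu, Str.append_natAdd] at h4
    rw [← F.coords_injective _ h3, ← F.coords_injective _ h4]
    exact congrFun hF.w u

/-! ### The counit -/

/-- A point of `F_*(X)` in `αᵢ` comes from an element of `F(αᵢ)` by `hits_iff`, and equivalent
points have the same image in `F(A)` by `inc_eq_inc`. The value is specified for all representatives
at once, so that any convenient one may be used to compute it. -/
theorem exists_zeta (a : Sem F.pushModel A) : ∃ b : (F.functor.obj A).El,
    ∀ (p : Pt F.pushModel A) (r), p.cls = a → F.coords _ r = p.x →
      F.functor.map (inc A p.i) r = b := by
  obtain ⟨p, rfl⟩ := Pt.cls_surj a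
  obtain ⟨r, hr⟩ := (hits_iff (F := F) _ _).2 p.sat
  refine ⟨F.functor.map (inc A p.i) r, fun q s hq hs => F.inc_eq_inc.2 ?_⟩
  rw [hr, hs]
  exact (hits_iff (F := F) _ _).2 (Pt.cls_eq.1 hq)

/-- The map `K(F_*(X))(A) → F(A)`, before numbering. -/
noncomputable def zeta (a : Sem F.pushModel A) : (F.functor.obj A).El := (F.exists_zeta a).choose

theorem zeta_cls {p : Pt F.pushModel A} {r} (h : F.coords _ r = p.x) :
    F.zeta p.cls = F.functor.map (inc A p.i) r :=
  ((F.exists_zeta p.cls).choose_spec p r rfl h).symm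

theorem exists_coords (p : Pt F.pushModel A) : ∃ r, F.coords (A.α p.i) r = p.x :=
  (hits_iff (F := F) _ _).2 p.sat

/-- Injectivity is `inc_eq_inc` read backwards, and surjectivity says that the `F(αᵢ)` cover `F(A)`.
-/
theorem zeta_bijective : Function.Bijective (F.zeta (A := A)) := by
  constructor
  · intro a b h
    obtain ⟨p, rfl⟩ := Pt.cls_surj a
    obtain ⟨q, rfl⟩ := Pt.cls_surj b
    obtain ⟨r, hr⟩ := F.exists_coords p
    obtain ⟨s, hs⟩ := F.exists_coords q
    rw [F.zeta_cls hr, F.zeta_cls hs, inc_eq_inc, hr, hs] at h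
    exact Pt.cls_eq.2 ((hits_iff (F := F) _ _).1 h)
  · intro a
    obtain ⟨i, r, rfl⟩ := F.exists_inc a
    exact ⟨Pt.cls ⟨i, F.coords _ r, (hits_iff (F := F) _ _).1 ⟨r, rfl⟩⟩, F.zeta_cls rfl⟩

theorem zeta_homeSort (a : Sem F.pushModel (homeSort T)) : F.zeta a = hval a := by
  obtain ⟨p, rfl⟩ := Pt.cls_surj a
  obtain ⟨r, hr⟩ := F.exists_coords p
  rw [F.zeta_cls hr, inc_homeSort]
  exact congrFun hr (0 : Fin 1)

/-- The graph formula of `f` at the indices of `p` and `q`, taken as a sort, projects to both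
formulas and makes a commutative square with `f`. Applying `F` to that square at an element over the
pair `(p, q)` gives the equation. -/
theorem zeta_naturality (f : A ⟶ B) (a : Sem F.pushModel A) :
    F.functor.map f (F.zeta a) = F.zeta (smap F.pushModel f a) := by
  obtain ⟨p, rfl⟩ := Pt.cls_surj a
  obtain ⟨q, hq⟩ := Pt.cls_surj (smap F.pushModel f p.cls)
  rw [← hq]
  obtain ⟨Φ, hΦ⟩ := Quotient.exists_rep f
  have h1 : ∀ (M : Model T) v, M.str.Sat (Φ.φ p.i q.i) v → M.str.Sat ((A.α p.i).subst
      (Fin.castAdd _)) v ∧ M.str.Sat ((B.α q.i).subst (Fin.natAdd _)) v := fun M v hv => by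
    have := M.sound1 (Φ.dom p.i q.i (Fin.castAdd _) (Fin.natAdd _)) v (by
      obtain ⟨x, y, rfl⟩ := Str.exists_append v
      rwa [Str.sat_sub2, Str.append_castAdd, Str.append_natAdd])
    rwa [Str.sat_and] at this
  have h2 : ∀ (M : Model T) v, M.str.Sat (Φ.φ p.i q.i) v →
      M.str.Sat (A.α p.i) (v ∘ Fin.castAdd _) := fun M v hv => (Str.sat_subst _ _ _ _).1 (h1 M v hv).1
  have h3 : ∀ (M : Model T) v, M.str.Sat (Φ.φ p.i q.i) v →
      M.str.Sat (B.α q.i) (v ∘ Fin.natAdd _) := fun M v hv => (Str.sat_subst _ _ _ _).1 (h1 M v hv).2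
  have h4 : reindex _ h2 ≫ inc A p.i ≫ f = reindex _ h3 ≫ inc B q.i :=
    syn_hom_ext fun M u => by
      rw [smap_comp, smap_comp, smap_comp, smap_inc, smap_inc]
      refine (smap_rep M hΦ).2 ?_
      obtain ⟨x, y, h⟩ := Str.exists_append (vec u)
      have := vec_sat u
      dsimp only
      rw [vec_reindex, vec_reindex, h, Str.append_castAdd, Str.append_natAdd, ← h]
      exact this
  obtain ⟨u, hu⟩ := (hits_iff (F := F) _ _).2 ((smap_rep F.pushModel hΦ).1 hq.symm)
  have h5 := (F.coords_reindex _ h2 u).trans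
    ((congrArg (· ∘ Fin.castAdd _) hu).trans (Str.append_castAdd p.x q.x))
  have h6 := (F.coords_reindex _ h3 u).trans
    ((congrArg (· ∘ Fin.natAdd _) hu).trans (Str.append_natAdd p.x q.x))
  rw [F.zeta_cls h5, F.zeta_cls h6, ← F.map_comp_apply, ← F.map_comp_apply, ← F.map_comp_apply,
    ← h4]

/-- A natural isomorphism is determined by its component at the home sort. -/
theorem hom_ext_homeSort {F G : CohFun (ImSort T) Count} {τ τ' : F ⟶ G}
    (h : ∀ a : (F.functor.obj (homeSort T)).El,
      (τ.iso.hom.app (homeSort T) a : ℕ) = τ'.iso.hom.app (homeSort T) a) : τ = τ' := by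
  refine CohFun.hom_ext fun A => funext fun a => ?_
  -- An element of `F(A)` comes from some `F(αᵢ)`, and its image in `G(αᵢ)` is determined by
  -- coordinates in `G(X)`, where the two transformations agree.
  obtain ⟨i, r, rfl⟩ := F.exists_inc a
  have nat : ∀ (σ : F ⟶ G) {A B : ImSort T} (f : A ⟶ B) (a : (F.functor.obj A).El),
      σ.iso.hom.app B (F.functor.map f a) = G.functor.map f (σ.iso.hom.app A a) :=
    fun σ _ _ f a => congrFun (σ.iso.hom.naturality f) a
  rw [nat, nat]
  refine congrArg _ (G.coords_injective _ (funext fun j => ?_))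
  refine (nat τ _ _).symm.trans (Eq.trans ?_ (nat τ' _ _))
  exact Subtype.ext (h _)

/-- Elements of objects of `Count` are natural numbers, which transport along an equality of
functors leaves unchanged. Equations that involve such transports can thus be tested on numbers. -/
theorem eqToHom_val {F G : CohFun (ImSort T) Count} (h : F = G) (a : (F.functor.obj A).El) :
    ((eqToHom h).iso.hom.app A a : ℕ) = a := by
  subst h
  rfl

end CohFun

/-- An isomorphism of `Count` given by a bijection. -/
def Count.isoOfEquiv {M N : Count} (e : M.El ≃ N.El) : M ≅ N where
  hom := e
  inv := e.symm
  hom_inv_id := funext e.symm_apply_apply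
  inv_hom_id := funext e.apply_symm_apply

/-- The isomorphism `K(F_*(X)) ≅ F`. -/
noncomputable def zetaHom (F : CohFun (ImSort T) Count) :
    (Model.toCoh T).obj F.pushModel ⟶ F where
  iso := NatIso.ofComponents
    (fun A => Count.isoOfEquiv ((num F.pushModel A).symm.trans (Equiv.ofBijective _ F.zeta_bijective)))
    fun {A B} f => funext fun k => by
      obtain ⟨a, rfl⟩ := (num F.pushModel A).surjective k
      change F.zeta ((num F.pushModel B).symm (F.pushModel.functor.map f (num F.pushModel A a))) =
        F.functor.map f (F.zeta ((num F.pushModel A).symm (num F.pushModel A a)))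
      rw [Model.functor_map_num, Equiv.symm_apply_apply, Equiv.symm_apply_apply,
        F.zeta_naturality]

theorem zetaHom_num (F : CohFun (ImSort T) Count) (a : Sem F.pushModel A) :
    (zetaHom F).iso.hom.app A (num F.pushModel A a) = F.zeta a :=
  congrArg F.zeta ((num F.pushModel A).symm_apply_apply a)

/-- On the home sort, both the numbering of `K` and the map `zeta` fix the underlying numbers.
Together with `hom_ext_homeSort` this gives the naturality of `ζ` and the equation `ζ_{K(M)} = 1`.
-/
theorem zetaHom_val (F : CohFun (ImSort T) Count)
    (k : (F.pushModel.functor.obj (homeSort T)).El) :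
    ((zetaHom F).iso.hom.app (homeSort T) k : ℕ) = k := by
  obtain ⟨a, rfl⟩ := (num F.pushModel (homeSort T)).surjective k
  rw [zetaHom_num, F.zeta_homeSort, num_homeSort]

/-! ### Isomorphisms of models -/

theorem Model.hom_ext {M N : Model T} {g g' : M ⟶ N}
    (h : ∀ a, (Model.homEquiv g a : ℕ) = Model.homEquiv g' a) : g = g' :=
  Str.Iso.ext (Equiv.ext fun a => Subtype.ext (h a))

theorem Model.homEquiv_comp {M N P : Model T} (g : M ⟶ N) (h : N ⟶ P) (a : M.str.dom.El) :
    Model.homEquiv (g ≫ h) a = Model.homEquiv h (Model.homEquiv g a) := rfl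

theorem Model.eqToHom_val {M N : Model T} (h : M = N) (a : M.str.dom.El) :
    (Model.homEquiv (eqToHom h) a : ℕ) = a := by
  subst h
  rfl

/-- Isomorphisms which agree as partial functions on `ℕ` agree on elements with the same value. -/
theorem Model.homEquiv_val_congr {M N : Model T} (g : M ⟶ N) {a b : M.str.dom.El}
    (h : (a : ℕ) = b) : (Model.homEquiv g a : ℕ) = Model.homEquiv g b := by
  rw [Subtype.ext h]

theorem toCoh_map_num {M N : Model T} (g : M ⟶ N) (a : Sem M A) :
    ((Model.toCoh T).map g).iso.hom.app A (num M A a) = num N A (gmap g a) :=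
  Model.trans_num g a

theorem toCoh_map_val {M N : Model T} (g : M ⟶ N) (k : (M.functor.obj (homeSort T)).El)
    (a : M.str.dom.El) (h : (k : ℕ) = a) :
    (((Model.toCoh T).map g).iso.hom.app (homeSort T) k : ℕ) = Model.homEquiv g a := by
  obtain ⟨b, rfl⟩ := (num M (homeSort T)).surjective k
  rw [toCoh_map_num, num_homeSort, hval_gmap]
  exact Model.homEquiv_val_congr g (by rw [← h, num_homeSort])

/-- The natural isomorphism `ζ : K ∘ L → 1`. -/
noncomputable def zetaNat (T : Theory) :
    toModel T ⋙ Model.toCoh T ⟶ 𝟭 (CohFun (ImSort T) Count) where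
  app F := zetaHom F
  naturality F G τ := CohFun.hom_ext_homeSort fun k => by
    change ((zetaHom G).iso.hom.app (homeSort T)
      (((Model.toCoh T).map ((toModel T).map τ)).iso.hom.app (homeSort T) k) : ℕ) =
      (τ.iso.hom.app (homeSort T) ((zetaHom F).iso.hom.app (homeSort T) k) : ℕ)
    exact (zetaHom_val G _).trans (toCoh_map_val _ _ _ (zetaHom_val F k).symm)

/-- The universes agree because the home sort is its own numbering. The relations agree because the
elements of the sort `R` are the tuples satisfying `R`, with their entries as coordinates. -/
theorem pushModel_toCoh (M : Model T) : ((Model.toCoh T).obj M).pushModel = M := by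
  refine Model.ext (Str.code_injective (Prod.ext (congrArg Count.size rankCount_homeSort) ?_))
  funext R v
  refine propext ⟨?_, ?_⟩
  · rintro ⟨h, k, hk⟩
    obtain ⟨c, rfl⟩ := (num M (ImSort.ofFormula (relFormula R))).surjective k
    have hv : ∀ i, v i = vec c i := fun i => by
      refine (congrArg Subtype.val (hk i)).trans ?_
      refine (congrArg Subtype.val (M.functor_map_num _ c)).trans ?_
      rw [num_homeSort, hval_coord]
    obtain rfl : v = fun i => (vec c i : ℕ) := funext hv
    exact ⟨fun i => (vec c i).2, vec_sat c⟩
  · rintro ⟨h, hR⟩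
    let c : Sem M (ImSort.ofFormula (relFormula R)) := ofVec (fun i => ⟨v i, h i⟩) hR
    have hs : ((Model.toCoh T).obj M).pushModel.str.dom = M.str.dom := rankCount_homeSort
    refine ⟨fun i => by rw [hs]; exact h i, num M _ c, fun i => Subtype.ext ?_⟩
    refine Eq.symm ((congrArg Subtype.val (M.functor_map_num _ c)).trans ?_)
    rw [num_homeSort, hval_coord]
    rfl

theorem toCoh_comp_toModel (T : Theory) : Model.toCoh T ⋙ toModel T = 𝟭 (Model T) := by
  refine CategoryTheory.Functor.ext pushModel_toCoh fun M N g => Model.hom_ext fun a => ?_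
  rw [Model.homEquiv_comp, Model.homEquiv_comp, Model.eqToHom_val]
  exact toCoh_map_val g a _ (Model.eqToHom_val _ _).symm

theorem zetaHom_toCoh (M : Model T) : zetaHom ((Model.toCoh T).obj M) =
    eqToHom (congrArg (Model.toCoh T).obj (pushModel_toCoh M)) :=
  CohFun.hom_ext_homeSort fun k => (zetaHom_val _ k).trans (CohFun.eqToHom_val _ k).symm

end Zeta

/-! ### Borelness of the counit -/

/-- Adding identities at sources and targets and all composites keeps a set of morphisms countable;
the union of the finite iterates is closed under these operations. -/
theorem exists_subcategory {C : Type} [Category.{0} C] {S₀ : Set (Arrow C)} (h : S₀.Countable) :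
    ∃ S : Set (Arrow C), S₀ ⊆ S ∧ S.Countable ∧
      (∀ f ∈ S, Arrow.mk (𝟙 f.left) ∈ S ∧ Arrow.mk (𝟙 f.right) ∈ S) ∧
      ∀ p : Composable C, p.1.1 ∈ S → p.1.2 ∈ S → p.mul ∈ S := by
  let step : Set (Arrow C) → Set (Arrow C) := fun S =>
    S ∪ ((fun f => Arrow.mk (𝟙 f.left)) '' S ∪ (fun f => Arrow.mk (𝟙 f.right)) '' S ∪
      Composable.mul '' {p : Composable C | p.1 ∈ S ×ˢ S})
  let S : ℕ → Set (Arrow C) := fun n => step^[n] S₀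
  have hS : ∀ n, S (n + 1) = step (S n) := fun n => Function.iterate_succ_apply' _ _ _
  have hmono : Monotone S := monotone_nat_of_le_succ fun n => by
    rw [hS]
    exact Set.subset_union_left
  refine ⟨⋃ n, S n, Set.subset_iUnion S 0, Set.countable_iUnion fun n => ?_, fun f hf => ?_,
    fun p hp hp' => ?_⟩
  · induction n with
    | zero => exact h
    | succ n ih =>
      rw [hS]
      exact ih.union (((ih.image _).union (ih.image _)).union
        (((ih.prod ih).preimage Subtype.val_injective).image _))
  · obtain ⟨n, hn⟩ := Set.mem_iUnion.1 hf
    constructor <;> refine Set.mem_iUnion.2 ⟨n + 1, ?_⟩ <;> rw [hS]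
    · exact Or.inr (Or.inl (Or.inl ⟨f, hn, rfl⟩))
    · exact Or.inr (Or.inl (Or.inr ⟨f, hn, rfl⟩))
  · obtain ⟨n, hn⟩ := Set.mem_iUnion.1 hp
    obtain ⟨m, hm⟩ := Set.mem_iUnion.1 hp'
    refine Set.mem_iUnion.2 ⟨max n m + 1, ?_⟩
    rw [hS]
    exact Or.inr (Or.inr ⟨p, ⟨hmono (le_max_left _ _) hn, hmono (le_max_right _ _) hm⟩, rfl⟩)

section ZetaBorel

variable {T : Theory}

/-- The morphisms on which the counit at `A` depends. -/
def zetaArrows (A : ImSort T) : Set (Arrow (ImSort T)) :=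
  -- The identities are included so that the sizes of the objects `F(B)` can be read off from values
  -- of `F` on morphisms.
  {Arrow.mk (𝟙 (homeSort T)), Arrow.mk (𝟙 A)} ∪
    (Set.range (fun R : T.L.Sym => Arrow.mk (𝟙 (ImSort.ofFormula (relFormula R)))) ∪
    Set.range (fun p : Σ R : T.L.Sym, Fin (T.L.arity R) => Arrow.mk (coord (relFormula p.1) p.2)) ∪
    (Set.range (fun i : A.I => Arrow.mk (𝟙 (ImSort.ofFormula (A.α i)))) ∪
    Set.range (fun p : Σ i : A.I, Fin (A.n i) => Arrow.mk (coord (A.α p.1) p.2)) ∪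
    Set.range (fun i : A.I => Arrow.mk (inc A i))))

theorem countable_zetaArrows (A : ImSort T) : (zetaArrows A).Countable := by
  have := T.L.countable
  exact (Set.to_countable _).union (((Set.countable_range _).union (Set.countable_range _)).union
    (((Set.countable_range _).union (Set.countable_range _)).union (Set.countable_range _)))

variable {X : Type} [MeasurableSpace X] {F : X → CohFun (ImSort T) Count}

theorem measurable_obj {B : ImSort T}
    (h : Measurable fun x => Arrow.mk ((F x).functor.map (𝟙 B))) :
    Measurable fun x => ((F x).functor.obj B).size :=
  Count.measurable_left.comp h

/-- The functor depends on a parameter in an arbitrary measurable space. This covers two uses: all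
coherent functors, with the structure generated by finitely or countably many of their values, and
the functors `G^* K(M)` for varying `M`. -/
theorem measurable_toModel (h0 : Measurable fun x => Arrow.mk ((F x).functor.map (𝟙 (homeSort T))))
    (h1 : ∀ R, Measurable fun x => Arrow.mk
      ((F x).functor.map (𝟙 (ImSort.ofFormula (relFormula R)))))
    (h2 : ∀ R i, Measurable fun x => Arrow.mk ((F x).functor.map (coord (relFormula R) i))) :
    Measurable fun x => (F x).pushModel := by
  refine measurable_comap_iff.2 (measurable_comap_iff.2 ((measurable_obj h0).prodMk
    (measurable_pi_lambda _ fun R => measurable_pi_lambda _ fun v => ?_)))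
  refine (Measurable.exists fun k : ℕ => (Count.measurable_lt (measurable_obj (h1 R)) k).and
    (Measurable.forall fun i => (Count.measurable_maps k (v i)).comp (h2 R i))).congr_prop
      fun x => ?_
  constructor
  · rintro ⟨k, hk, h⟩
    choose hk' h using h
    refine ⟨fun i => ?_, ⟨k, hk⟩, fun i => Subtype.ext (h i).symm⟩
    rw [← h i]
    exact ((F x).functor.map (coord (relFormula R) i) ⟨k, hk⟩).2
  · rintro ⟨h, k, hk⟩
    exact ⟨k, k.2, fun i => ⟨k.2, congrArg Subtype.val (hk i).symm⟩⟩

/-- `ζ` sends `k` to `l` when some name `(i, v)` of `k` is the coordinate tuple of an `m` in `F(αᵢ)`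
whose image in `F(A)` is `l`. The quantifiers are countable, and only morphisms in `zetaArrows A`
occur. -/
theorem measurable_zetaHom (A : ImSort T)
    (h : ∀ f ∈ zetaArrows A, Measurable fun x => Arrow.mk ((F x).functor.map f.hom)) :
    Measurable fun x => Arrow.mk ((zetaHom (F x)).iso.hom.app A) := by
  have hX := h _ (Or.inl (Or.inl rfl))
  have hA := h _ (Or.inl (Or.inr rfl))
  have h1 := fun R => h _ (Or.inr (Or.inl (Or.inl ⟨R, rfl⟩)))
  have h2 := fun R i => h _ (Or.inr (Or.inl (Or.inr ⟨⟨R, i⟩, rfl⟩)))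
  have h3 := fun i => h _ (Or.inr (Or.inr (Or.inl (Or.inl ⟨i, rfl⟩))))
  have h4 := fun i j => h _ (Or.inr (Or.inr (Or.inl (Or.inr ⟨⟨i, j⟩, rfl⟩))))
  have h5 := fun i => h _ (Or.inr (Or.inr (Or.inr ⟨i, rfl⟩)))
  have hM := measurable_toModel hX h1 h2
  refine Count.measurable_to_arrow ((measurable_functor_obj A).comp hM) (measurable_obj hA)
    fun k l => ?_
  refine (Measurable.exists fun i : A.I => Measurable.exists fun v : Fin (A.n i) → ℕ =>
    ((measurable_rankN (A := A) ⟨i, v⟩ k).comp hM).and (Measurable.exists fun m : ℕ =>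
      (Count.measurable_lt (measurable_obj (h3 i)) m).and
      ((Measurable.forall fun j => (Count.measurable_maps m (v j)).comp (h4 i j)).and
        ((Count.measurable_maps m l).comp (h5 i))))).congr_prop fun x => ?_
  constructor
  · rintro ⟨i, v, ⟨p, hp, rfl⟩, m, hm, hv, hl⟩
    obtain ⟨i, y, hy⟩ := p
    obtain ⟨rfl, hp⟩ := Sigma.mk.inj_iff.1 hp
    obtain rfl := eq_of_heq hp
    choose hm' hv using hv
    obtain ⟨_, hl⟩ := hl
    refine ⟨(num (F x).pushModel A _).2, ?_⟩
    refine (congrArg Subtype.val ((zetaHom_num (F x) _).trans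
      ((F x).zeta_cls (r := ⟨m, hm⟩) (funext fun j => Subtype.ext (hv j))))).trans hl
  · rintro ⟨h, rfl⟩
    obtain ⟨a, ha⟩ := (num (F x).pushModel A).surjective ⟨k, h⟩
    obtain ⟨p, rfl⟩ := Pt.cls_surj a
    obtain ⟨r, hr⟩ := (F x).exists_coords p
    refine ⟨p.i, fun j => p.x j, ⟨p, rfl, congrArg Subtype.val ha⟩, r, r.2,
      fun j => ⟨r.2, congrArg Subtype.val (congrFun hr j)⟩, r.2, ?_⟩
    refine congrArg Subtype.val ?_
    refine ((F x).zeta_cls hr).symm.trans ((zetaHom_num (F x) _).symm.trans ?_)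
    rw [ha]
    rfl

theorem isRetraction (T : Theory) : IsRetraction T (Model.toCoh T) (toModel T) (zetaNat T) where
  push_eq := rfl
  retract := ⟨toCoh_comp_toModel T, zetaHom_toCoh⟩
  borel_obj := measurable_functor_obj
  borel_map := measurable_trans
  borel_nat := measurable_functor_map
  borel_zeta A := by
    obtain ⟨S, h0, h1, h2, h3⟩ := exists_subcategory (countable_zetaArrows A)
    refine ⟨S, h1, h2, h3, ?_⟩
    let d : CohFun (ImSort T) Count → (S → Arrow Count) := fun F s =>
      Arrow.mk (F.functor.map s.1.hom)
    -- With the coarsest structure making `F ↦ F|S` measurable, a measurable map to the standard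
    -- Borel space `Arrow Count` factors through that restriction by a Borel map; this factor is
    -- `b`.
    let _ : MeasurableSpace (CohFun (ImSort T) Count) := MeasurableSpace.comap d inferInstance
    have hd : Measurable d := comap_measurable d
    have : Nonempty (Arrow Count) := ⟨Arrow.mk (𝟙 Count.one)⟩
    have hz : Measurable fun F : CohFun (ImSort T) Count =>
        Arrow.mk ((zetaHom F).iso.hom.app A) :=
      measurable_zetaHom (F := fun F => F) A fun f hf =>
        (measurable_pi_apply (⟨f, h0 hf⟩ : S)).comp hd
    obtain ⟨b, hb, hb'⟩ := hz.exists_eq_measurable_comp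
    exact ⟨b, hb, fun F => congrFun hb' F⟩

end ZetaBorel


section MOD

variable {T S R : Theory}

/-! ### The triangle identities -/

/-- `ζ_F` as an isomorphism. -/
noncomputable def zetaIso (F : CohFun (ImSort T) Count) : (Model.toCoh T).obj F.pushModel ≅ F where
  hom := zetaHom F
  inv := Groupoid.inv (zetaHom F)
  hom_inv_id := Groupoid.comp_inv _
  inv_hom_id := Groupoid.inv_comp _

/-- The equality `L(K(M)) = M` as an isomorphism. -/
noncomputable def etaIso (M : Model T) : ((Model.toCoh T).obj M).pushModel ≅ M := eqToIso (pushModel_toCoh M)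

theorem etaIso_val (M : Model T) (a : ((Model.toCoh T).obj M).pushModel.str.dom.El) :
    (Model.homEquiv (etaIso M).hom a : ℕ) = a := Model.eqToHom_val (pushModel_toCoh M) a

theorem zeta_naturality {F G : CohFun (ImSort T) Count} (τ : F ⟶ G) :
    (Model.toCoh T).map ((toModel T).map τ) ≫ (zetaIso G).hom = (zetaIso F).hom ≫ τ :=
  (zetaNat T).naturality τ

theorem eta_naturality {M N : Model T} (g : M ⟶ N) :
    (toModel T).map ((Model.toCoh T).map g) ≫ (etaIso N).hom = (etaIso M).hom ≫ g :=
  Model.hom_ext fun a => (etaIso_val N _).trans (toCoh_map_val g a _ (etaIso_val M a).symm)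

/-- One triangle identity: both sides are the identity on underlying numbers. -/
theorem toModel_map_zeta (F : CohFun (ImSort T) Count) :
    (toModel T).map (zetaIso F).hom = (etaIso F.pushModel).hom :=
  Model.hom_ext fun a => (zetaHom_val F a).trans (etaIso_val _ a).symm

/-- The other triangle identity: both sides are transports along the equality `L(K(M)) = M`. -/
theorem toCoh_map_eta (M : Model T) :
    (Model.toCoh T).map (etaIso M).hom = (zetaIso ((Model.toCoh T).obj M)).hom := by
  refine Eq.trans ?_ (zetaHom_toCoh M).symm
  exact eqToHom_map (Model.toCoh T) (pushModel_toCoh M)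

/-! ### Borelness of the functors and transformations induced by interpretations -/

variable {X : Type} [MeasurableSpace X]

theorem measurable_toModel_map {F G : X → CohFun (ImSort T) Count} (τ : ∀ x, F x ⟶ G x)
    (hF : Measurable fun x => (F x).pushModel) (hG : Measurable fun x => (G x).pushModel)
    (hτ : Measurable fun x => Arrow.mk ((τ x).iso.hom.app (homeSort T))) :
    Measurable fun x => Arrow.mk ((toModel T).map (τ x)) :=
  Model.measurable_to_arrow hF hG fun k l => (Count.measurable_maps k l).comp hτ

theorem measurable_inv {M N : X → Model T} (e : ∀ x, M x ≅ N x)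
    (h : Measurable fun x => Arrow.mk (e x).hom) : Measurable fun x => Arrow.mk (e x).inv :=
  Model.measurable_to_arrow (Model.measurable_tgt.comp h) (Model.measurable_src.comp h) fun k l =>
    ((Model.measurable_maps l k).comp h).congr_prop fun x => by
      refine (Model.maps_inv (Arrow.mk (e x).hom) k l).symm.trans ?_
      have : Groupoid.inv (e x).hom = (e x).inv := by
        rw [Groupoid.inv_eq_inv, IsIso.Iso.inv_hom]
      exact iff_of_eq (congrArg (fun g => Model.Maps (Arrow.mk g) k l) this)

theorem measurable_etaIso : Measurable fun M : Model T => Arrow.mk (etaIso M).hom := by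
  have : ∀ {M N : Model T} (h : M = N), Arrow.mk (eqToHom h) = Arrow.mk (𝟙 N) := by
    rintro M _ rfl
    rfl
  exact (funext fun M => this (pushModel_toCoh M)) ▸ (modGpd T).one

/-- The value of `G^* K(M)` at a morphism `f` is the value of `K(M)` at the fixed morphism `G f`,
which is Borel in `M`. -/
theorem measurable_pullback (G : CohFun (ImSort S) (ImSort T)) :
    Measurable fun M : Model T => (G.comp ((Model.toCoh T).obj M)).pushModel :=
  measurable_toModel (F := fun M : Model T => G.comp ((Model.toCoh T).obj M))
    (measurable_functor_map _) (fun _ => measurable_functor_map _)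
    fun _ _ => measurable_functor_map _

/-- The Borel functor `F_*(X) ↤ F` induced by an interpretation. -/
noncomputable def modFun (G : CohFun (ImSort S) (ImSort T)) :
    BorGpd.Fun (modGpd T) (modGpd S) where
  -- Precomposition with `G` is conjugated by `K` and `L`: the pseudofunctor is transported from
  -- coherent functors to models.
  functor := Model.toCoh T ⋙ CohFun.precomp G Count ⋙ toModel S
  obj := measurable_pullback G
  map := measurable_toModel_map (X := Arrow (Model T))
    (fun g => (CohFun.precomp G Count).map ((Model.toCoh T).map g.hom))
    ((measurable_pullback G).comp Model.measurable_src)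
    ((measurable_pullback G).comp Model.measurable_tgt)
    (measurable_trans (G.functor.obj (homeSort S)))

/-- The Borel natural transformation induced by a natural isomorphism of interpretations. -/
noncomputable def modTrans {G G' : CohFun (ImSort S) (ImSort T)} (σ : G ⟶ G') :
    BorGpd.Trans (modFun G) (modFun G') where
  nat :=
    { app := fun M => (toModel S).map (CohFun.whR σ ((Model.toCoh T).obj M))
      naturality := fun M N g => by
        refine ((toModel S).map_comp _ _).symm.trans
          (Eq.trans (congrArg _ ?_) ((toModel S).map_comp _ _))
        refine CohFun.hom_ext fun A => ?_
        exact (((Model.toCoh T).map g).iso.hom.naturality (σ.iso.hom.app A)).symm }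
  app := measurable_toModel_map (X := Model T) (fun M => CohFun.whR σ ((Model.toCoh T).obj M))
    (measurable_pullback G) (measurable_pullback G')
    (measurable_functor_map (σ.iso.hom.app (homeSort S)))

/-- The unit constraint of `MOD`. -/
noncomputable def modId (T : Theory) : modFun (CohFun.idFun (ImSort T)) ≅ BorGpd.idFun (modGpd T) :=
  BorGpd.isoOf (NatIso.ofComponents (etaIso (T := T)) eta_naturality) measurable_etaIso
    (measurable_inv etaIso measurable_etaIso)

/-- The composition constraint of `MOD` at a model. -/
noncomputable def modCompIso (G : CohFun (ImSort S) (ImSort T)) (G' : CohFun (ImSort R) (ImSort S))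
    (M : Model T) : (toModel R).obj (G'.comp ((Model.toCoh S).obj
      ((toModel S).obj (G.comp ((Model.toCoh T).obj M))))) ≅
        (toModel R).obj (G'.comp (G.comp ((Model.toCoh T).obj M))) :=
  -- The two sides differ by a factor `K ∘ L` in the middle, which is removed by `ζ` at `G^* K(M)`.
  (CohFun.precomp G' Count ⋙ toModel R).mapIso (zetaIso (G.comp ((Model.toCoh T).obj M)))

theorem measurable_modCompIso (G : CohFun (ImSort S) (ImSort T))
    (G' : CohFun (ImSort R) (ImSort S)) :
    Measurable fun M : Model T => Arrow.mk (modCompIso G G' M).hom :=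
  measurable_toModel_map (X := Model T) (fun M => (CohFun.precomp G' Count).map
      (zetaIso (G.comp ((Model.toCoh T).obj M))).hom)
    ((measurable_pullback G').comp (measurable_pullback G)) (measurable_pullback (G'.comp G))
    (measurable_zetaHom (F := fun M : Model T => G.comp ((Model.toCoh T).obj M)) _
      fun _ _ => measurable_functor_map _)

/-- The composition constraint of `MOD`. -/
noncomputable def modComp (G : CohFun (ImSort S) (ImSort T)) (G' : CohFun (ImSort R) (ImSort S)) :
    modFun (G'.comp G) ≅ BorGpd.comp (modFun G) (modFun G') :=
  (BorGpd.isoOf (F := BorGpd.comp (modFun G) (modFun G')) (F' := modFun (G'.comp G))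
    (NatIso.ofComponents (modCompIso G G') fun g =>
      ((CohFun.precomp G' Count ⋙ toModel R).map_comp _ _).symm.trans ((congrArg _
        (zeta_naturality ((CohFun.precomp G Count).map ((Model.toCoh T).map g)))).trans
          ((CohFun.precomp G' Count ⋙ toModel R).map_comp _ _)))
    (measurable_modCompIso G G')
    (measurable_inv (modCompIso G G') (measurable_modCompIso G G'))).symm

/-! ### The pseudofunctor -/

section

variable {C D : Type} [Category.{0} C] [Category.{0} D] (P : C ⥤ D) {a b c d e : C}

/-- Evaluated at a model, a coherence law for `MOD` is an equation between composites of images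
under one functor, with identities interspersed. These lemmas reduce it to a single equation before
that functor is applied. -/
theorem map_comp₃ {f₁ : a ⟶ b} {f₂ : b ⟶ c} {f₃ : c ⟶ d} {g : a ⟶ d} (h : f₁ ≫ f₂ ≫ f₃ = g) :
    P.map f₁ ≫ P.map f₂ ≫ P.map f₃ = P.map g := by
  rw [← h, P.map_comp, P.map_comp]

theorem map_comp₄ {f₁ : a ⟶ b} {f₂ : b ⟶ c} {f₃ : c ⟶ d} {f₄ : d ⟶ e} {g : a ⟶ e}
    (h : f₁ ≫ f₂ ≫ f₃ ≫ f₄ = g) :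
    P.map f₁ ≫ P.map f₂ ≫ 𝟙 _ ≫ P.map f₃ ≫ P.map f₄ = P.map g := by
  rw [← h, P.map_comp, P.map_comp, P.map_comp, Category.id_comp]

theorem map_comp₂ {f₁ : a ⟶ b} {f₂ : b ⟶ c} {g : a ⟶ c} (h : f₁ ≫ f₂ = g) :
    P.map f₁ ≫ P.map f₂ ≫ 𝟙 _ = P.map g := by
  rw [← h, P.map_comp, Category.comp_id]

end

theorem whisker_zeta (H : CohFun (ImSort T) Count) {G G' : CohFun (ImSort S) (ImSort T)}
    (σ : G ⟶ G') : (CohFun.precomp G Count).map (zetaIso H).inv ≫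
      CohFun.whR σ ((Model.toCoh T).obj H.pushModel) ≫
        (CohFun.precomp G' Count).map (zetaIso H).hom = CohFun.whR σ H :=
  CohFun.hom_ext fun A => NatIso.naturality_1 (zetaHom H).iso (σ.iso.hom.app A)

theorem zeta_conj {F G : CohFun (ImSort T) Count} (τ : F ⟶ G) :
    (zetaIso F).inv ≫ (Model.toCoh T).map ((toModel T).map τ) ≫ (zetaIso G).hom = τ := by
  exact (congrArg ((zetaIso F).inv ≫ ·) (zeta_naturality τ)).trans (Iso.inv_hom_id_assoc _ _)

/-- Naturality of `ζ` along `G^* ζ_F⁻¹` collapses the first three factors to that map, which then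
cancels against `G^* ζ_F`. This is the content of associativity for `MOD`. -/
theorem zeta_assoc (G : CohFun (ImSort S) (ImSort T)) (F : CohFun (ImSort T) Count) :
    (zetaIso (G.comp F)).inv ≫ (Model.toCoh S).map ((toModel S).map
      ((CohFun.precomp G Count).map (zetaIso F).inv)) ≫
        (zetaIso (G.comp ((Model.toCoh T).obj F.pushModel))).hom ≫
          (CohFun.precomp G Count).map (zetaIso F).hom = 𝟙 (G.comp F) := by
  have h := zeta_conj ((CohFun.precomp G Count).map (zetaIso F).inv)
  have h2 : (CohFun.precomp G Count).map (zetaIso F).inv ≫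
      (CohFun.precomp G Count).map (zetaIso F).hom = 𝟙 (G.comp F) := by
    rw [← Functor.map_comp, Iso.inv_hom_id]
    exact (CohFun.precomp G Count).map_id _
  refine Eq.trans ?_ h2
  refine Eq.trans ?_ (congrArg (· ≫ (CohFun.precomp G Count).map (zetaIso F).hom) h)
  exact ((Category.assoc _ _ _).trans (congrArg (_ ≫ ·) (Category.assoc _ _ _))).symm

open Opposite

/-- The pseudofunctor `MOD`. -/
noncomputable def MOD : Pseudofunctor Theoryᵒᵖ BorGpd where
  obj T := modGpd T.unop
  map F := modFun F.unop
  map₂ s := modTrans s.unop2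
  map₂_id {a _} F := by
    apply BorGpd.hom_ext; intro M
    refine Eq.trans (congrArg (toModel _).map ?_) ((toModel _).map_id _)
    exact CohFun.hom_ext fun A => ((Model.toCoh a.unop).obj M).functor.map_id _
  map₂_comp {a _ _ _ _} s t := by
    apply BorGpd.hom_ext; intro M
    refine Eq.trans (congrArg (toModel _).map ?_) ((toModel _).map_comp _ _)
    exact CohFun.hom_ext fun A => ((Model.toCoh a.unop).obj M).functor.map_comp _ _
  mapId T := modId T.unop
  mapComp F F' := modComp F.unop F'.unop
  map₂_whisker_left {a _ _} F _ _ s := by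
    apply BorGpd.hom_ext; intro M
    exact (map_comp₃ (toModel _) (whisker_zeta (F.unop.comp ((Model.toCoh a.unop).obj M)) s.unop2)).symm
  map₂_whisker_right {a _ _ _ _} s F := by
    apply BorGpd.hom_ext; intro M
    exact (map_comp₃ (CohFun.precomp F.unop Count ⋙ toModel _)
      (zeta_conj (CohFun.whR s.unop2 ((Model.toCoh a.unop).obj M)))).symm
  map₂_associator {a _ _ _} F F' F'' := by
    apply BorGpd.hom_ext; intro M
    refine Eq.trans ?_ (map_comp₄ (CohFun.precomp F''.unop Count ⋙ toModel _)
      (zeta_assoc F'.unop (F.unop.comp ((Model.toCoh a.unop).obj M)))).symm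
    refine congrArg (toModel _).map (CohFun.hom_ext fun A => ?_)
    exact ((Model.toCoh a.unop).obj M).functor.map_id _
  -- The left unit law rests on the triangle identity `K η = ζ K`.
  map₂_left_unitor {a _} F := by
    apply BorGpd.hom_ext; intro M
    refine Eq.trans ?_ (map_comp₂ (CohFun.precomp F.unop Count ⋙ toModel _)
      ((congrArg ((zetaIso ((Model.toCoh a.unop).obj M)).inv ≫ ·) (toCoh_map_eta M)).trans
        (Iso.inv_hom_id _))).symm
    refine congrArg (toModel _).map (CohFun.hom_ext fun A => ?_)
    exact ((Model.toCoh a.unop).obj M).functor.map_id _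
  -- The right unit law rests on the triangle identity `L ζ = η L`.
  map₂_right_unitor {a _} F := by
    apply BorGpd.hom_ext; intro M
    refine Eq.trans ?_ ((congrArg (fun g => (toModel _).map (zetaIso (F.unop.comp
      ((Model.toCoh a.unop).obj M))).inv ≫ g ≫ 𝟙 _) (toModel_map_zeta (F.unop.comp
      ((Model.toCoh a.unop).obj M)))).symm.trans (map_comp₂ (toModel _) (Iso.inv_hom_id _))).symm
    refine congrArg (toModel _).map (CohFun.hom_ext fun A => ?_)
    exact ((Model.toCoh a.unop).obj M).functor.map_id _

end MOD


/-! ### The adjoint equivalence of `K` and `L`. -/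

section Equivalence

open Opposite Bicategory
open scoped CategoryTheory.Pseudofunctor.StrongTrans

section

variable {C D : Type} [Category.{0} C] [Category.{0} D] (P : C ⥤ D) {a b c d e : C}

/-- Here and in the next lemmas are the shapes that the pseudonaturality, modification and triangle
axioms take at a component. The identity cells are kept in place, and each axiom is reduced to the
equations about `ζ` and `η` that carry it. -/
theorem comp_id_eq_map {f : a ⟶ b} {z : P.obj a ⟶ P.obj b} (h : P.map f = z) :
    z ≫ 𝟙 _ = P.map (f ≫ 𝟙 _) ≫ 𝟙 _ ≫ 𝟙 _ := by simp [h]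

theorem comp_id_eq_map_comp {x y : D} {f : a ⟶ b} {z : P.obj a ⟶ y} {z' : P.obj b ⟶ x} {w : x ⟶ y}
    (h : P.map f ≫ z' ≫ w = z) :
    z ≫ 𝟙 _ = P.map (f ≫ 𝟙 _) ≫ 𝟙 _ ≫ z' ≫ 𝟙 _ ≫ w ≫ 𝟙 _ := by simp [← h]

theorem map_square {f : a ⟶ b} {g : b ⟶ d} {f' : a ⟶ c} {g' : c ⟶ d} (h : f ≫ g = f' ≫ g') :
    P.map f ≫ P.map g = P.map f' ≫ P.map g' := by
  rw [← P.map_comp, h, P.map_comp]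

theorem map_inv_comp (i : a ≅ b) {e : P.obj a ⟶ P.obj b} (h : P.map i.hom = e) :
    P.map i.inv ≫ (e ≫ 𝟙 _) = P.map (𝟙 _) ≫ 𝟙 _ ≫ 𝟙 _ := by simp [← h, ← P.map_comp]

theorem map_square_comp_id {f : a ⟶ b} {g : b ⟶ d} {f' : a ⟶ c} {g' : c ⟶ d}
    (h : f ≫ g = f' ≫ g') {z : P.obj a ⟶ P.obj a} (hz : z = 𝟙 _) :
    P.map f ≫ (P.map g ≫ 𝟙 _) = z ≫ 𝟙 _ ≫ P.map f' ≫ 𝟙 _ ≫ P.map g' ≫ 𝟙 _ := by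
  rw [hz, Category.comp_id, Category.comp_id, Category.id_comp, Category.id_comp, Category.id_comp,
    ← P.map_comp, h, P.map_comp]

theorem inv_comp_comp {x y z : D} (i : x ≅ y) {u : x ⟶ y} {v w : y ⟶ z} (hu : u = i.hom)
    (h : v = w) : i.inv ≫ (𝟙 _ ≫ u ≫ 𝟙 _ ≫ v ≫ 𝟙 _) = (𝟙 _ ≫ 𝟙 _) ≫ w := by simp [hu, h]

theorem comp_id_eq_comp {x y z w : D} {t : x ⟶ w} {u : x ⟶ y} {v : y ⟶ z} {r : z ⟶ w}
    (h : u ≫ v ≫ r = t) :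
    t ≫ (𝟙 _ ≫ 𝟙 _) = (𝟙 _ ≫ u ≫ 𝟙 _ ≫ v ≫ 𝟙 _) ≫ r := by simp [h]

theorem inv_comp_hom {x y : D} (i : x ≅ y) {u : y ⟶ x} (h : u = i.inv) :
    u ≫ 𝟙 _ ≫ i.hom = 𝟙 _ ≫ 𝟙 _ := by simp [h]

end

variable {T S : Theory}

theorem zeta_comp (G : CohFun (ImSort S) (ImSort T)) (F : CohFun (ImSort T) Count) :
    (Model.toCoh S).map ((toModel S).map ((CohFun.precomp G Count).map (zetaIso F).inv)) ≫
        (zetaIso (G.comp ((Model.toCoh T).obj F.pushModel))).hom ≫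
          (CohFun.precomp G Count).map (zetaIso F).hom = (zetaIso (G.comp F)).hom :=
  ((Iso.inv_comp_eq _).1 (zeta_assoc G F)).trans (Category.comp_id _)

theorem zeta_inv_naturality {F G : CohFun (ImSort T) Count} (τ : F ⟶ G) :
    τ ≫ (zetaIso G).inv = (zetaIso F).inv ≫ (Model.toCoh T).map ((toModel T).map τ) :=
  (Iso.comp_inv_eq _).2 (((Category.assoc _ _ _).trans (zeta_conj τ)).symm)

theorem whisker_zeta_inv (H : CohFun (ImSort T) Count) {G G' : CohFun (ImSort S) (ImSort T)}
    (σ : G ⟶ G') : CohFun.whR σ H ≫ (CohFun.precomp G' Count).map (zetaIso H).inv =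
      (CohFun.precomp G Count).map (zetaIso H).inv ≫ CohFun.whR σ ((Model.toCoh T).obj H.pushModel) :=
  CohFun.hom_ext fun A => (zetaIso H).inv.iso.hom.naturality (σ.iso.hom.app A)

theorem toCoh_map_eta_inv (M : Model T) :
    (Model.toCoh T).map (etaIso M).inv = (zetaIso ((Model.toCoh T).obj M)).inv :=
  congrArg Iso.inv (show (Model.toCoh T).mapIso (etaIso M) = zetaIso ((Model.toCoh T).obj M) from
    Iso.ext (toCoh_map_eta M))

/-- `MOD` with values in small groupoids. -/
noncomputable abbrev modPsf : Pseudofunctor Theoryᵒᵖ Gpd := MOD.comp forgetBorel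

/-- The pseudonatural transformation `K`. -/
noncomputable def transK : modPsf ⟶ cohPsf :=
  show Pseudofunctor.StrongTrans modPsf cohPsf from
  { app := fun T => Model.toCoh T.unop
    -- Following `MOD(f)` by `K` gives `K L f^* K`, which `ζ` at `f^* K(M)` compares with `f^* K`.
    naturality := fun {a b} f => NatIso.ofComponents
      (F := (Model.toCoh a.unop ⋙ CohFun.precomp f.unop Count ⋙ toModel b.unop) ⋙ Model.toCoh b.unop)
      (G := Model.toCoh a.unop ⋙ CohFun.precomp f.unop Count)
      (fun M => zetaIso (f.unop.comp ((Model.toCoh a.unop).obj M))) fun g => zeta_naturality _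
    naturality_naturality := fun {a b f g} s => by
      apply NatTrans.ext; funext M
      exact zeta_naturality (CohFun.whR s.unop2 ((Model.toCoh a.unop).obj M))
    naturality_id := fun a => by
      apply NatTrans.ext; funext M
      exact comp_id_eq_map (Model.toCoh a.unop) (toCoh_map_eta M)
    naturality_comp := fun {a b c} f g => by
      apply NatTrans.ext; funext M
      exact comp_id_eq_map_comp (Model.toCoh c.unop)
        (zeta_comp g.unop (f.unop.comp ((Model.toCoh a.unop).obj M))) }

/-- The pseudonatural transformation `L`. -/
noncomputable def transL : cohPsf ⟶ modPsf :=
  show Pseudofunctor.StrongTrans cohPsf modPsf from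
  { app := fun T => toModel T.unop
    -- Following `L` by `MOD(f)` gives `L f^* K L`, and `L f^*` maps to it by the image of `ζ⁻¹`.
    naturality := fun {a b} f => NatIso.ofComponents
      (F := CohFun.precomp f.unop Count ⋙ toModel b.unop)
      (G := toModel a.unop ⋙ Model.toCoh a.unop ⋙ CohFun.precomp f.unop Count ⋙ toModel b.unop)
      (fun F => (CohFun.precomp f.unop Count ⋙ toModel b.unop).mapIso (zetaIso F).symm) fun τ => by
        exact map_square (CohFun.precomp f.unop Count ⋙ toModel b.unop) (zeta_inv_naturality τ)
    naturality_naturality := fun {a b f g} s => by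
      apply NatTrans.ext; funext F
      exact map_square (toModel b.unop) (whisker_zeta_inv F s.unop2)
    naturality_id := fun a => by
      apply NatTrans.ext; funext F
      exact map_inv_comp (toModel a.unop) (zetaIso F) (toModel_map_zeta F)
    naturality_comp := fun {a b c} f g => by
      apply NatTrans.ext; funext F
      exact map_square_comp_id (CohFun.precomp g.unop Count ⋙ toModel c.unop)
        (zeta_inv_naturality ((CohFun.precomp f.unop Count).map (zetaIso F).inv))
        ((toModel c.unop).map_id _) }

/-- The unit. -/
noncomputable def unitKL : 𝟙 modPsf ≅ transK ≫ transL :=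
  Pseudofunctor.StrongTrans.isoMk
    (fun T => (show transK.app T ≫ transL.app T ≅ 𝟙 _ from NatIso.ofComponents
      (F := Model.toCoh T.unop ⋙ toModel T.unop) (G := 𝟭 (Model T.unop))
      etaIso eta_naturality).symm)
    fun {a b} f => by
      apply NatTrans.ext; funext M
      exact inv_comp_comp (etaIso (f.unop.comp ((Model.toCoh a.unop).obj M)).pushModel)
        (toModel_map_zeta (f.unop.comp ((Model.toCoh a.unop).obj M)))
        (congrArg (CohFun.precomp f.unop Count ⋙ toModel b.unop).map (toCoh_map_eta_inv M).symm)

/-- The counit `ζ`. -/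
noncomputable def counitKL : transL ≫ transK ≅ 𝟙 cohPsf :=
  Pseudofunctor.StrongTrans.isoMk
    (fun T => show transL.app T ≫ transK.app T ≅ 𝟙 _ from NatIso.ofComponents
      (F := toModel T.unop ⋙ Model.toCoh T.unop) (G := 𝟭 (CohFun (ImSort T.unop) Count))
      zetaIso zeta_naturality)
    fun {a b} f => by
      apply NatTrans.ext; funext F
      exact comp_id_eq_comp (zeta_comp f.unop F)

/-- The adjoint equivalence between `MOD` and `Coh`. -/
noncomputable def equivKL : Bicategory.Equivalence modPsf cohPsf where
  hom := transK
  inv := transL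
  unit := unitKL
  counit := counitKL
  -- At a model `M` this is the cancellation of `K η⁻¹` against `ζ` at `K(M)`.
  left_triangle := by
    apply Iso.ext
    simp only [leftZigzagIso_hom, leftZigzag, bicategoricalComp, BicategoricalCoherence.iso,
      Iso.trans_hom, whiskerRightIso_hom, Iso.refl_hom, id_whiskerRight, Category.comp_id]
    apply Pseudofunctor.StrongTrans.homCategory.ext
    intro T
    apply NatTrans.ext; funext M
    exact inv_comp_hom (zetaIso ((Model.toCoh T.unop).obj M)) (toCoh_map_eta_inv M)

end Equivalence

end Lw1w

open scoped CategoryTheory.Pseudofunctor.StrongTrans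
theorem mainTheorem10 :
    ∃ (MOD : Pseudofunctor Lw1w.Theoryᵒᵖ Lw1w.BorGpd)
      (h : ∀ T : Lw1w.Theory, Lw1w.modGpd T = MOD.obj (Opposite.op T))
      (e : Bicategory.Equivalence (MOD.comp Lw1w.forgetBorel) Lw1w.cohPsf),
      ∀ T : Lw1w.Theory, Lw1w.IsRetractionAt T (h T) (e.hom.app (Opposite.op T))
        (e.inv.app (Opposite.op T)) (e.counit.hom.as.app (Opposite.op T)) :=
  -- On objects `MOD` is `modGpd` by definition, so the transport in `IsRetractionAt` is along `rfl`
  -- and disappears.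
  ⟨Lw1w.MOD, fun _ => rfl, Lw1w.equivKL, fun T => Lw1w.isRetraction T⟩
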